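/- **Setting.** Let $D\ge 1$, $\epsilon>0$, let $\Gamma\in\mathbb R^{D\times D}$ be symmetric positive definite, and let $V:\mathbb R^D\to\mathbb R$ be smooth with all partial derivatives of order at least $2$ bounded. Let $\langle f,g\rangle=\int_{\mathbb R^D}\overline{f}\,g\,dx$ and, for $z=(q,p)\in\mathbb R^{2D}$, $$g_z(x)=\Big(\tfrac{\det\Gamma}{\pi^D\epsilon^D}\Big)^{1/4}\exp\Big(-\tfrac1{2\epsilon}(x-q)^T\Gamma(x-q)+\tfrac i\epsilon p^T(x-q)\Big).$$ Let $z(t)=(q(t),p(t))$ be the solution of $\dot q=p$, $\dot p=-\nabla V(q)$ with $z(0)=z$, let $S_t(z)=\int_0^t\big(\tfrac12|p(s)|^2-V(q(s))\big)ds$, let $M_{qq},M_{qp},M_{pq},M_{pp}$ be the $D\times D$ blocks of $\partial z(t)/\partial z$, and let $$R_t(z)=2^{-D/2}\det\big(M_{qq}+\Gamma^{-1}M_{pp}\Gamma-iM_{qp}\Gamma+i\Gamma^{-1}M_{pq}\big)^{1/2},$$ with the branch of the square root that is continuous in $t$ and satisfies $R_0(z)=1$. Let $\hat A$ be one of the operators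 $\mathrm{Id}$, $\hat q_j^n$ (multiplication by $x_j^n$), $\hat p_j^n=(-i\epsilon\partial_{x_j})^n$, $T=-\tfrac{\epsilon^2}{2}\Delta$, $V$ (multiplication by $V$), $\hat H=T+V$, where $j\in\{1,\dots,D\}$ and $n\in\mathbb N$ (including $n=0$); $\hat A=0$ means that $\hat A\varphi=0$ for all Schwartz functions $\varphi$. Let $\psi_0\in L^2(\mathbb R^D)$ with $\|\psi_0\|_{L^2}=1$. For $w=(y,z)\in\mathbb R^{2D}\times\mathbb R^{2D}$ put $$f_0(w)=(2\pi\epsilon)^{-2D}\langle\psi_0,g_y\rangle\langle g_z,\psi_0\rangle,\quad \Phi_t(w)=\overline{R_t(y)}R_t(z)e^{i(S_t(z)-S_t(y))/\epsilon},\quad O_t[\hat A](w)=\langle g_{y(t)},\hat A g_{z(t)}\rangle,$$ and let $\langle\hat A\rangle_t=\int_{\mathbb R^{4D}}f_0\Phi_tO_t[\hat A]\,dw$ (taken to be $0$ if the integrand is not integrable). For a density $\rho$ on $\mathbb R^{4D}$ the variance of the crude Monte Carlo estimator with sampling density $\rho$ (per sample, i.e. of its i.i.d. summands) is $$\mathbb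 V_t[\hat A,\psi_0,\rho]=\int_{\mathbb R^{4D}}\Big|\frac{f_0\Phi_tO_t[\hat A]}{\rho}-\langle\hat A\rangle_t\Big|^2\rho\,dw\in[0,\infty].$$ The Husimi density is $\rho_{\rm H}(z)=(2\pi\epsilon)^{-D}|\langle g_z,\psi_0\rangle|^2$; the sqrt-Husimi density is $\rho_{\textup{sqrt-H}}(z)=\kappa^{-1}(2\pi\epsilon)^{-D}|\langle\psi_0,g_z\rangle|$ with $\kappa=(2\pi\epsilon)^{-D}\int_{\mathbb R^{2D}}|\langle\psi_0,g_\zeta\rangle|\,d\zeta$. **Proposition.** Let $\tau>0$. For all $t\in[0,\tau]$: 1. $\mathbb V_t[\hat A,\psi_0,\rho_{\rm H}\otimes\rho_{\rm H}]<\infty$ if and only if $\hat A=0$ (so it is infinite for every operator listed above, except for $\hat A=V$ when $V\equiv0$); 2. if $\psi_0$ is (almost everywhere equal to) a Schwartz function, then $\rho_{\textup{sqrt-H}}$ is a well-defined probability density, $f_0\Phi_tO_t[\hat A]$ is integrable, and $\mathbb V_t[\hat A,\psi_0,\rho_{\textup{sqrt-H}}\otimes\rho_{\textup{sqrt-H}}]<\infty$.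 -/

import Mathlib

open MeasureTheory
open scoped SchwartzMap ContDiff ENNReal

noncomputable section

namespace HermanKluk

/-- Configuration space `ℝ^D` with its Euclidean norm and Lebesgue measure. -/
abbrev Config (D : ℕ) : Type := EuclideanSpace ℝ (Fin D)

/-- Single phase space `ℝ^{2D}`; its points are pairs `z = (q, p)`. -/
abbrev Phase (D : ℕ) : Type := Config D × Config D

/-- Double phase space `ℝ^{4D}`; its points are pairs `w = (y, z)`. -/
abbrev DoublePhase (D : ℕ) : Type := Phase D × Phase D

/-- Smooth potentials of sub-quadratic growth: all derivatives of order at least two are bounded. -/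
def IsSubquadratic {D : ℕ} (V : Config D → ℝ) : Prop :=
  ContDiff ℝ ∞ V ∧ ∀ k : ℕ, 2 ≤ k → ∃ C : ℝ, ∀ x, ‖iteratedFDeriv ℝ k V x‖ ≤ C

/-- The `L²` pairing `⟨f, g⟩ = ∫ conj (f x) * g x dx`. -/
def bracket {D : ℕ} (f g : Config D → ℂ) : ℂ :=
  ∫ x, (starRingEnd ℂ) (f x) * g x

/-- The Gaussian wavepacket `g_z`, `z = (q, p)`, with width matrix `Γ`. -/
def gaussian {D : ℕ} (ε : ℝ) (Γ : Matrix (Fin D) (Fin D) ℝ) (z : Phase D) : Config D → ℂ :=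
  fun x =>
    (((Γ.det / (Real.pi ^ D * ε ^ D)) ^ (1 / 4 : ℝ) : ℝ) : ℂ) *
      Complex.exp
        (-(1 / (2 * (ε : ℂ))) *
            (((x - z.1).ofLp ⬝ᵥ (Γ.mulVec (x - z.1).ofLp) : ℝ) : ℂ) +
          Complex.I / (ε : ℂ) * ((inner ℝ z.2 (x - z.1) : ℝ) : ℂ))

/-! ### Classical dynamics -/

/-- `γ` solves Hamilton's equations `q' = p`, `p' = -∇V(q)` for all times, with `γ(0) = z`. -/
def IsTrajectory {D : ℕ} (V : Config D → ℝ) (z : Phase D) (γ : ℝ → Phase D) : Prop :=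
  γ 0 = z ∧ ∀ t, HasDerivAt γ ((γ t).2, -gradient V (γ t).1) t

/-- The classical flow `z ↦ z(t)`: the position at time `t` of the trajectory started in `z`
(for sub-quadratic `V` this trajectory exists and is unique, as `∇V` is Lipschitz). -/
def flow {D : ℕ} (V : Config D → ℝ) (t : ℝ) (z : Phase D) : Phase D :=
  Classical.epsilon (IsTrajectory V z) t

/-- The classical action `S_t(z) = ∫_0^t (|p(s)|²/2 - V(q(s))) ds`. -/
def action {D : ℕ} (V : Config D → ℝ) (t : ℝ) (z : Phase D) : ℝ :=
  ∫ s in (0 : ℝ)..t, (‖(flow V s z).2‖ ^ 2 / 2 - V (flow V s z).1)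

/-- The stability matrix `M(t) = ∂z(t)/∂z`, as a linear map of phase space. -/
def stability {D : ℕ} (V : Config D → ℝ) (t : ℝ) (z : Phase D) : Phase D →L[ℝ] Phase D :=
  fderiv ℝ (flow V t) z

/-- The block `M_qq = ∂q(t)/∂q`. -/
def stabQQ {D : ℕ} (V : Config D → ℝ) (t : ℝ) (z : Phase D) : Matrix (Fin D) (Fin D) ℝ :=
  Matrix.of fun i j => (stability V t z (EuclideanSpace.single j 1, 0)).1 i

/-- The block `M_qp = ∂q(t)/∂p`. -/
def stabQP {D : ℕ} (V : Config D → ℝ) (t : ℝ) (z : Phase D) : Matrix (Fin D) (Fin D) ℝ :=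
  Matrix.of fun i j => (stability V t z (0, EuclideanSpace.single j 1)).1 i

/-- The block `M_pq = ∂p(t)/∂q`. -/
def stabPQ {D : ℕ} (V : Config D → ℝ) (t : ℝ) (z : Phase D) : Matrix (Fin D) (Fin D) ℝ :=
  Matrix.of fun i j => (stability V t z (EuclideanSpace.single j 1, 0)).2 i

/-- The block `M_pp = ∂p(t)/∂p`. -/
def stabPP {D : ℕ} (V : Config D → ℝ) (t : ℝ) (z : Phase D) : Matrix (Fin D) (Fin D) ℝ :=
  Matrix.of fun i j => (stability V t z (0, EuclideanSpace.single j 1)).2 i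

/-- `det (M_qq + Γ⁻¹ M_pp Γ - i M_qp Γ + i Γ⁻¹ M_pq)`. -/
def hkDet {D : ℕ} (Γ : Matrix (Fin D) (Fin D) ℝ) (V : Config D → ℝ) (t : ℝ) (z : Phase D) : ℂ :=
  Matrix.det
    ((stabQQ V t z + Γ⁻¹ * stabPP V t z * Γ).map Complex.ofReal
      + Complex.I • (Γ⁻¹ * stabPQ V t z - stabQP V t z * Γ).map Complex.ofReal)

/-- `r` is the branch, continuous in time and equal to `1` at time `0`, of
`s ↦ 2^{-D/2} det(…)^{1/2}` along the trajectory started in `z`. -/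
def IsPrefactorBranch {D : ℕ} (Γ : Matrix (Fin D) (Fin D) ℝ) (V : Config D → ℝ) (z : Phase D)
    (r : ℝ → ℂ) : Prop :=
  Continuous r ∧ r 0 = 1 ∧ ∀ s, r s ^ 2 = ((2 : ℂ) ^ D)⁻¹ * hkDet Γ V s z

/-- The Herman--Kluk prefactor `R_t(z)` (the branch exists and is unique, as `hkDet` is
continuous in time, never vanishes, and equals `2^D` at time `0`). -/
def prefactor {D : ℕ} (Γ : Matrix (Fin D) (Fin D) ℝ) (V : Config D → ℝ) (t : ℝ)
    (z : Phase D) : ℂ :=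
  Classical.epsilon (IsPrefactorBranch Γ V z) t

/-! ### Observables -/

/-- The quantum-mechanical operators under consideration: `Id`, `q_j^n`, `p_j^n`, `T`, `V`, `H`. -/
inductive Observable (D : ℕ) : Type
  | identity : Observable D
  | position (j : Fin D) (n : ℕ) : Observable D
  | momentum (j : Fin D) (n : ℕ) : Observable D
  | kinetic : Observable D
  | potential : Observable D
  | hamiltonian : Observable D

/-- The momentum operator `-i ε ∂_j`. -/
def momentumOp {D : ℕ} (ε : ℝ) (j : Fin D) (f : Config D → ℂ) : Config D → ℂ :=
  fun x => -Complex.I * (ε : ℂ) * fderiv ℝ f x (EuclideanSpace.single j 1)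

/-- The kinetic energy operator `T = -(ε²/2) Δ`. -/
def kineticOp {D : ℕ} (ε : ℝ) (f : Config D → ℂ) : Config D → ℂ :=
  fun x => -((ε : ℂ) ^ 2 / 2) * Laplacian.laplacian f x

/-- The action of an observable on (smooth) functions. -/
def Observable.apply {D : ℕ} (ε : ℝ) (V : Config D → ℝ) :
    Observable D → (Config D → ℂ) → Config D → ℂ
  | .identity, f => f
  | .position j n, f => fun x => ((x j : ℝ) : ℂ) ^ n * f x
  | .momentum j n, f => (momentumOp ε j)^[n] f
  | .kinetic, f => kineticOp ε f
  | .potential, f => fun x => (V x : ℂ) * f x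
  | .hamiltonian, f => fun x => kineticOp ε f x + (V x : ℂ) * f x

/-- `Â = 0`, as an operator on Schwartz functions. -/
def Observable.IsZero {D : ℕ} (ε : ℝ) (V : Config D → ℝ) (A : Observable D) : Prop :=
  ∀ φ : 𝓢(Config D, ℂ), A.apply ε V φ = 0

/-! ### The phase-space integrand -/

/-- `f_0(y, z) = (2πε)^{-2D} ⟨ψ₀, g_y⟩ ⟨g_z, ψ₀⟩`. -/
def initialFactor {D : ℕ} (ε : ℝ) (Γ : Matrix (Fin D) (Fin D) ℝ) (ψ₀ : Config D → ℂ)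
    (w : DoublePhase D) : ℂ :=
  (((2 * Real.pi * ε) ^ (2 * D))⁻¹ : ℝ) *
    (bracket ψ₀ (gaussian ε Γ w.1) * bracket (gaussian ε Γ w.2) ψ₀)

/-- `Φ_t(y, z) = conj (R_t(y)) R_t(z) exp(i (S_t(z) - S_t(y)) / ε)`. -/
def phaseFactor {D : ℕ} (ε : ℝ) (Γ : Matrix (Fin D) (Fin D) ℝ) (V : Config D → ℝ) (t : ℝ)
    (w : DoublePhase D) : ℂ :=
  (starRingEnd ℂ) (prefactor Γ V t w.1) * prefactor Γ V t w.2 *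
    Complex.exp (Complex.I * ((action V t w.2 - action V t w.1 : ℝ) : ℂ) / (ε : ℂ))

/-- `O_t[Â](y, z) = ⟨g_{y(t)}, Â g_{z(t)}⟩`. -/
def operatorFactor {D : ℕ} (ε : ℝ) (Γ : Matrix (Fin D) (Fin D) ℝ) (V : Config D → ℝ)
    (A : Observable D) (t : ℝ) (w : DoublePhase D) : ℂ :=
  bracket (gaussian ε Γ (flow V t w.1)) (A.apply ε V (gaussian ε Γ (flow V t w.2)))

/-- The integrand `f_0 Φ_t O_t[Â]`. -/
def integrand {D : ℕ} (ε : ℝ) (Γ : Matrix (Fin D) (Fin D) ℝ) (V : Config D → ℝ)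
    (ψ₀ : Config D → ℂ) (A : Observable D) (t : ℝ) (w : DoublePhase D) : ℂ :=
  initialFactor ε Γ ψ₀ w * phaseFactor ε Γ V t w * operatorFactor ε Γ V A t w

/-- The Herman--Kluk expectation value `⟨Â⟩_t = ∫ f_0 Φ_t O_t[Â] dw`. -/
def expectation {D : ℕ} (ε : ℝ) (Γ : Matrix (Fin D) (Fin D) ℝ) (V : Config D → ℝ)
    (ψ₀ : Config D → ℂ) (A : Observable D) (t : ℝ) : ℂ :=
  ∫ w, integrand ε Γ V ψ₀ A t w

/-- The variance
`𝕍_t[Â, ψ₀, ρ] = ∫ |f_0 Φ_t O_t[Â] / ρ - ⟨Â⟩_t|² ρ dw ∈ [0, ∞]`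
of the crude Monte Carlo integrand with sampling density `ρ`. -/
def variance {D : ℕ} (ε : ℝ) (Γ : Matrix (Fin D) (Fin D) ℝ) (V : Config D → ℝ)
    (ψ₀ : Config D → ℂ) (A : Observable D) (t : ℝ) (ρ : DoublePhase D → ℝ) : ℝ≥0∞ :=
  ∫⁻ w, ENNReal.ofReal
    (‖integrand ε Γ V ψ₀ A t w / (ρ w : ℂ) - expectation ε Γ V ψ₀ A t‖ ^ 2 * ρ w)

/-! ### Sampling densities -/

/-- The Husimi density `ρ_H(z) = (2πε)^{-D} |⟨g_z, ψ₀⟩|²`. -/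
def husimi {D : ℕ} (ε : ℝ) (Γ : Matrix (Fin D) (Fin D) ℝ) (ψ₀ : Config D → ℂ)
    (z : Phase D) : ℝ :=
  ((2 * Real.pi * ε) ^ D)⁻¹ * ‖bracket (gaussian ε Γ z) ψ₀‖ ^ 2

/-- The normalizing constant `κ = (2πε)^{-D} ∫ |⟨ψ₀, g_ζ⟩| dζ`. -/
def sqrtHusimiConst {D : ℕ} (ε : ℝ) (Γ : Matrix (Fin D) (Fin D) ℝ) (ψ₀ : Config D → ℂ) : ℝ :=
  ((2 * Real.pi * ε) ^ D)⁻¹ * ∫ ζ, ‖bracket ψ₀ (gaussian ε Γ ζ)‖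

/-- The sqrt-Husimi density `ρ(z) = (2πε)^{-D} κ⁻¹ |⟨ψ₀, g_z⟩|`. -/
def sqrtHusimi {D : ℕ} (ε : ℝ) (Γ : Matrix (Fin D) (Fin D) ℝ) (ψ₀ : Config D → ℂ)
    (z : Phase D) : ℝ :=
  ((2 * Real.pi * ε) ^ D)⁻¹ / sqrtHusimiConst ε Γ ψ₀ * ‖bracket ψ₀ (gaussian ε Γ z)‖

/-- The product density `ρ ⊗ ρ` on the double phase space. -/
def double {D : ℕ} (ρ : Phase D → ℝ) (w : DoublePhase D) : ℝ := ρ w.1 * ρ w.2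

end HermanKluk

end

open HermanKluk

/-! ### Vector fields with bounded Lipschitz derivative: flow and linearization -/

section ODE

open Set Metric
open scoped NNReal Manifold Topology

variable {E : Type*} [NormedAddCommGroup E] [NormedSpace ℝ E]

/-! Since |a|² ≤ 2|a - E|² + 2|E|² and the sampling densities have finite mass, passing between the
variance and the second moment ∫ |f₀ Φ_t O_t|² / ρ costs only finite terms. Everything is therefore
decided by the second moment.

Husimi sampling. Where the transforms ⟨g_y, ψ₀⟩ and ⟨g_z, ψ₀⟩ do not vanish, their squared moduli
cancel exactly, and the integrand of the second moment is (2πε)^{-2D} |R_t(y)|² |R_t(z)|² |O_t(y,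
z)|². The zeros are negligible: along every line in phase space the transform is a nonvanishing
exponential times the restriction of an entire function (`ae_bracket_gaussian_ne_zero`).
Symplecticity of the stability matrix gives |R_t| ≥ 1 (`two_pow_le_norm_det_hkMatrix`), so it
suffices that ∫ |O_t|² = ∞. The flow is onto and Lipschitz, hence can be removed from this integral
at the cost of a constant (`exists_lintegral_le_mul_lintegral_comp`); preservation of volume is not
needed. By the isometry property of the wavepacket transform in y (`exists_moyal`), what remains is
a multiple of ∫ ‖Â g_z‖² dz. This diverges: Â multiplies g_z by a symbol, |g_{(q,p)}(x)| does not
depend on p, and for Â ≠ 0 and x in a suitable open set the symbol stays away from zero on a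
half-space of momenta p. Conversely, if Â annihilates Schwartz functions, then by locality it
annihilates wavepackets, and the integrand is zero.

Square-root sampling. Here ρ ⊗ ρ is proportional to |⟨g_y, ψ₀⟩| |⟨g_z, ψ₀⟩|, so one power of each
transform survives in the second moment. The prefactor R_t is bounded, O_t grows at most
polynomially in z and uniformly in y, and for Schwartz ψ₀ the transform decays faster than any power
(`exists_norm_bracket_le`).

Flow and prefactor are defined by choice (`Classical.epsilon`). Hence the preliminary theory: global
trajectories, the derivative of the flow as solution of the linearized equation, existence and
uniqueness of the continuous square root, and its continuity in z, which measurability of the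
integrand requires. -/

/-- A two-sided Grönwall inequality. -/
theorem norm_le_gronwallBound_abs {f f' : ℝ → E} {δ K ε T : ℝ}
    (hf : ∀ t, HasDerivAt f (f' t) t) (h0 : ‖f 0‖ ≤ δ)
    (bound : ∀ t, |t| ≤ T → ‖f' t‖ ≤ K * ‖f t‖ + ε) {t : ℝ} (ht : |t| ≤ T) :
    ‖f t‖ ≤ gronwallBound δ K ε |t| := by
  rcases le_total 0 t with h | h
  · have := norm_le_gronwallBound_of_norm_deriv_right_le (f := f) (f' := f') (δ := δ) (K := K)
      (ε := ε) (a := 0) (b := t) (fun s _ => (hf s).continuousAt.continuousWithinAt)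
      (fun s _ => (hf s).hasDerivWithinAt) h0
      (fun s hs => bound s (by rw [abs_of_nonneg hs.1]; exact hs.2.le.trans ((le_abs_self t).trans ht)))
      t ⟨h, le_rfl⟩
    simpa [abs_of_nonneg h] using this
  · have hd : ∀ s, HasDerivAt (fun s => f (-s)) (-f' (-s)) s := fun s => by
      simpa [Function.comp_def] using (hf (-s)).scomp s (hasDerivAt_neg s)
    have := norm_le_gronwallBound_of_norm_deriv_right_le (f := fun s => f (-s))
      (f' := fun s => -f' (-s)) (δ := δ) (K := K)
      (ε := ε) (a := 0) (b := -t) (fun s _ => (hd s).continuousAt.continuousWithinAt)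
      (fun s _ => (hd s).hasDerivWithinAt) (by simpa using h0)
      (fun s hs => by
        rw [norm_neg]
        refine bound (-s) ?_
        rw [abs_neg, abs_of_nonneg hs.1]
        exact hs.2.le.trans ((neg_le_abs t).trans ht))
      (-t) ⟨by linarith, le_rfl⟩
    simpa [abs_of_nonpos h] using this

/-- The uniform time lemma in a vector space. -/
theorem exists_global_trajectory [CompleteSpace E] {G : E → E} (hG : ContDiff ℝ 1 G) {h : ℝ}
    (hh : 0 < h)
    (hloc : ∀ x, ∃ γ : ℝ → E, γ 0 = x ∧ ∀ t ∈ Ioo (-h) h, HasDerivAt γ (G (γ t)) t) (x : E) :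
    ∃ γ : ℝ → E, γ 0 = x ∧ ∀ t, HasDerivAt γ (G (γ t)) t := by
  obtain ⟨γ, h0, hγ⟩ := exists_isMIntegralCurve_of_isMIntegralCurveOn (I := 𝓘(ℝ, E)) (M := E)
    (v := G) (contMDiff_vectorSpace_iff_contDiff.2 hG) hh
    (fun x => by
      obtain ⟨γ, h0, hγ⟩ := hloc x
      refine ⟨γ, h0, fun t ht => ?_⟩
      exact (hγ t ht).hasFDerivAt.hasMFDerivAt.hasMFDerivWithinAt) x
  refine ⟨γ, h0, fun t => ?_⟩
  have : HasFDerivAt γ ((1 : ℝ →L[ℝ] ℝ).smulRight (G (γ t))) t := (hγ t).hasFDerivAt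
  exact this.hasDerivAt.congr_deriv (by simp)

/-- A vector field with globally bounded, globally Lipschitz derivative. -/
structure IsTameField (F : E → E) (K C : ℝ) : Prop where
  contDiff : ContDiff ℝ 2 F
  pos : 0 < K
  bound : ∀ x, ‖fderiv ℝ F x‖ ≤ K
  lipschitz : ∀ x y, ‖fderiv ℝ F x - fderiv ℝ F y‖ ≤ C * ‖x - y‖

namespace IsTameField

variable {F : E → E} {K C : ℝ}

theorem differentiable (hF : IsTameField F K C) : Differentiable ℝ F :=
  hF.contDiff.differentiable (by norm_num)

theorem norm_sub_le (hF : IsTameField F K C) (x y : E) : ‖F x - F y‖ ≤ K * ‖x - y‖ :=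
  convex_univ.norm_image_sub_le_of_norm_fderiv_le (fun x _ => hF.differentiable x)
    (fun x _ => hF.bound x) (mem_univ y) (mem_univ x)

theorem taylor (hF : IsTameField F K C) (x y : E) :
    ‖F y - F x - fderiv ℝ F x (y - x)‖ ≤ C * ‖y - x‖ ^ 2 := by
  have hC : ∀ z ∈ segment ℝ x y, ‖fderiv ℝ F z - fderiv ℝ F x‖ ≤ C * ‖y - x‖ := by
    intro z hz
    by_cases hC : 0 ≤ C
    · refine (hF.lipschitz z x).trans (mul_le_mul_of_nonneg_left ?_ hC)
      obtain ⟨θ, ⟨h0, h1⟩, rfl⟩ := (segment_eq_image' ℝ x y ▸ hz : z ∈ _)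
      simp only [add_sub_cancel_left, norm_smul, Real.norm_eq_abs, abs_of_nonneg h0]
      exact mul_le_of_le_one_left (norm_nonneg _) h1
    -- `C` is not assumed nonnegative; if it is negative, the Lipschitz bound forces `x = y`.
    · have hxy : ‖y - x‖ = 0 := by
        have h := (norm_nonneg _).trans (hF.lipschitz y x)
        nlinarith [norm_nonneg (y - x)]
      have : y = x := by rwa [norm_eq_zero, sub_eq_zero] at hxy
      subst this
      simp at hz
      simp [hz]
  have := (convex_segment x y).norm_image_sub_le_of_norm_fderiv_le' (𝕜 := ℝ) (f := F)
    (φ := fderiv ℝ F x) (fun z _ => hF.differentiable z) hC (left_mem_segment ℝ x y)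
    (right_mem_segment ℝ x y)
  simpa [pow_two, mul_assoc] using this

/-- The vector field of the flow together with its linearization. -/
noncomputable def variational (F : E → E) (v : E × (E →L[ℝ] E)) : E × (E →L[ℝ] E) :=
  (F v.1, (fderiv ℝ F v.1).comp v.2)

theorem contDiff_variational (hF : IsTameField F K C) : ContDiff ℝ 1 (variational F) := by
  refine (hF.contDiff.of_le (by norm_num) |>.comp contDiff_fst).prodMk ?_
  exact ((hF.contDiff.fderiv_right (m := 1) (by norm_num)).comp contDiff_fst).clm_comp contDiff_snd

/-- Point and linearization are solved for together. The joint field is not globally Lipschitz,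
since `DF(x) ∘ W` varies with `x` at a rate proportional to `W`; but Picard–Lindelöf gives the
existence time `1 / (2K)` for every initial value, and a uniform local time yields a global
solution. -/
theorem exists_trajectory [CompleteSpace E] (hF : IsTameField F K C) (x : E) (W₀ : E →L[ℝ] E) :
    ∃ (γ : ℝ → E) (W : ℝ → E →L[ℝ] E), γ 0 = x ∧ W 0 = W₀ ∧
      (∀ t, HasDerivAt γ (F (γ t)) t) ∧
      ∀ t, HasDerivAt W ((fderiv ℝ F (γ t)).comp (W t)) t := by
  have hK := hF.pos
  have hh : (0 : ℝ) < 1 / (2 * K) := by positivity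
  obtain ⟨γ, h0, hγ⟩ := exists_global_trajectory hF.contDiff_variational hh (fun v => by
    obtain ⟨x, W⟩ := v
    -- The radius is scaled with the initial speed: on the ball of radius `a` the joint field has
    -- norm at most `2 * K * a`, so the time `a / (2 * K * a)` needed to leave the ball does not
    -- depend on the initial value.
    let a : ℝ := ‖F x‖ / K + ‖W‖ + 1
    have ha : 0 < a := by positivity
    have hp : IsPicardLindelof (fun _ => variational F) (tmin := -(1 / (2 * K)))
        (tmax := 1 / (2 * K)) ⟨0, by constructor <;> linarith⟩ (x, W) a.toNNReal 0
        (2 * K * a).toNNReal (K + |C| * (‖W‖ + a)).toNNReal := by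
      have hball : ∀ v ∈ closedBall (x, W) a.toNNReal, ‖v.1 - x‖ ≤ a ∧ ‖v.2‖ ≤ ‖W‖ + a := by
        intro v hv
        rw [Real.coe_toNNReal _ ha.le, mem_closedBall, dist_eq_norm] at hv
        have h1 := (norm_fst_le _).trans hv
        have h2 := (norm_snd_le _).trans hv
        exact ⟨h1, by have := norm_le_norm_add_norm_sub' v.2 W; simp only [Prod.snd_sub] at h2; linarith⟩
      refine ⟨fun _ _ => ?_, fun _ _ => continuousOn_const, fun _ _ v hv => ?_, ?_⟩
      · refine LipschitzOnWith.of_dist_le_mul fun v hv v' hv' => ?_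
        rw [Real.coe_toNNReal _ (by positivity), dist_eq_norm, dist_eq_norm]
        have hv := hball v hv
        have hn1 := norm_fst_le (v - v')
        have hn2 := norm_snd_le (v - v')
        have hn0 := norm_nonneg (v - v')
        simp only [Prod.fst_sub, Prod.snd_sub] at hn1 hn2
        refine norm_prod_le_iff.2 ⟨?_, ?_⟩
        · simp only [variational, Prod.fst_sub]
          refine (hF.norm_sub_le _ _).trans ?_
          have : 0 ≤ |C| * (‖W‖ + a) * ‖v - v'‖ := by positivity
          nlinarith
        · have e : (variational F v - variational F v').2
              = (fderiv ℝ F v.1 - fderiv ℝ F v'.1).comp v.2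
                + (fderiv ℝ F v'.1).comp (v.2 - v'.2) := by
            simp [variational, ContinuousLinearMap.comp_sub, ContinuousLinearMap.sub_comp]
          rw [e]
          refine (norm_add_le _ _).trans ?_
          have h1 := (ContinuousLinearMap.opNorm_comp_le (fderiv ℝ F v.1 - fderiv ℝ F v'.1) v.2)
          have h2 := (ContinuousLinearMap.opNorm_comp_le (fderiv ℝ F v'.1) (v.2 - v'.2))
          have h3 : ‖fderiv ℝ F v.1 - fderiv ℝ F v'.1‖ ≤ |C| * ‖v - v'‖ :=
            (hF.lipschitz _ _).trans (mul_le_mul (le_abs_self C) hn1 (norm_nonneg _) (abs_nonneg C))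
          have h4 : ‖fderiv ℝ F v.1 - fderiv ℝ F v'.1‖ * ‖v.2‖
              ≤ |C| * ‖v - v'‖ * (‖W‖ + a) := mul_le_mul h3 hv.2 (norm_nonneg _) (by positivity)
          have h5 : ‖fderiv ℝ F v'.1‖ * ‖v.2 - v'.2‖ ≤ K * ‖v - v'‖ :=
            mul_le_mul (hF.bound _) hn2 (norm_nonneg _) hK.le
          linarith
      · rw [Real.coe_toNNReal _ (by positivity)]
        have hv := hball v hv
        have hKx : K * (‖F x‖ / K) = ‖F x‖ := by field_simp
        refine norm_prod_le_iff.2 ⟨?_, ?_⟩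
        · have h1 := norm_le_norm_add_norm_sub' (F v.1) (F x)
          have h2 := hF.norm_sub_le v.1 x
          have : K * ‖v.1 - x‖ ≤ K * a := mul_le_mul_of_nonneg_left hv.1 hK.le
          have : ‖F x‖ ≤ K * a := by
            simp only [a]; nlinarith [norm_nonneg W]
          simp only [variational]
          linarith
        · refine (ContinuousLinearMap.opNorm_comp_le _ _).trans ?_
          have : ‖fderiv ℝ F v.1‖ * ‖v.2‖ ≤ K * (‖W‖ + a) :=
            mul_le_mul (hF.bound _) hv.2 (norm_nonneg _) hK.le
          have : ‖W‖ ≤ a := by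
            have : 0 ≤ ‖F x‖ / K := by positivity
            simp only [a]; linarith
          nlinarith
      · rw [Real.coe_toNNReal _ ha.le, Real.coe_toNNReal _ (by positivity)]
        simp only [sub_zero, zero_sub, neg_neg, max_self, NNReal.coe_zero]
        apply le_of_eq
        field_simp
    obtain ⟨α, hα, hd⟩ := hp.exists_eq_forall_mem_Icc_hasDerivWithinAt₀
    exact ⟨α, hα, fun t ht => (hd t (Ioo_subset_Icc_self ht)).hasDerivAt
      (Icc_mem_nhds ht.1 ht.2)⟩) (x, W₀)
  refine ⟨fun t => (γ t).1, fun t => (γ t).2, by simp [h0], by simp [h0], fun t => ?_, fun t => ?_⟩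
  · exact (ContinuousLinearMap.fst ℝ E (E →L[ℝ] E)).hasFDerivAt.comp_hasDerivAt t (hγ t)
  · exact (ContinuousLinearMap.snd ℝ E (E →L[ℝ] E)).hasFDerivAt.comp_hasDerivAt t (hγ t)

theorem norm_trajectory_sub_le (hF : IsTameField F K C) {γ γ' : ℝ → E}
    (hγ : ∀ t, HasDerivAt γ (F (γ t)) t) (hγ' : ∀ t, HasDerivAt γ' (F (γ' t)) t) (t : ℝ) :
    ‖γ t - γ' t‖ ≤ Real.exp (K * |t|) * ‖γ 0 - γ' 0‖ := by
  have := norm_le_gronwallBound_abs (f := fun s => γ s - γ' s) (δ := ‖γ 0 - γ' 0‖) (K := K)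
    (ε := 0) (fun s => (hγ s).sub (hγ' s)) le_rfl
    (fun s _ => by simpa using hF.norm_sub_le _ _) (le_refl |t|)
  rwa [gronwallBound_ε0, mul_comm] at this

theorem trajectory_unique (hF : IsTameField F K C) {γ γ' : ℝ → E}
    (hγ : ∀ t, HasDerivAt γ (F (γ t)) t) (hγ' : ∀ t, HasDerivAt γ' (F (γ' t)) t)
    (h0 : γ 0 = γ' 0) : γ = γ' := by
  funext t
  have := hF.norm_trajectory_sub_le hγ hγ' t
  rw [h0, sub_self, norm_zero, mul_zero] at this
  exact sub_eq_zero.1 (norm_le_zero_iff.1 this)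

theorem norm_linearization_le (hF : IsTameField F K C) {γ : ℝ → E} {W : ℝ → E →L[ℝ] E}
    (hW : ∀ t, HasDerivAt W ((fderiv ℝ F (γ t)).comp (W t)) t) (t : ℝ) :
    ‖W t‖ ≤ Real.exp (K * |t|) * ‖W 0‖ := by
  have := norm_le_gronwallBound_abs (f := W) (δ := ‖W 0‖) (K := K)
    (ε := 0) hW le_rfl
    (fun s _ => by
      rw [add_zero]
      exact (ContinuousLinearMap.opNorm_comp_le _ _).trans
        (mul_le_mul_of_nonneg_right (hF.bound _) (norm_nonneg _))) (le_refl |t|)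
  rwa [gronwallBound_ε0, mul_comm] at this

theorem gronwallBound_zero_le {K ε x T : ℝ} (hK : 0 < K) (hε : 0 ≤ ε) (hx : x ≤ T) :
    gronwallBound 0 K ε x ≤ ε * (Real.exp (K * T) / K) := by
  rw [gronwallBound_of_K_ne_0 hK.ne']
  have h1 : Real.exp (K * x) ≤ Real.exp (K * T) :=
    Real.exp_le_exp.2 (mul_le_mul_of_nonneg_left hx hK.le)
  have h2 : 0 ≤ ε / K := by positivity
  calc 0 * Real.exp (K * x) + ε / K * (Real.exp (K * x) - 1)
      ≤ ε / K * Real.exp (K * T) := by nlinarith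
    _ = ε * (Real.exp (K * T) / K) := by ring

/-- Grönwall for `W - W'`: the inhomogeneity is `(DF(γ) - DF(γ')) ∘ W'`, controlled by the Lipschitz
constant of `DF` and the separation of the trajectories. This makes the stability matrix jointly
continuous in time and initial point. -/
theorem norm_linearization_sub_le (hF : IsTameField F K C) (T : ℝ) :
    ∃ B : ℝ, ∀ {γ γ' : ℝ → E} {W W' : ℝ → E →L[ℝ] E},
      (∀ t, HasDerivAt γ (F (γ t)) t) → (∀ t, HasDerivAt γ' (F (γ' t)) t) →
      (∀ t, HasDerivAt W ((fderiv ℝ F (γ t)).comp (W t)) t) →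
      (∀ t, HasDerivAt W' ((fderiv ℝ F (γ' t)).comp (W' t)) t) →
      W 0 = ContinuousLinearMap.id ℝ E → W' 0 = ContinuousLinearMap.id ℝ E →
      ∀ t, |t| ≤ T → ‖W t - W' t‖ ≤ B * ‖γ 0 - γ' 0‖ := by
  have hK := hF.pos
  refine ⟨|C| * Real.exp (K * T) * Real.exp (K * T) * (Real.exp (K * T) / K), ?_⟩
  intro γ γ' W W' hγ hγ' hW hW' h0 h0' t ht
  have hexp : ∀ {s : ℝ}, |s| ≤ T → Real.exp (K * |s|) ≤ Real.exp (K * T) := fun hs =>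
    Real.exp_le_exp.2 (mul_le_mul_of_nonneg_left hs hK.le)
  have := norm_le_gronwallBound_abs (f := fun s => W s - W' s) (δ := 0) (K := K)
    (ε := |C| * (Real.exp (K * T) * ‖γ 0 - γ' 0‖) * Real.exp (K * T))
    (fun s => (hW s).sub (hW' s)) (by simp [h0, h0'])
    (fun s hs => by
      have e : (fderiv ℝ F (γ s)).comp (W s) - (fderiv ℝ F (γ' s)).comp (W' s)
          = (fderiv ℝ F (γ s)).comp (W s - W' s)
            + (fderiv ℝ F (γ s) - fderiv ℝ F (γ' s)).comp (W' s) := by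
        simp [ContinuousLinearMap.comp_sub, ContinuousLinearMap.sub_comp]
      rw [e]
      refine (norm_add_le _ _).trans (add_le_add ?_ ?_)
      · exact (ContinuousLinearMap.opNorm_comp_le _ _).trans
          (mul_le_mul_of_nonneg_right (hF.bound _) (norm_nonneg _))
      · refine (ContinuousLinearMap.opNorm_comp_le _ _).trans ?_
        refine mul_le_mul ?_ ?_ (norm_nonneg _) (by positivity)
        · refine (hF.lipschitz _ _).trans
            (mul_le_mul (le_abs_self C) ?_ (norm_nonneg _) (abs_nonneg C))
          exact (hF.norm_trajectory_sub_le hγ hγ' s).trans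
            (mul_le_mul_of_nonneg_right (hexp hs) (norm_nonneg _))
        · refine (hF.norm_linearization_le hW' s).trans ?_
          rw [h0']
          calc Real.exp (K * |s|) * ‖ContinuousLinearMap.id ℝ E‖ ≤ Real.exp (K * T) * 1 :=
                mul_le_mul (hexp hs) ContinuousLinearMap.norm_id_le (norm_nonneg _) (by positivity)
            _ = _ := mul_one _) ht
  refine this.trans ((gronwallBound_zero_le hK (by positivity) ht).trans (le_of_eq (by ring)))

/-- The linearization error solves the linearized equation up to the Taylor remainder of `F`, which
is quadratic in the separation of the trajectories; Grönwall keeps it quadratic. A quadratic error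
means that `W t` is the derivative of the flow. -/
theorem norm_trajectory_sub_linearization_le (hF : IsTameField F K C) (t : ℝ) :
    ∃ B : ℝ, ∀ {γ γ' : ℝ → E} {W : ℝ → E →L[ℝ] E},
      (∀ t, HasDerivAt γ (F (γ t)) t) → (∀ t, HasDerivAt γ' (F (γ' t)) t) →
      (∀ t, HasDerivAt W ((fderiv ℝ F (γ t)).comp (W t)) t) →
      W 0 = ContinuousLinearMap.id ℝ E →
      ‖γ' t - γ t - W t (γ' 0 - γ 0)‖ ≤ B * ‖γ' 0 - γ 0‖ ^ 2 := by
  have hK := hF.pos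
  refine ⟨|C| * Real.exp (K * |t|) ^ 2 * (Real.exp (K * |t|) / K), ?_⟩
  intro γ γ' W hγ hγ' hW h0
  have := norm_le_gronwallBound_abs (f := fun s => γ' s - γ s - W s (γ' 0 - γ 0)) (δ := 0) (K := K)
    (ε := |C| * (Real.exp (K * |t|) * ‖γ' 0 - γ 0‖) ^ 2)
    (fun s => ((hγ' s).sub (hγ s)).sub ((hW s).clm_apply (hasDerivAt_const s (γ' 0 - γ 0))))
    (by simp [h0])
    (fun s hs => by
      have e : F (γ' s) - F (γ s) - (((fderiv ℝ F (γ s)).comp (W s)) (γ' 0 - γ 0) + W s 0)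
          = fderiv ℝ F (γ s) (γ' s - γ s - W s (γ' 0 - γ 0))
            + (F (γ' s) - F (γ s) - fderiv ℝ F (γ s) (γ' s - γ s)) := by
        simp only [ContinuousLinearMap.comp_apply, map_sub, map_zero]
        abel
      rw [e]
      refine (norm_add_le _ _).trans (add_le_add ?_ ?_)
      · exact (ContinuousLinearMap.le_opNorm _ _).trans
          (mul_le_mul_of_nonneg_right (hF.bound _) (norm_nonneg _))
      · refine (hF.taylor _ _).trans (mul_le_mul (le_abs_self C) ?_ (by positivity) (abs_nonneg C))
        refine pow_le_pow_left₀ (norm_nonneg _) ?_ 2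
        refine (hF.norm_trajectory_sub_le hγ' hγ s).trans
            (mul_le_mul_of_nonneg_right ?_ (norm_nonneg _))
        exact Real.exp_le_exp.2 (mul_le_mul_of_nonneg_left hs hK.le)) (le_refl |t|)
  refine this.trans ((gronwallBound_zero_le hK (by positivity) le_rfl).trans (le_of_eq (by ring)))

end IsTameField

/-- Joint continuity from continuity in time and locally uniform Lipschitz continuity in space. -/
theorem continuous_uncurry_of_lipschitz {E X : Type*} [NormedAddCommGroup E]
    [NormedAddCommGroup X] {f : ℝ → E → X}
    (hc : ∀ x, Continuous fun t => f t x)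
    (hl : ∀ T : ℝ, ∃ B : ℝ, ∀ t, |t| ≤ T → ∀ x y, ‖f t x - f t y‖ ≤ B * ‖x - y‖) :
    Continuous fun p : ℝ × E => f p.1 p.2 := by
  rw [continuous_iff_continuousAt]
  rintro ⟨t₀, x₀⟩
  obtain ⟨B, hB⟩ := hl (|t₀| + 1)
  rw [ContinuousAt, tendsto_iff_norm_sub_tendsto_zero]
  have h1 : Filter.Tendsto (fun p : ℝ × E => B * ‖p.2 - x₀‖ + ‖f p.1 x₀ - f t₀ x₀‖)
      (𝓝 (t₀, x₀)) (𝓝 0) := by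
    have : Continuous fun p : ℝ × E => B * ‖p.2 - x₀‖ + ‖f p.1 x₀ - f t₀ x₀‖ :=
      (continuous_const.mul (continuous_snd.sub continuous_const).norm).add
        (((hc x₀).comp continuous_fst).sub continuous_const).norm
    simpa using this.tendsto (t₀, x₀)
  refine squeeze_zero' (Filter.Eventually.of_forall fun _ => norm_nonneg _) ?_ h1
  have h2 : ∀ᶠ p : ℝ × E in 𝓝 (t₀, x₀), |p.1| < |t₀| + 1 :=
    (continuous_fst.abs.continuousAt (x := (t₀, x₀))).eventually_lt continuousAt_const (by simp)
  filter_upwards [h2] with p hp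
  have := norm_sub_le_norm_sub_add_norm_sub (f p.1 p.2) (f p.1 x₀) (f t₀ x₀)
  linarith [hB p.1 hp.le p.2 x₀]

end ODE

namespace HermanKluk

open Set
open scoped Topology InnerProductSpace

variable {D : ℕ} {V : Config D → ℝ}

/-! ### The Hamiltonian flow and its stability matrix -/

section Dynamics

/-- The Hamiltonian vector field `(q, p) ↦ (p, -∇V(q))`. -/
noncomputable def hamiltonField (V : Config D → ℝ) (z : Phase D) : Phase D :=
  (z.2, -gradient V z.1)

theorem gradient_eq_toDual (V : Config D → ℝ) :
    gradient V = fun x => (InnerProductSpace.toDual ℝ (Config D)).symm (fderiv ℝ V x) := rfl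

theorem IsSubquadratic.contDiff_gradient (hV : IsSubquadratic V) : ContDiff ℝ ∞ (gradient V) := by
  rw [gradient_eq_toDual]
  exact (InnerProductSpace.toDual ℝ (Config D)).symm.contDiff.comp
    (hV.1.fderiv_right (by simp))

theorem two_le_infty : (2 : WithTop ℕ∞) ≤ (⊤ : ℕ∞) :=
  WithTop.coe_le_coe.2 (le_top : (2 : ℕ∞) ≤ ⊤)

/-- Identifies the derivative of the gradient with the Hessian, so that the symmetry of second
derivatives can be used in the proof of symplecticity. -/
theorem IsSubquadratic.inner_fderiv_gradient (hV : IsSubquadratic V) (x u v : Config D) :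
    ⟪fderiv ℝ (gradient V) x u, v⟫_ℝ = fderiv ℝ (fderiv ℝ V) x u v := by
  have h : DifferentiableAt ℝ (fderiv ℝ V) x :=
    (hV.1.fderiv_right (m := 1) (by rw [one_add_one_eq_two]; exact two_le_infty)).differentiable
      (by norm_num) x
  have h' : DifferentiableAt ℝ (gradient V) x := hV.contDiff_gradient.differentiable (by simp) x
  have h1 := h.hasFDerivAt.clm_apply (hasFDerivAt_const v x)
  have h2 := h'.hasFDerivAt.inner ℝ (hasFDerivAt_const v x)
  have e : (fun y => ⟪gradient V y, v⟫_ℝ) = fun y => fderiv ℝ V y v := by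
    funext y
    rw [gradient_eq_toDual, InnerProductSpace.toDual_symm_apply]
  rw [e] at h2
  have := congrArg (fun L => L u) (h2.unique h1)
  simpa using this

/-- The Riesz map is a linear isometry, so bounds on derivatives of `V` carry over unchanged to the
Hamiltonian field. -/
theorem norm_fderiv_gradient (V : Config D → ℝ) (x : Config D) :
    ‖fderiv ℝ (gradient V) x‖ = ‖iteratedFDeriv ℝ 2 V x‖ := by
  rw [← norm_iteratedFDeriv_fderiv, ← norm_iteratedFDeriv_one, gradient_eq_toDual]
  exact LinearIsometryEquiv.norm_iteratedFDeriv_comp_left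
    (InnerProductSpace.toDual ℝ (Config D)).symm (fderiv ℝ V) x 1

theorem IsSubquadratic.exists_lipschitz_fderiv_gradient (hV : IsSubquadratic V) :
    ∃ C, ∀ x y, ‖fderiv ℝ (gradient V) x - fderiv ℝ (gradient V) y‖ ≤ C * ‖x - y‖ := by
  obtain ⟨C, hC⟩ := hV.2 3 (by norm_num)
  refine ⟨C, fun x y => ?_⟩
  have hd : Differentiable ℝ (fderiv ℝ (gradient V)) :=
    (hV.contDiff_gradient.fderiv_right (m := 1)
      (by rw [one_add_one_eq_two]; exact two_le_infty)).differentiable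
      (by norm_num)
  refine convex_univ.norm_image_sub_le_of_norm_fderiv_le (𝕜 := ℝ) (fun x _ => hd x)
    (fun x _ => ?_) (mem_univ y) (mem_univ x)
  rw [← norm_iteratedFDeriv_one, norm_iteratedFDeriv_fderiv]
  have := LinearIsometryEquiv.norm_iteratedFDeriv_comp_left
    (InnerProductSpace.toDual ℝ (Config D)).symm (fderiv ℝ V) x 2
  rw [gradient_eq_toDual]
  refine (le_of_eq this).trans ?_
  rw [norm_iteratedFDeriv_fderiv]
  exact hC x

theorem IsSubquadratic.hasFDerivAt_hamiltonField (hV : IsSubquadratic V) (z : Phase D) :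
    HasFDerivAt (hamiltonField V) ((ContinuousLinearMap.snd ℝ (Config D) (Config D)).prod
      (-(fderiv ℝ (gradient V) z.1).comp (ContinuousLinearMap.fst ℝ (Config D) (Config D)))) z := by
  have h : DifferentiableAt ℝ (gradient V) z.1 :=
    hV.contDiff_gradient.differentiable (by simp) z.1
  exact hasFDerivAt_snd.prodMk (h.hasFDerivAt.comp z hasFDerivAt_fst).neg

theorem IsSubquadratic.exists_isTameField (hV : IsSubquadratic V) :
    ∃ K C, IsTameField (hamiltonField V) K C := by
  obtain ⟨K, hK⟩ := hV.2 2 le_rfl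
  obtain ⟨C, hC⟩ := hV.exists_lipschitz_fderiv_gradient
  refine ⟨max 1 K, |C|, ?_, by positivity, fun z => ?_, fun z z' => ?_⟩
  · exact contDiff_snd.prodMk
      ((hV.contDiff_gradient.of_le two_le_infty).comp contDiff_fst).neg
  · rw [(hV.hasFDerivAt_hamiltonField z).fderiv]
    refine ContinuousLinearMap.opNorm_le_bound _ (by positivity) fun v => ?_
    refine norm_prod_le_iff.2 ⟨?_, ?_⟩
    · calc ‖v.2‖ ≤ ‖v‖ := norm_snd_le v
        _ ≤ max 1 K * ‖v‖ := le_mul_of_one_le_left (norm_nonneg _) (le_max_left _ _)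
    · simp only [ContinuousLinearMap.prod_apply, neg_apply, norm_neg,
        ContinuousLinearMap.comp_apply, ContinuousLinearMap.coe_fst']
      refine (ContinuousLinearMap.le_opNorm _ _).trans ?_
      refine mul_le_mul ?_ (norm_fst_le v) (norm_nonneg _) (by positivity)
      rw [norm_fderiv_gradient]
      exact (hK _).trans (le_max_right _ _)
  · rw [(hV.hasFDerivAt_hamiltonField z).fderiv, (hV.hasFDerivAt_hamiltonField z').fderiv]
    refine ContinuousLinearMap.opNorm_le_bound _ (by positivity) fun v => ?_
    refine norm_prod_le_iff.2 ⟨?_, ?_⟩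
    · simp; positivity
    · have e : (((ContinuousLinearMap.snd ℝ (Config D) (Config D)).prod
          (-(fderiv ℝ (gradient V) z.1).comp (ContinuousLinearMap.fst ℝ (Config D) (Config D))) -
          (ContinuousLinearMap.snd ℝ (Config D) (Config D)).prod
          (-(fderiv ℝ (gradient V) z'.1).comp (ContinuousLinearMap.fst ℝ (Config D) (Config D)))) v).2 =
          -((fderiv ℝ (gradient V) z.1 - fderiv ℝ (gradient V) z'.1) v.1) := by
        simp; abel
      rw [e, norm_neg]
      refine (ContinuousLinearMap.le_opNorm _ _).trans ?_
      refine mul_le_mul ((hC _ _).trans ?_) (norm_fst_le v) (norm_nonneg _) (by positivity)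
      exact mul_le_mul (le_abs_self C) (norm_fst_le (z - z')) (norm_nonneg _) (abs_nonneg C)

theorem IsSubquadratic.isTrajectory_flow (hV : IsSubquadratic V) (z : Phase D) :
    IsTrajectory V z fun t => flow V t z := by
  obtain ⟨K, C, hF⟩ := hV.exists_isTameField
  obtain ⟨γ, -, h0, -, hγ, -⟩ := hF.exists_trajectory z 0
  exact Classical.epsilon_spec (p := IsTrajectory V z) ⟨γ, h0, hγ⟩

theorem IsSubquadratic.flow_zero (hV : IsSubquadratic V) (z : Phase D) : flow V 0 z = z :=
  (hV.isTrajectory_flow z).1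

theorem IsSubquadratic.hasDerivAt_flow (hV : IsSubquadratic V) (z : Phase D) (t : ℝ) :
    HasDerivAt (fun t => flow V t z) (hamiltonField V (flow V t z)) t :=
  (hV.isTrajectory_flow z).2 t

theorem IsSubquadratic.flow_add (hV : IsSubquadratic V) (s t : ℝ) (z : Phase D) :
    flow V (s + t) z = flow V s (flow V t z) := by
  obtain ⟨K, C, hF⟩ := hV.exists_isTameField
  have := hF.trajectory_unique (γ := fun s => flow V (s + t) z)
    (γ' := fun s => flow V s (flow V t z))
    (fun s => (hV.hasDerivAt_flow z (s + t)).comp_add_const s t)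
    (fun s => hV.hasDerivAt_flow _ s) (by simp [hV.flow_zero])
  exact congrFun this s

theorem IsSubquadratic.flow_surjective (hV : IsSubquadratic V) (t : ℝ) :
    Function.Surjective (flow V t) := fun z =>
  ⟨flow V (-t) z, by rw [← hV.flow_add, add_neg_cancel, hV.flow_zero]⟩

theorem IsSubquadratic.exists_lipschitz_flow (hV : IsSubquadratic V) (T : ℝ) :
    ∃ B, 0 ≤ B ∧ ∀ t, |t| ≤ T → ∀ x y, ‖flow V t x - flow V t y‖ ≤ B * ‖x - y‖ := by
  obtain ⟨K, C, hF⟩ := hV.exists_isTameField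
  refine ⟨Real.exp (K * T), by positivity, fun t ht x y => ?_⟩
  have := hF.norm_trajectory_sub_le (hV.hasDerivAt_flow x) (hV.hasDerivAt_flow y) t
  rw [hV.flow_zero, hV.flow_zero] at this
  exact this.trans (mul_le_mul_of_nonneg_right
    (Real.exp_le_exp.2 (mul_le_mul_of_nonneg_left ht hF.pos.le)) (norm_nonneg _))

theorem IsSubquadratic.lipschitzWith_flow (hV : IsSubquadratic V) (t : ℝ) :
    ∃ B, LipschitzWith B (flow V t) := by
  obtain ⟨B, hB, h⟩ := hV.exists_lipschitz_flow |t|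
  exact ⟨B.toNNReal, LipschitzWith.of_dist_le_mul fun x y => by
    rw [Real.coe_toNNReal _ hB, dist_eq_norm, dist_eq_norm]; exact h t le_rfl x y⟩

theorem IsSubquadratic.continuous_flow (hV : IsSubquadratic V) :
    Continuous fun p : ℝ × Phase D => flow V p.1 p.2 :=
  continuous_uncurry_of_lipschitz (f := fun t z => flow V t z)
    (fun z => continuous_iff_continuousAt.2 fun t => (hV.hasDerivAt_flow z t).continuousAt)
    fun T => let ⟨B, _, h⟩ := hV.exists_lipschitz_flow T; ⟨B, h⟩

theorem IsSubquadratic.exists_norm_flow_le (hV : IsSubquadratic V) (t : ℝ) :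
    ∃ B, 0 ≤ B ∧ ∀ z, ‖flow V t z‖ ≤ B * (1 + ‖z‖) := by
  obtain ⟨B, hB, h⟩ := hV.exists_lipschitz_flow |t|
  refine ⟨B + ‖flow V t 0‖, by positivity, fun z => ?_⟩
  have h1 := h t le_rfl z 0
  rw [sub_zero] at h1
  have h2 := norm_le_norm_add_norm_sub' (flow V t z) (flow V t 0)
  nlinarith [norm_nonneg z, norm_nonneg (flow V t 0), mul_nonneg (norm_nonneg z) (norm_nonneg (flow V t 0))]

/-- The quadratic error of the linearization is `o(‖y - z‖)`, so the solution `W` of the variational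
equation is the Fréchet derivative of the flow. -/
theorem IsSubquadratic.stability_eq (hV : IsSubquadratic V) (z : Phase D)
    {W : ℝ → Phase D →L[ℝ] Phase D} (h0 : W 0 = ContinuousLinearMap.id ℝ _)
    (hW : ∀ t, HasDerivAt W ((fderiv ℝ (hamiltonField V) (flow V t z)).comp (W t)) t) (t : ℝ) :
    stability V t z = W t := by
  obtain ⟨K, C, hF⟩ := hV.exists_isTameField
  obtain ⟨B, hB⟩ := hF.norm_trajectory_sub_linearization_le t
  refine HasFDerivAt.fderiv ?_
  have hO : (fun y => flow V t y - flow V t z - W t (y - z)) =O[𝓝 z] fun y => ‖y - z‖ ^ 2 := by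
    refine Asymptotics.IsBigO.of_bound B (Filter.Eventually.of_forall fun y => ?_)
    have := hB (hV.hasDerivAt_flow z) (hV.hasDerivAt_flow y) hW h0
    rw [hV.flow_zero, hV.flow_zero] at this
    simpa using this
  exact HasFDerivAt.of_isLittleO
    (hO.trans_isLittleO (Asymptotics.isLittleO_pow_sub_sub z one_lt_two))

theorem IsSubquadratic.stability_spec (hV : IsSubquadratic V) (z : Phase D) :
    stability V 0 z = ContinuousLinearMap.id ℝ _ ∧
    ∀ t, HasDerivAt (fun t => stability V t z)
      ((fderiv ℝ (hamiltonField V) (flow V t z)).comp (stability V t z)) t := by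
  obtain ⟨K, C, hF⟩ := hV.exists_isTameField
  obtain ⟨γ, W, h0, hW0, hγ, hW⟩ := hF.exists_trajectory z (ContinuousLinearMap.id ℝ _)
  have e : γ = fun t => flow V t z :=
    hF.trajectory_unique hγ (hV.hasDerivAt_flow z) (by rw [h0, hV.flow_zero])
  subst e
  have hs := hV.stability_eq z hW0 hW
  have hs' : (fun t => stability V t z) = W := funext hs
  refine ⟨by rw [hs, hW0], fun t => ?_⟩
  rw [hs', hs]
  exact hW t

theorem IsSubquadratic.continuous_stability (hV : IsSubquadratic V) :
    Continuous fun p : ℝ × Phase D => stability V p.1 p.2 := by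
  obtain ⟨K, C, hF⟩ := hV.exists_isTameField
  refine continuous_uncurry_of_lipschitz (f := fun t z => stability V t z)
    (fun z => continuous_iff_continuousAt.2 fun t => ((hV.stability_spec z).2 t).continuousAt)
    fun T => ?_
  obtain ⟨B, hB⟩ := hF.norm_linearization_sub_le T
  refine ⟨B, fun t ht x y => ?_⟩
  have := hB (hV.hasDerivAt_flow x) (hV.hasDerivAt_flow y) (hV.stability_spec x).2
    (hV.stability_spec y).2 (hV.stability_spec x).1 (hV.stability_spec y).1 t ht
  rwa [hV.flow_zero, hV.flow_zero] at this

theorem IsSubquadratic.exists_norm_stability_le (hV : IsSubquadratic V) (t : ℝ) :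
    ∃ B, ∀ z, ‖stability V t z‖ ≤ B := by
  obtain ⟨K, C, hF⟩ := hV.exists_isTameField
  refine ⟨Real.exp (K * |t|), fun z => ?_⟩
  have := hF.norm_linearization_le (hV.stability_spec z).2 t
  rw [(hV.stability_spec z).1] at this
  exact this.trans (mul_le_of_le_one_right (by positivity) ContinuousLinearMap.norm_id_le)

/-- The stability matrix is symplectic. -/
theorem IsSubquadratic.symplectic_stability (hV : IsSubquadratic V) (t : ℝ) (z a b : Phase D) :
    ⟪(stability V t z a).1, (stability V t z b).2⟫_ℝ
      - ⟪(stability V t z a).2, (stability V t z b).1⟫_ℝ = ⟪a.1, b.2⟫_ℝ - ⟪a.2, b.1⟫_ℝ := by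
  have hsymm : ∀ x u v, ⟪fderiv ℝ (gradient V) x u, v⟫_ℝ = ⟪u, fderiv ℝ (gradient V) x v⟫_ℝ := by
    intro x u v
    rw [hV.inner_fderiv_gradient, real_inner_comm, hV.inner_fderiv_gradient]
    exact (hV.1.contDiffAt (x := x)).isSymmSndFDerivAt (by simpa using two_le_infty) u v
  have hd : ∀ (c : Phase D) (s : ℝ), HasDerivAt (fun s => stability V s z c)
      ((stability V s z c).2, -fderiv ℝ (gradient V) (flow V s z).1 (stability V s z c).1) s := by
    intro c s
    have := ((hV.stability_spec z).2 s).clm_apply (hasDerivAt_const s c)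
    rw [(hV.hasFDerivAt_hamiltonField _).fderiv] at this
    simpa using this
  have hd1 : ∀ (c : Phase D) (s : ℝ), HasDerivAt (fun s => (stability V s z c).1)
      (stability V s z c).2 s := fun c s =>
    (ContinuousLinearMap.fst ℝ (Config D) (Config D)).hasFDerivAt.comp_hasDerivAt s (hd c s)
  have hd2 : ∀ (c : Phase D) (s : ℝ), HasDerivAt (fun s => (stability V s z c).2)
      (-fderiv ℝ (gradient V) (flow V s z).1 (stability V s z c).1) s := fun c s =>
    (ContinuousLinearMap.snd ℝ (Config D) (Config D)).hasFDerivAt.comp_hasDerivAt s (hd c s)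
  -- The symplectic form of two solutions of the linearized equation is constant in time: the
  -- kinetic terms cancel by symmetry of the inner product, the potential terms by symmetry of the
  -- Hessian.
  have hω : ∀ s, HasDerivAt (fun s => ⟪(stability V s z a).1, (stability V s z b).2⟫_ℝ
      - ⟪(stability V s z a).2, (stability V s z b).1⟫_ℝ) 0 s := by
    intro s
    refine (((hd1 a s).inner ℝ (hd2 b s)).sub ((hd2 a s).inner ℝ (hd1 b s))).congr_deriv ?_
    simp only [inner_neg_left, inner_neg_right, hsymm]
    ring
  have := is_const_of_deriv_eq_zero (fun s => (hω s).differentiableAt)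
    (fun s => (hω s).deriv) t 0
  rw [this, (hV.stability_spec z).1]
  simp

end Dynamics

end HermanKluk

namespace HermanKluk

open Set
open scoped Topology InnerProductSpace Matrix ComplexOrder

variable {D : ℕ} {V : Config D → ℝ}

/-! ### The Herman–Kluk prefactor: lower bound, branch, continuity, boundedness -/

section Prefactor

/-- For `v = x + iy` the form splits into its values at `x` and at `y`; symmetry of `Γ` cancels the
cross terms. -/
theorem posDef_map_ofReal {n : Type*} [Fintype n] [DecidableEq n] {Γ : Matrix n n ℝ}
    (hΓ : Γ.PosDef) : (Γ.map Complex.ofReal).PosDef := by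
  refine Matrix.PosDef.of_dotProduct_mulVec_pos ?_ fun v hv => ?_
  · ext i j
    have := congrFun (congrFun hΓ.1 i) j
    simpa using this
  set x : n → ℝ := fun i => (v i).re with hx
  set y : n → ℝ := fun i => (v i).im with hy
  have e : star v ⬝ᵥ (Γ.map Complex.ofReal *ᵥ v) =
      ((x ⬝ᵥ (Γ *ᵥ x) + y ⬝ᵥ (Γ *ᵥ y) : ℝ) : ℂ)
        + Complex.I * ((x ⬝ᵥ (Γ *ᵥ y) - y ⬝ᵥ (Γ *ᵥ x) : ℝ) : ℂ) := by
    simp only [dotProduct, Matrix.mulVec, Matrix.map_apply, Complex.ofReal_add, Complex.ofReal_sub,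
      Complex.ofReal_sum, Complex.ofReal_mul, Finset.mul_sum, ← Finset.sum_add_distrib,
      ← Finset.sum_sub_distrib]
    refine Finset.sum_congr rfl fun i _ => Finset.sum_congr rfl fun j _ => ?_
    have h1 : star v i = x i - y i * Complex.I := by
      apply Complex.ext <;> simp [hx, hy]
    have h2 : v j = x j + y j * Complex.I := (Complex.re_add_im (v j)).symm
    rw [h1, h2]
    linear_combination (-(y i : ℂ) * Γ i j * y j) * Complex.I_sq
  have hsymm : x ⬝ᵥ (Γ *ᵥ y) = y ⬝ᵥ (Γ *ᵥ x) := by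
    have hT : Γᵀ = Γ := hΓ.1
    rw [Matrix.dotProduct_mulVec, dotProduct_comm, ← Matrix.mulVec_transpose, hT]
  rw [e, hsymm, sub_self, Complex.ofReal_zero, mul_zero, add_zero, Complex.zero_lt_real]
  have hpos : ∀ u : n → ℝ, u ≠ 0 → 0 < u ⬝ᵥ (Γ *ᵥ u) := fun u hu => by
    simpa using hΓ.dotProduct_mulVec_pos hu
  have hnn : ∀ u : n → ℝ, 0 ≤ u ⬝ᵥ (Γ *ᵥ u) := fun u => by
    simpa using hΓ.posSemidef.dotProduct_mulVec_nonneg u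
  by_cases h : x = 0
  · have hy0 : y ≠ 0 := fun hy0 => hv (by
      funext i
      exact Complex.ext (congrFun h i) (congrFun hy0 i))
    linarith [hnn x, hpos y hy0]
  · linarith [hnn y, hpos x h]

/-- The complex matrix `M_qq + Γ⁻¹ M_pp Γ - i M_qp Γ + i Γ⁻¹ M_pq` built from real blocks. -/
noncomputable def hkMatrix {n : Type*} [Fintype n] [DecidableEq n] (Γ A B C E : Matrix n n ℝ) :
    Matrix n n ℂ :=
  (A + Γ⁻¹ * E * Γ).map Complex.ofReal + Complex.I • (Γ⁻¹ * C - B * Γ).map Complex.ofReal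

/-- With `X` the Herman–Kluk matrix and `Y` its counterpart with the signs of `E` and `C` reversed,
`X* Γ X - Y* Γ Y` is a polarization: only mixed products of the blocks survive, and the symplectic
relations evaluate them to `4Γ`. This is the source of the lower bound on the prefactor. -/
theorem hkMatrix_identity {n : Type*} [Fintype n] [DecidableEq n] {Γ A B C E : Matrix n n ℝ}
    (hΓ : Γ.PosDef) (h1 : Aᵀ * C = Cᵀ * A) (h2 : Bᵀ * E = Eᵀ * B) (h3 : Aᵀ * E - Cᵀ * B = 1) :
    (hkMatrix Γ A B C E)ᴴ * Γ.map Complex.ofReal * hkMatrix Γ A B C E =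
      (4 : ℂ) • Γ.map Complex.ofReal +
        ((A - Γ⁻¹ * E * Γ).map Complex.ofReal - Complex.I • (B * Γ + Γ⁻¹ * C).map Complex.ofReal)ᴴ
          * Γ.map Complex.ofReal *
        ((A - Γ⁻¹ * E * Γ).map Complex.ofReal
          - Complex.I • (B * Γ + Γ⁻¹ * C).map Complex.ofReal) := by
  have hdet : IsUnit Γ.det := hΓ.det_pos.ne'.isUnit
  have hT : Γᵀ = Γ := hΓ.1
  have hTi : (Γ⁻¹)ᵀ = Γ⁻¹ := by rw [Matrix.transpose_nonsing_inv, hT]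
  have hi1 : Γ * Γ⁻¹ = 1 := Matrix.mul_nonsing_inv Γ hdet
  have hi2 : Γ⁻¹ * Γ = 1 := Matrix.nonsing_inv_mul Γ hdet
  have h3' : Eᵀ * A - Bᵀ * C = 1 := by
    have := congrArg Matrix.transpose h3
    simpa using this
  let R : Matrix n n ℝ →+* Matrix n n ℂ := Complex.ofRealHom.mapMatrix
  have hR : ∀ M : Matrix n n ℝ, M.map Complex.ofReal = R M := fun M => rfl
  have hRH : ∀ M : Matrix n n ℝ, (R M)ᴴ = R Mᵀ := fun M => by
    ext i j; simp [R]
  have key : ∀ a b c d G : Matrix n n ℝ,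
      aᵀ * G * c + bᵀ * G * d = cᵀ * G * a + dᵀ * G * b →
      (R (a + d) + Complex.I • R (c - b))ᴴ * R G * (R (a + d) + Complex.I • R (c - b)) =
      (2 : ℂ) • R (aᵀ * G * d - bᵀ * G * c + (dᵀ * G * a - cᵀ * G * b)) +
        (R (a - d) - Complex.I • R (b + c))ᴴ * R G * (R (a - d) - Complex.I • R (b + c)) := by
    intro a b c d G h
    have h' := congrArg (fun M => Complex.I • R M) h
    -- The imaginary part of the polarization is exactly twice the difference of the two sides of
    -- `h`. Inserting this zero turns the claim into an identity of noncommutative polynomials.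
    have hb : (2 : ℂ) • (Complex.I • R (aᵀ * G * c + bᵀ * G * d)
        - Complex.I • R (cᵀ * G * a + dᵀ * G * b)) = 0 := by
      rw [h, sub_self, smul_zero]
    rw [← sub_eq_zero, ← hb]
    simp only [Matrix.conjTranspose_add, Matrix.conjTranspose_sub, Matrix.conjTranspose_smul, hRH,
      map_add, map_sub, map_mul, Complex.star_def, Complex.conj_I, Matrix.add_mul, Matrix.mul_add,
      Matrix.sub_mul, Matrix.mul_sub, Matrix.smul_mul, Matrix.mul_smul, smul_add, smul_sub,
      smul_smul, neg_smul, neg_mul]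
    match_scalars <;> ring_nf <;> simp only [Complex.I_sq] <;> ring
  have := key A (B * Γ) (Γ⁻¹ * C) (Γ⁻¹ * E * Γ) Γ (by
    simp only [Matrix.transpose_mul, hTi, hT]
    have e1 : Aᵀ * Γ * (Γ⁻¹ * C) = Aᵀ * C := by rw [Matrix.mul_assoc, ← Matrix.mul_assoc Γ, hi1, Matrix.one_mul]
    have e2 : Γ * Bᵀ * Γ * (Γ⁻¹ * E * Γ) = Γ * (Bᵀ * E) * Γ := by
      simp only [Matrix.mul_assoc]; rw [← Matrix.mul_assoc Γ Γ⁻¹, hi1, Matrix.one_mul]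
    have e3 : Cᵀ * Γ⁻¹ * Γ * A = Cᵀ * A := by rw [Matrix.mul_assoc Cᵀ, hi2, Matrix.mul_one]
    have e4 : Γ * (Eᵀ * Γ⁻¹) * Γ * (B * Γ) = Γ * (Eᵀ * B) * Γ := by
      simp only [Matrix.mul_assoc]; rw [← Matrix.mul_assoc Γ⁻¹ Γ, hi2, Matrix.one_mul]
    rw [e1, e2, e3, e4, h1, h2])
  simp only [hkMatrix, hR]
  rw [this]
  congr 1
  have e : Aᵀ * Γ * (Γ⁻¹ * E * Γ) - (B * Γ)ᵀ * Γ * (Γ⁻¹ * C)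
      + ((Γ⁻¹ * E * Γ)ᵀ * Γ * A - (Γ⁻¹ * C)ᵀ * Γ * (B * Γ)) =
      (Aᵀ * E - Cᵀ * B) * Γ + Γ * (Eᵀ * A - Bᵀ * C) := by
    simp only [Matrix.transpose_mul, hTi, hT]
    have e1 : Aᵀ * Γ * (Γ⁻¹ * E * Γ) = Aᵀ * E * Γ := by
      simp only [Matrix.mul_assoc]; rw [← Matrix.mul_assoc Γ Γ⁻¹, hi1, Matrix.one_mul]
    have e2 : Γ * Bᵀ * Γ * (Γ⁻¹ * C) = Γ * (Bᵀ * C) := by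
      simp only [Matrix.mul_assoc]; rw [← Matrix.mul_assoc Γ Γ⁻¹, hi1, Matrix.one_mul]
    have e3 : Γ * (Eᵀ * Γ⁻¹) * Γ * A = Γ * (Eᵀ * A) := by
      simp only [Matrix.mul_assoc]; rw [← Matrix.mul_assoc Γ⁻¹ Γ, hi2, Matrix.one_mul]
    have e4 : Cᵀ * Γ⁻¹ * Γ * (B * Γ) = Cᵀ * B * Γ := by
      simp only [Matrix.mul_assoc]; rw [← Matrix.mul_assoc Γ⁻¹ Γ, hi2, Matrix.one_mul]
    rw [e1, e2, e3, e4, Matrix.sub_mul, Matrix.mul_sub]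
    abel
  rw [e, h3, h3', Matrix.one_mul, Matrix.mul_one, map_add, ← two_smul ℂ, smul_smul]
  norm_num

/-- If `X v = μ v`, then `hkMatrix_identity` tested on `v` reads `|μ|² v*Γv = 4 v*Γv + (Yv)*Γ(Yv)`,
so every eigenvalue has modulus at least 2. The determinant is the product of the eigenvalues with
multiplicity. -/
theorem two_pow_le_norm_det_hkMatrix {n : Type*} [Fintype n] [DecidableEq n]
    {Γ A B C E : Matrix n n ℝ}
    (hΓ : Γ.PosDef) (h1 : Aᵀ * C = Cᵀ * A) (h2 : Bᵀ * E = Eᵀ * B) (h3 : Aᵀ * E - Cᵀ * B = 1) :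
    2 ^ Fintype.card n ≤ ‖(hkMatrix Γ A B C E).det‖ := by
  set X := hkMatrix Γ A B C E with hX
  have hid := hkMatrix_identity hΓ h1 h2 h3
  rw [← hX] at hid
  set Y := (A - Γ⁻¹ * E * Γ).map Complex.ofReal
    - Complex.I • (B * Γ + Γ⁻¹ * C).map Complex.ofReal
  have hG := posDef_map_ofReal hΓ
  set G := Γ.map Complex.ofReal
  have hroot : ∀ μ ∈ X.charpoly.roots, 2 ≤ ‖μ‖ := by
    intro μ hμ
    have hμ' : X.charpoly.eval μ = 0 := (Polynomial.mem_roots'.1 hμ).2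
    rw [Matrix.eval_charpoly, ← Matrix.exists_mulVec_eq_zero_iff] at hμ'
    obtain ⟨v, hv, hv'⟩ := hμ'
    have hXv : X *ᵥ v = μ • v := by
      rw [Matrix.sub_mulVec, sub_eq_zero] at hv'
      rw [← hv']
      simp [Matrix.scalar_apply, ← Matrix.smul_one_eq_diagonal, Matrix.smul_mulVec]
    have hpos := hG.dotProduct_mulVec_pos hv
    have hY : 0 ≤ star (Y *ᵥ v) ⬝ᵥ (G *ᵥ (Y *ᵥ v)) := hG.posSemidef.dotProduct_mulVec_nonneg _
    have e : star (X *ᵥ v) ⬝ᵥ (G *ᵥ (X *ᵥ v)) = 4 * (star v ⬝ᵥ (G *ᵥ v))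
        + star (Y *ᵥ v) ⬝ᵥ (G *ᵥ (Y *ᵥ v)) := by
      have := congrArg (fun M => star v ⬝ᵥ (M *ᵥ v)) hid
      simp only [Matrix.add_mulVec, Matrix.smul_mulVec, dotProduct_add, dotProduct_smul,
        ← Matrix.mulVec_mulVec, smul_eq_mul] at this
      simpa only [Matrix.star_mulVec, Matrix.dotProduct_mulVec, Matrix.vecMul_vecMul,
        Matrix.mulVec_mulVec, Matrix.mul_assoc] using this
    rw [hXv, star_smul, Matrix.mulVec_smul, smul_dotProduct, dotProduct_smul, smul_smul,
      smul_eq_mul, Complex.star_def, ← Complex.normSq_eq_conj_mul_self] at e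
    have hre := congrArg Complex.re e
    rw [Complex.re_ofReal_mul, Complex.add_re] at hre
    have h4 : (4 * (star v ⬝ᵥ (G *ᵥ v))).re = 4 * (star v ⬝ᵥ (G *ᵥ v)).re := by
      simp
    rw [h4] at hre
    have hp := (Complex.pos_iff.1 hpos).1
    have hy := (Complex.nonneg_iff.1 hY).1
    rw [Complex.normSq_eq_norm_sq] at hre
    have : 4 ≤ ‖μ‖ ^ 2 := by
      by_contra! hlt
      nlinarith
    nlinarith [norm_nonneg μ]
  have hprod : ∀ s : Multiset ℂ, (∀ μ ∈ s, 2 ≤ ‖μ‖) → 2 ^ s.card ≤ ‖s.prod‖ := by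
    intro s
    induction s using Multiset.induction with
    | empty => simp
    | cons a s ih =>
      intro h
      rw [Multiset.card_cons, Multiset.prod_cons, norm_mul, pow_succ']
      exact mul_le_mul (h a (Multiset.mem_cons_self a s))
        (ih fun μ hμ => h μ (Multiset.mem_cons_of_mem hμ)) (by positivity) (norm_nonneg _)
  rw [Matrix.det_eq_prod_roots_charpoly]
  have hcard : X.charpoly.roots.card = Fintype.card n := by
    rw [← (IsAlgClosed.splits X.charpoly).natDegree_eq_card_roots,
      Matrix.charpoly_natDegree_eq_dim]
  rw [← hcard]
  exact hprod _ hroot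

/-- The determinant `hkDet` as a function of the stability matrix. -/
noncomputable def hkDetOf (Γ : Matrix (Fin D) (Fin D) ℝ) (L : Phase D →L[ℝ] Phase D) : ℂ :=
  (hkMatrix Γ (Matrix.of fun i j => (L (EuclideanSpace.single j 1, 0)).1 i)
    (Matrix.of fun i j => (L (0, EuclideanSpace.single j 1)).1 i)
    (Matrix.of fun i j => (L (EuclideanSpace.single j 1, 0)).2 i)
    (Matrix.of fun i j => (L (0, EuclideanSpace.single j 1)).2 i)).det

theorem hkDet_eq_hkDetOf (Γ : Matrix (Fin D) (Fin D) ℝ) (V : Config D → ℝ) (t : ℝ) (z : Phase D) :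
    hkDet Γ V t z = hkDetOf Γ (stability V t z) := rfl

/-- The matrix entries are linear in `L` and the determinant is a polynomial in them.
Differentiability is needed because the branch is constructed from the logarithmic derivative in
time. -/
theorem contDiff_hkDetOf (Γ : Matrix (Fin D) (Fin D) ℝ) : ContDiff ℝ 1 (hkDetOf (D := D) Γ) := by
  unfold hkDetOf
  simp only [Matrix.det_apply]
  refine ContDiff.sum fun σ _ => ContDiff.const_smul _ (contDiff_prod fun i _ => ?_)
  have hlin : IsLinearMap ℝ fun L : Phase D →L[ℝ] Phase D =>
      hkMatrix Γ (Matrix.of fun i j => (L (EuclideanSpace.single j 1, 0)).1 i)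
        (Matrix.of fun i j => (L (0, EuclideanSpace.single j 1)).1 i)
        (Matrix.of fun i j => (L (EuclideanSpace.single j 1, 0)).2 i)
        (Matrix.of fun i j => (L (0, EuclideanSpace.single j 1)).2 i) (σ i) i := by
    constructor
    · intro L L'
      simp only [hkMatrix, Matrix.add_apply, Matrix.map_apply, Matrix.mul_apply, Matrix.of_apply,
        Matrix.smul_apply, Matrix.sub_apply, add_apply, Prod.fst_add, Prod.snd_add, PiLp.add_apply,
        mul_add, add_mul, Finset.sum_add_distrib, Complex.ofReal_add, Complex.ofReal_sub, smul_add,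
        smul_sub]
      ring
    · intro c L
      simp only [hkMatrix, Matrix.add_apply, Matrix.map_apply, Matrix.mul_apply, Matrix.of_apply,
        Matrix.smul_apply, Matrix.sub_apply, smul_apply, Prod.smul_fst, Prod.smul_snd,
        PiLp.smul_apply, smul_eq_mul, mul_assoc, mul_left_comm _ c, ← Finset.mul_sum,
        Complex.ofReal_add, Complex.ofReal_sub, Complex.ofReal_mul, Complex.real_smul]
      ring
  exact (LinearMap.toContinuousLinearMap (hlin.mk' _)).contDiff

theorem hkDetOf_id {Γ : Matrix (Fin D) (Fin D) ℝ} (hΓ : Γ.PosDef) :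
    hkDetOf Γ (ContinuousLinearMap.id ℝ (Phase D)) = 2 ^ D := by
  have hdet : IsUnit Γ.det := hΓ.det_pos.ne'.isUnit
  have e1 : (Matrix.of fun i j => (EuclideanSpace.single (𝕜 := ℝ) j (1 : ℝ)) i : Matrix (Fin D) (Fin D) ℝ) = 1 := by
    ext i j
    simp [Matrix.one_apply]
  have e0 : (Matrix.of fun i _ => (0 : Config D) i : Matrix (Fin D) (Fin D) ℝ) = 0 := by
    ext i j
    simp
  simp only [hkDetOf, ContinuousLinearMap.id_apply, e1, e0, hkMatrix]
  rw [Matrix.mul_one, Matrix.nonsing_inv_mul _ hdet, Matrix.mul_zero, Matrix.zero_mul, sub_zero]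
  have : (1 + 1 : Matrix (Fin D) (Fin D) ℝ).map Complex.ofReal
      + Complex.I • (0 : Matrix (Fin D) (Fin D) ℝ).map Complex.ofReal = (2 : ℂ) • 1 := by
    ext i j
    simp only [Matrix.add_apply, Matrix.map_apply, Matrix.one_apply, Matrix.smul_apply,
      Matrix.zero_apply]
    split_ifs <;> norm_num
  rw [this, Matrix.det_smul, Matrix.det_one]
  simp

theorem IsSubquadratic.two_pow_le_norm_hkDet (hV : IsSubquadratic V)
    {Γ : Matrix (Fin D) (Fin D) ℝ} (hΓ : Γ.PosDef) (t : ℝ) (z : Phase D) :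
    2 ^ D ≤ ‖hkDet Γ V t z‖ := by
  -- The three block relations are the invariance of the symplectic form on pairs of position
  -- vectors, pairs of momentum vectors, and mixed pairs of basis vectors.
  have h := two_pow_le_norm_det_hkMatrix (A := stabQQ V t z) (B := stabQP V t z)
    (C := stabPQ V t z) (E := stabPP V t z) hΓ
    (by
      ext i j
      have := hV.symplectic_stability t z (EuclideanSpace.single i 1, 0) (EuclideanSpace.single j 1, 0)
      simp [PiLp.inner_apply] at this
      simp only [Matrix.mul_apply, Matrix.transpose_apply, stabQQ, stabPQ, Matrix.of_apply]
      simp only [mul_comm] at this ⊢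
      linarith)
    (by
      ext i j
      have := hV.symplectic_stability t z (0, EuclideanSpace.single i 1) (0, EuclideanSpace.single j 1)
      simp [PiLp.inner_apply] at this
      simp only [Matrix.mul_apply, Matrix.transpose_apply, stabQP, stabPP, Matrix.of_apply]
      simp only [mul_comm] at this ⊢
      linarith)
    (by
      ext i j
      have := hV.symplectic_stability t z (EuclideanSpace.single i 1, 0) (0, EuclideanSpace.single j 1)
      simp [PiLp.inner_apply] at this
      simp only [Matrix.mul_apply, Matrix.transpose_apply, Matrix.sub_apply, stabQQ, stabPP, stabPQ, stabQP,
        Matrix.of_apply, Matrix.one_apply]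
      simp only [mul_comm] at this ⊢
      linarith)
  rw [Fintype.card_fin] at h
  exact h

theorem IsSubquadratic.continuous_hkDet (hV : IsSubquadratic V) (Γ : Matrix (Fin D) (Fin D) ℝ) :
    Continuous fun p : ℝ × Phase D => hkDet Γ V p.1 p.2 :=
  (contDiff_hkDetOf Γ).continuous.comp hV.continuous_stability

/-- The time derivative of the stability matrix. -/
noncomputable def stabilityDeriv (V : Config D → ℝ) (t : ℝ) (z : Phase D) : Phase D →L[ℝ] Phase D :=
  (fderiv ℝ (hamiltonField V) (flow V t z)).comp (stability V t z)

/-- The time derivative of `hkDet`. -/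
noncomputable def hkDetDeriv (Γ : Matrix (Fin D) (Fin D) ℝ) (V : Config D → ℝ) (t : ℝ)
    (z : Phase D) : ℂ :=
  fderiv ℝ (hkDetOf Γ) (stability V t z) (stabilityDeriv V t z)

theorem IsSubquadratic.hasDerivAt_hkDet (hV : IsSubquadratic V) (Γ : Matrix (Fin D) (Fin D) ℝ)
    (t : ℝ) (z : Phase D) :
    HasDerivAt (fun t => hkDet Γ V t z) (hkDetDeriv Γ V t z) t := by
  have h : HasFDerivAt (hkDetOf Γ) (fderiv ℝ (hkDetOf Γ) (stability V t z)) (stability V t z) :=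
    ((contDiff_hkDetOf Γ).differentiable (by norm_num) _).hasFDerivAt
  exact h.comp_hasDerivAt t ((hV.stability_spec z).2 t)

theorem IsSubquadratic.continuous_hkDetDeriv (hV : IsSubquadratic V)
    (Γ : Matrix (Fin D) (Fin D) ℝ) :
    Continuous fun p : ℝ × Phase D => hkDetDeriv Γ V p.1 p.2 := by
  obtain ⟨K, C, hF⟩ := hV.exists_isTameField
  have h1 : Continuous fun p : ℝ × Phase D => fderiv ℝ (hkDetOf Γ) (stability V p.1 p.2) :=
    ((contDiff_hkDetOf Γ).continuous_fderiv (by norm_num)).comp hV.continuous_stability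
  have h2 : Continuous fun p : ℝ × Phase D => fderiv ℝ (hamiltonField V) (flow V p.1 p.2) :=
    (hF.contDiff.continuous_fderiv (by norm_num)).comp hV.continuous_flow
  exact h1.clm_apply (h2.clm_comp hV.continuous_stability)

theorem continuous_uncurry_swap {X Y Z : Type*} [TopologicalSpace X] [TopologicalSpace Y]
    [TopologicalSpace Z] {f : Y → X → Z} (h : Continuous fun p : Y × X => f p.1 p.2) :
    Continuous (Function.uncurry fun x y => f y x) :=
  h.comp continuous_swap

/-- A jointly continuous square root of a nonvanishing family of paths. -/
theorem exists_continuous_sqrt {X : Type*} [TopologicalSpace X]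
    [FirstCountableTopology X] {d d' : X → ℝ → ℂ}
    (hd : ∀ x t, HasDerivAt (d x) (d' x t) t) (hd0 : ∀ x t, d x t ≠ 0)
    (hcd : Continuous (Function.uncurry d)) (hcd' : Continuous (Function.uncurry d'))
    (h1 : ∀ x, d x 0 = 1) :
    ∃ R : X → ℝ → ℂ, Continuous (Function.uncurry R) ∧
      ∀ x, R x 0 = 1 ∧ ∀ t, R x t ^ 2 = d x t := by
  -- The square root is `exp (½ ∫₀ᵗ d'/d)`. It is jointly continuous because the primitive is, and
  -- its square is `d` because `d · exp (-∫ d'/d)` has derivative zero and equals 1 at time 0.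
  let q : X → ℝ → ℂ := fun x t => d' x t / d x t
  have hq : Continuous (Function.uncurry q) := hcd'.div hcd fun p => hd0 p.1 p.2
  let I : X → ℝ → ℂ := fun x t => ∫ s in (0 : ℝ)..t, q x s
  have hI : Continuous fun p : X × ℝ => I p.1 p.2 :=
    intervalIntegral.continuous_parametric_primitive_of_continuous hq
  have hId : ∀ x t, HasDerivAt (I x) (q x t) t := fun x t => by
    have hqx : Continuous (q x) := hq.comp (by fun_prop : Continuous fun s : ℝ => (x, s))
    exact intervalIntegral.integral_hasDerivAt_right (hqx.intervalIntegrable _ _)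
      (hqx.stronglyMeasurableAtFilter _ _) hqx.continuousAt
  have hI0 : ∀ x, I x 0 = 0 := fun x => intervalIntegral.integral_same
  refine ⟨fun x t => Complex.exp (I x t / 2), Complex.continuous_exp.comp (hI.div_const 2),
    fun x => ⟨by simp [hI0], fun t => ?_⟩⟩
  have hconst : ∀ s, HasDerivAt (fun s => d x s * Complex.exp (-I x s)) 0 s := fun s => by
    refine ((hd x s).mul (hId x s).neg.cexp).congr_deriv ?_
    have := hd0 x s
    simp only [q]
    field_simp
    ring
  have h := is_const_of_deriv_eq_zero (fun s => (hconst s).differentiableAt)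
    (fun s => (hconst s).deriv) t 0
  rw [h1, hI0, neg_zero, Complex.exp_zero, mul_one, Complex.exp_neg] at h
  rw [← Complex.exp_nat_mul, Nat.cast_ofNat, mul_div_cancel₀ _ two_ne_zero]
  exact (mul_inv_eq_one₀ (Complex.exp_ne_zero _)).1 h |>.symm

/-- A jointly continuous choice of the prefactor branches. -/
theorem IsSubquadratic.exists_continuous_branch (hV : IsSubquadratic V)
    {Γ : Matrix (Fin D) (Fin D) ℝ} (hΓ : Γ.PosDef) :
    ∃ R : Phase D → ℝ → ℂ, Continuous (Function.uncurry R) ∧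
      ∀ z, IsPrefactorBranch Γ V z (R z) := by
  have h2 : ((2 : ℂ) ^ D)⁻¹ ≠ 0 := inv_ne_zero (pow_ne_zero D two_ne_zero)
  obtain ⟨R, hR, h⟩ := exists_continuous_sqrt (X := Phase D)
    (d := fun z t => ((2 : ℂ) ^ D)⁻¹ * hkDet Γ V t z)
    (d' := fun z t => ((2 : ℂ) ^ D)⁻¹ * hkDetDeriv Γ V t z)
    (fun z t => (hV.hasDerivAt_hkDet Γ t z).const_mul _)
    (fun z t => mul_ne_zero h2 fun h => by
      have := hV.two_pow_le_norm_hkDet hΓ t z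
      rw [h, norm_zero] at this
      exact absurd this (not_le.2 (by positivity)))
    (continuous_uncurry_swap (f := fun t z => ((2 : ℂ) ^ D)⁻¹ * hkDet Γ V t z)
      (continuous_const.mul (hV.continuous_hkDet Γ)))
    (continuous_uncurry_swap (f := fun t z => ((2 : ℂ) ^ D)⁻¹ * hkDetDeriv Γ V t z)
      (continuous_const.mul (hV.continuous_hkDetDeriv Γ)))
    (fun z => by
      rw [hkDet_eq_hkDetOf, (hV.stability_spec z).1, hkDetOf_id hΓ]
      exact inv_mul_cancel₀ (pow_ne_zero D two_ne_zero))
  exact ⟨R, hR, fun z => ⟨hR.comp (by fun_prop : Continuous fun s : ℝ => (z, s)), h z⟩⟩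

/-- On a connected set two continuous square roots of a nonvanishing function that agree at one
point agree everywhere; nonvanishing is the lower bound on `hkDet`. -/
theorem IsPrefactorBranch.unique (hV : IsSubquadratic V)
    {Γ : Matrix (Fin D) (Fin D) ℝ} (hΓ : Γ.PosDef) {z : Phase D} {r r' : ℝ → ℂ}
    (h : IsPrefactorBranch Γ V z r) (h' : IsPrefactorBranch Γ V z r') : r = r' := by
  funext t
  refine isPreconnected_univ.eq_of_sq_eq h.1.continuousOn h'.1.continuousOn
    (fun s _ => by simp only [Pi.pow_apply, h.2.2, h'.2.2]) (fun {s} _ hs => ?_) (mem_univ 0)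
    (h.2.1.trans h'.2.1.symm) (mem_univ t)
  have h1 := h'.2.2 s
  rw [hs, zero_pow two_ne_zero] at h1
  have h2 := hV.two_pow_le_norm_hkDet hΓ s z
  have h3 : hkDet Γ V s z = 0 := by
    simpa using h1.symm
  rw [h3, norm_zero] at h2
  exact absurd h2 (not_le.2 (by positivity))

theorem IsSubquadratic.isPrefactorBranch_prefactor (hV : IsSubquadratic V)
    {Γ : Matrix (Fin D) (Fin D) ℝ} (hΓ : Γ.PosDef) (z : Phase D) :
    IsPrefactorBranch Γ V z fun t => prefactor Γ V t z := by
  obtain ⟨R, -, hR⟩ := hV.exists_continuous_branch hΓ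
  exact Classical.epsilon_spec (p := IsPrefactorBranch Γ V z) ⟨_, hR z⟩

/-- The definition chooses a branch separately for each `z`, which by itself says nothing about the
dependence on `z`. By uniqueness these choices coincide with the jointly continuous family. -/
theorem IsSubquadratic.continuous_prefactor (hV : IsSubquadratic V)
    {Γ : Matrix (Fin D) (Fin D) ℝ} (hΓ : Γ.PosDef) (t : ℝ) : Continuous (prefactor Γ V t) := by
  obtain ⟨R, hc, hR⟩ := hV.exists_continuous_branch hΓ
  have e : prefactor Γ V t = fun z => R z t := by
    funext z
    exact congrFun (IsPrefactorBranch.unique hV hΓ (hV.isPrefactorBranch_prefactor hΓ z) (hR z)) t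
  rw [e]
  exact hc.comp (by fun_prop : Continuous fun z : Phase D => (z, t))

theorem IsSubquadratic.one_le_norm_prefactor (hV : IsSubquadratic V)
    {Γ : Matrix (Fin D) (Fin D) ℝ} (hΓ : Γ.PosDef) (t : ℝ) (z : Phase D) :
    1 ≤ ‖prefactor Γ V t z‖ := by
  have h := congrArg norm ((hV.isPrefactorBranch_prefactor hΓ z).2.2 t)
  have h2 := hV.two_pow_le_norm_hkDet hΓ t z
  simp only [norm_pow, norm_mul, norm_inv, Complex.norm_ofNat] at h
  have : 1 ≤ ‖prefactor Γ V t z‖ ^ 2 := by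
    rw [h, inv_mul_eq_div, le_div_iff₀ (by positivity), one_mul]
    exact h2
  nlinarith [norm_nonneg (prefactor Γ V t z)]

/-- At fixed time the stability matrices of all trajectories lie in one closed ball, which is
compact, and the determinant is continuous there. -/
theorem IsSubquadratic.exists_norm_prefactor_le (hV : IsSubquadratic V)
    {Γ : Matrix (Fin D) (Fin D) ℝ} (hΓ : Γ.PosDef) (t : ℝ) :
    ∃ B, 0 ≤ B ∧ ∀ z, ‖prefactor Γ V t z‖ ≤ B := by
  obtain ⟨B, hB⟩ := hV.exists_norm_stability_le t
  have : ProperSpace (Phase D →L[ℝ] Phase D) := FiniteDimensional.proper ℝ _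
  obtain ⟨M, hM⟩ := (isCompact_closedBall (0 : Phase D →L[ℝ] Phase D) B).exists_bound_of_continuousOn
    (contDiff_hkDetOf Γ).continuous.continuousOn
  refine ⟨1 + |M|, by positivity, fun z => ?_⟩
  have h := congrArg norm ((hV.isPrefactorBranch_prefactor hΓ z).2.2 t)
  have h2 := hM (stability V t z) (by simpa using hB z)
  rw [← hkDet_eq_hkDetOf] at h2
  simp only [norm_pow, norm_mul, norm_inv, Complex.norm_ofNat] at h
  have h3 : ((2 : ℝ) ^ D)⁻¹ ≤ 1 := inv_le_one_of_one_le₀ (one_le_pow₀ one_le_two)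
  have : ‖prefactor Γ V t z‖ ^ 2 ≤ |M| := by
    rw [h]
    exact (mul_le_of_le_one_left (norm_nonneg _) h3).trans (h2.trans (le_abs_self M))
  nlinarith [norm_nonneg (prefactor Γ V t z), abs_nonneg M]

theorem IsSubquadratic.continuous_action (hV : IsSubquadratic V) (t : ℝ) :
    Continuous (action V t) := by
  have hflow : Continuous fun p : Phase D × ℝ => flow V p.2 p.1 :=
    hV.continuous_flow.comp continuous_swap
  have h : Continuous (Function.uncurry fun (z : Phase D) (s : ℝ) =>
      ‖(flow V s z).2‖ ^ 2 / 2 - V (flow V s z).1) :=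
    ((hflow.snd.norm.pow 2).div_const 2).sub (hV.1.continuous.comp hflow.fst)
  exact intervalIntegral.continuous_parametric_intervalIntegral_of_continuous' h 0 t

end Prefactor

end HermanKluk

/-! ### Plancherel's theorem for the Fourier integral -/

section Plancherel

open scoped FourierTransform

variable {E : Type*} [NormedAddCommGroup E] [InnerProductSpace ℝ E] [FiniteDimensional ℝ E]
  [MeasurableSpace E] [BorelSpace E]

theorem eLpNorm_two_rpow {X F : Type*} [MeasurableSpace X] [NormedAddCommGroup F] {μ : Measure X}
    (u : X → F) : eLpNorm u 2 μ ^ (2 : ℝ) = ∫⁻ x, ‖u x‖ₑ ^ 2 ∂μ := by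
  rw [eLpNorm_eq_lintegral_rpow_enorm_toReal (by norm_num) (by norm_num), ← ENNReal.rpow_mul]
  simp

theorem MeasureTheory.MemLp.lintegral_enorm_sq_lt_top {X F : Type*} [MeasurableSpace X]
    [NormedAddCommGroup F] {μ : Measure X} {u : X → F} (h : MemLp u 2 μ) :
    ∫⁻ x, ‖u x‖ₑ ^ 2 ∂μ < ⊤ := by
  rw [← eLpNorm_two_rpow]
  exact ENNReal.rpow_lt_top_of_nonneg (by norm_num) h.2.ne

/-- Plancherel's theorem for functions in `L¹ ∩ L²`. -/
theorem lintegral_enorm_sq_fourier {f : E → ℂ} (h1 : Integrable f) (h2 : MemLp f 2) :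
    ∫⁻ ξ, ‖𝓕 f ξ‖ₑ ^ 2 = ∫⁻ x, ‖f x‖ₑ ^ 2 := by
  set H : Lp ℂ 2 (volume : Measure E) := h2.toLp f with hH
  have hcont : Continuous (𝓕 f) :=
    VectorFourier.fourierIntegral_continuous Real.continuous_fourierChar
      (L := innerₗ E) continuous_inner h1
  -- The `L²` Fourier transform and the Fourier integral have the same pairing with compactly
  -- supported smooth functions: the first as a tempered distribution, the second by Fubini. Hence
  -- they agree almost everywhere, and the `L²` isometry transfers.
  have hae : ∀ᵐ ξ, (𝓕 H : Lp ℂ 2 (volume : Measure E)) ξ = 𝓕 f ξ := by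
    refine ae_eq_of_integral_contDiff_smul_eq
      ((Lp.memLp _).locallyIntegrable (by norm_num)) hcont.locallyIntegrable ?_
    intro g hg hgc
    let φ : 𝓢(E, ℂ) := (hgc.comp_left (g := Complex.ofReal) rfl).toSchwartzMap
      (Complex.ofRealCLM.contDiff.comp hg)
    have hφ : ∀ x, φ x = (g x : ℂ) := fun x => rfl
    have e1 := congrArg (fun T => T φ) (Lp.fourier_toTemperedDistribution_eq H)
    simp only [TemperedDistribution.fourier_apply, Lp.toTemperedDistribution_apply] at e1
    have e2 : ∫ ξ, (𝓕 f ξ) • φ ξ = ∫ x, f x • 𝓕 φ x := by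
      simpa using! VectorFourier.integral_fourierIntegral_smul_eq_flip (L := innerₗ E)
        Real.continuous_fourierChar continuous_inner h1 φ.integrable
    calc ∫ x, g x • (𝓕 H : Lp ℂ 2 (volume : Measure E)) x
        = ∫ x, φ x • (𝓕 H : Lp ℂ 2 (volume : Measure E)) x := by simp [hφ]
      _ = ∫ x, 𝓕 φ x • H x := e1.symm
      _ = ∫ x, f x • 𝓕 φ x := by
          refine integral_congr_ae ?_
          filter_upwards [h2.coeFn_toLp] with x hx
          rw [hH, hx, smul_eq_mul, smul_eq_mul, mul_comm]
      _ = ∫ x, g x • 𝓕 f x := by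
          rw [← e2]
          simp [hφ, mul_comm]
  have hn := Lp.norm_fourier_eq H
  rw [Lp.norm_def, Lp.norm_def, ENNReal.toReal_eq_toReal_iff' (Lp.eLpNorm_ne_top _)
    (Lp.eLpNorm_ne_top _), eLpNorm_congr_ae hae, eLpNorm_congr_ae h2.coeFn_toLp] at hn
  rw [← eLpNorm_two_rpow, ← eLpNorm_two_rpow, hn]

end Plancherel

namespace HermanKluk

open Set
open scoped Topology InnerProductSpace Matrix

variable {D : ℕ} {ε : ℝ} {Γ : Matrix (Fin D) (Fin D) ℝ}

/-! ### Wavepackets: Gaussian bounds and the isometry of the wavepacket transform -/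

section Gaussian

/-- The quadratic form `uᵀ Γ u`. -/
noncomputable def quad (Γ : Matrix (Fin D) (Fin D) ℝ) (u : Config D) : ℝ :=
  u.ofLp ⬝ᵥ Γ.mulVec u.ofLp

theorem contDiff_quad (Γ : Matrix (Fin D) (Fin D) ℝ) : ContDiff ℝ ∞ (quad Γ) := by
  unfold quad
  simp only [dotProduct, Matrix.mulVec]
  have h : ∀ i, ContDiff ℝ ∞ fun u : Config D => u.ofLp i := fun i =>
    (EuclideanSpace.proj (𝕜 := ℝ) i).contDiff
  exact ContDiff.sum fun i _ => (h i).mul (ContDiff.sum fun j _ => contDiff_const.mul (h j))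

theorem quad_smul (c : ℝ) (u : Config D) : quad Γ (c • u) = c ^ 2 * quad Γ u := by
  simp only [quad, WithLp.ofLp_smul, Matrix.mulVec_smul, dotProduct_smul,
    smul_dotProduct, smul_eq_mul]
  ring

theorem exists_quad_lower_bound (hΓ : Γ.PosDef) : ∃ c, 0 < c ∧ ∀ u, c * ‖u‖ ^ 2 ≤ quad Γ u := by
  have hpos : ∀ u : Config D, u ≠ 0 → 0 < quad Γ u := fun u hu => by
    have h0 : u.ofLp ≠ 0 := fun h => hu (by ext i; simpa using congrFun h i)
    simpa [quad] using hΓ.dotProduct_mulVec_pos h0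
  -- The constant is the minimum of the form on the unit sphere, which is empty when `D = 0`.
  by_cases hne : (Metric.sphere (0 : Config D) 1).Nonempty
  · obtain ⟨u₀, hu₀, hmin⟩ := (isCompact_sphere (0 : Config D) 1).exists_isMinOn hne
      (contDiff_quad Γ).continuous.continuousOn
    have hu₀' : u₀ ≠ 0 := fun h => by simp [h] at hu₀
    refine ⟨quad Γ u₀, hpos u₀ hu₀', fun u => ?_⟩
    by_cases hu : u = 0
    · simp [hu, quad]
    have hn : ‖u‖ ≠ 0 := norm_ne_zero_iff.2 hu
    have h := hmin (show ‖u‖⁻¹ • u ∈ Metric.sphere (0 : Config D) 1 by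
      simp [norm_smul, inv_mul_cancel₀ hn])
    simp only [mem_ofPred_eq, quad_smul] at h
    have := mul_le_mul_of_nonneg_right h (sq_nonneg ‖u‖)
    have e : ‖u‖⁻¹ ^ 2 * quad Γ u * ‖u‖ ^ 2 = quad Γ u := by field_simp
    linarith
  · refine ⟨1, one_pos, fun u => ?_⟩
    have : u = 0 := by
      by_contra hu
      exact hne ⟨‖u‖⁻¹ • u, by simp [norm_smul, inv_mul_cancel₀ (norm_ne_zero_iff.2 hu)]⟩
    simp [this, quad]

/-- The modulus of a wavepacket centred at the origin. -/
noncomputable def envelope (ε : ℝ) (Γ : Matrix (Fin D) (Fin D) ℝ) (u : Config D) : ℝ :=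
  (Γ.det / (Real.pi ^ D * ε ^ D)) ^ (1 / 4 : ℝ) * Real.exp (-(1 / (2 * ε)) * quad Γ u)

theorem gaussian_eq (z : Phase D) (x : Config D) :
    gaussian ε Γ z x = (envelope ε Γ (x - z.1) : ℂ)
      * Complex.exp (((⟪z.2, x - z.1⟫_ℝ / ε : ℝ) : ℂ) * Complex.I) := by
  simp only [gaussian, envelope, Complex.exp_add, quad]
  push_cast
  rw [mul_assoc]
  congr 3
  ring

theorem envelope_pos (hε : 0 < ε) (hΓ : Γ.PosDef) (u : Config D) : 0 < envelope ε Γ u := by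
  have := hΓ.det_pos
  unfold envelope
  positivity

theorem contDiff_envelope : ContDiff ℝ ∞ (envelope (D := D) ε Γ) :=
  contDiff_const.mul (contDiff_const.mul (contDiff_quad Γ)).exp

theorem continuous_envelope : Continuous (envelope (D := D) ε Γ) :=
  contDiff_envelope.continuous

theorem norm_gaussian (hε : 0 < ε) (hΓ : Γ.PosDef) (z : Phase D) (x : Config D) :
    ‖gaussian ε Γ z x‖ = envelope ε Γ (x - z.1) := by
  rw [gaussian_eq, norm_mul, Complex.norm_exp_ofReal_mul_I, mul_one, Complex.norm_real,
    Real.norm_of_nonneg (envelope_pos hε hΓ _).le]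

theorem continuous_gaussian :
    Continuous fun p : Phase D × Config D => gaussian ε Γ p.1 p.2 := by
  simp only [gaussian_eq]
  refine (Complex.continuous_ofReal.comp (continuous_envelope.comp (by fun_prop))).mul ?_
  fun_prop

theorem exists_envelope_le (hε : 0 < ε) (hΓ : Γ.PosDef) :
    ∃ C b, 0 < C ∧ 0 < b ∧ ∀ u : Config D, envelope ε Γ u ≤ C * Real.exp (-b * ‖u‖ ^ 2) := by
  obtain ⟨c, hc, h⟩ := exists_quad_lower_bound hΓ
  have hdet := hΓ.det_pos
  refine ⟨(Γ.det / (Real.pi ^ D * ε ^ D)) ^ (1 / 4 : ℝ), 1 / (2 * ε) * c, by positivity,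
    by positivity, fun u => ?_⟩
  refine mul_le_mul_of_nonneg_left (Real.exp_le_exp.2 ?_) (by positivity)
  have := mul_le_mul_of_nonneg_left (h u) (by positivity : 0 ≤ 1 / (2 * ε))
  linarith

/-- Exponentially weighted Gaussians are integrable. -/
theorem integrable_exp_mul_norm_mul_envelope (hε : 0 < ε) (hΓ : Γ.PosDef) (a : ℝ) :
    Integrable fun u : Config D => Real.exp (a * ‖u‖) * envelope ε Γ u := by
  obtain ⟨C, b, hC, hb, h⟩ := exists_envelope_le (D := D) hε hΓ
  have hint : Integrable fun u : Config D => C * Real.exp (a ^ 2 / (2 * b)) *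
      Real.exp (-(b / 2) * ‖u‖ ^ 2) := by
    have := (GaussianFourier.integrable_cexp_neg_mul_sq_norm_add (V := Config D)
      (b := (b / 2 : ℝ)) (by simpa using hb) 0 0).norm
    refine (this.const_mul (C * Real.exp (a ^ 2 / (2 * b)))).congr ?_
    filter_upwards with u
    simp only [Complex.norm_exp]
    congr 2
    simp [← Complex.ofReal_pow]
  refine hint.mono' ?_ ?_
  · exact ((Real.continuous_exp.comp (continuous_const.mul continuous_norm)).mul
      continuous_envelope).aestronglyMeasurable
  · filter_upwards with u
    rw [Real.norm_of_nonneg (mul_nonneg (Real.exp_pos _).le (envelope_pos hε hΓ u).le)]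
    calc Real.exp (a * ‖u‖) * envelope ε Γ u
        ≤ Real.exp (a * ‖u‖) * (C * Real.exp (-b * ‖u‖ ^ 2)) :=
          mul_le_mul_of_nonneg_left (h u) (Real.exp_pos _).le
      _ = C * Real.exp (a * ‖u‖ + -b * ‖u‖ ^ 2) := by rw [Real.exp_add]; ring
      _ ≤ C * Real.exp (a ^ 2 / (2 * b) + -(b / 2) * ‖u‖ ^ 2) := by
          refine mul_le_mul_of_nonneg_left (Real.exp_le_exp.2 ?_) hC.le
          -- Young's inequality: half of the Gaussian decay absorbs the exponential weight.
          have : a * ‖u‖ ≤ a ^ 2 / (2 * b) + b / 2 * ‖u‖ ^ 2 := by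
            rw [div_add' _ _ _ (by positivity), le_div_iff₀ (by positivity)]
            nlinarith [sq_nonneg (a - b * ‖u‖)]
          linarith
      _ = _ := by rw [Real.exp_add]; ring

theorem memLp_exp_mul_norm_mul_envelope (hε : 0 < ε) (hΓ : Γ.PosDef) (a : ℝ) :
    MemLp (fun u : Config D => Real.exp (a * ‖u‖) * envelope ε Γ u) 2 := by
  obtain ⟨C, b, hC, hb, h⟩ := exists_envelope_le (D := D) hε hΓ
  have hm : Continuous fun u : Config D => Real.exp (a * ‖u‖) * envelope ε Γ u :=
    (Real.continuous_exp.comp (continuous_const.mul continuous_norm)).mul continuous_envelope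
  rw [memLp_two_iff_integrable_sq hm.aestronglyMeasurable]
  refine ((integrable_exp_mul_norm_mul_envelope (D := D) hε hΓ (2 * a)).const_mul C).mono'
    (hm.pow 2).aestronglyMeasurable ?_
  filter_upwards with u
  have h1 : envelope ε Γ u ≤ C := (h u).trans (mul_le_of_le_one_right hC.le
    (Real.exp_le_one_iff.2 (by nlinarith [sq_nonneg ‖u‖])))
  have h0 := envelope_pos hε hΓ u
  rw [Real.norm_of_nonneg (by positivity), mul_pow, ← Real.exp_nat_mul, pow_two (envelope ε Γ u)]
  push_cast
  rw [← mul_assoc 2 a]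
  have := mul_le_mul_of_nonneg_right h1 (mul_pos (Real.exp_pos (2 * a * ‖u‖)) h0).le
  linarith

theorem memLp_envelope (hε : 0 < ε) (hΓ : Γ.PosDef) : MemLp (envelope (D := D) ε Γ) 2 := by
  simpa using memLp_exp_mul_norm_mul_envelope (D := D) hε hΓ 0

theorem exists_envelope_le_const (hε : 0 < ε) (hΓ : Γ.PosDef) :
    ∃ C, 0 < C ∧ ∀ u : Config D, envelope ε Γ u ≤ C := by
  obtain ⟨C, b, hC, hb, h⟩ := exists_envelope_le (D := D) hε hΓ
  exact ⟨C, hC, fun u => (h u).trans (mul_le_of_le_one_right hC.le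
    (Real.exp_le_one_iff.2 (by nlinarith [sq_nonneg ‖u‖])))⟩

theorem bracket_congr_right {f g g' : Config D → ℂ} (h : g =ᵐ[volume] g') :
    bracket f g = bracket f g' := by
  refine integral_congr_ae ?_
  filter_upwards [h] with x hx
  rw [hx]

theorem bracket_conj (f g : Config D → ℂ) : bracket f g = (starRingEnd ℂ) (bracket g f) := by
  rw [bracket, bracket, ← integral_conj]
  simp [mul_comm]

theorem norm_bracket_comm (f g : Config D → ℂ) : ‖bracket f g‖ = ‖bracket g f‖ := by
  rw [bracket_conj, RCLike.norm_conj]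

theorem stronglyMeasurable_bracket {ψ : Config D → ℂ} (hψ : AEStronglyMeasurable ψ volume) :
    StronglyMeasurable fun z => bracket (gaussian ε Γ z) ψ := by
  have e : (fun z => bracket (gaussian ε Γ z) ψ) = fun z => bracket (gaussian ε Γ z) (hψ.mk ψ) :=
    funext fun z => bracket_congr_right hψ.ae_eq_mk
  rw [e]
  refine StronglyMeasurable.integral_prod_right
    (f := fun z x => (starRingEnd ℂ) (gaussian ε Γ z x) * hψ.mk ψ x) ?_
  exact (Complex.continuous_conj.comp continuous_gaussian).stronglyMeasurable.mul
    (hψ.stronglyMeasurable_mk.comp_measurable measurable_snd)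

-- At fixed `q` the transform is, up to the unimodular phase `exp (i⟨p, q⟩/ε)`, a Fourier transform
-- of `ψ` windowed around `q`. The factor `2πε` converts `exp (-i⟨p, x⟩/ε)` to the convention `exp
-- (-2πi⟨x, ξ⟩)`.
open scoped FourierTransform in
theorem norm_bracket_gaussian_eq_norm_fourier (hε : 0 < ε) (ψ : Config D → ℂ) (q p : Config D) :
    ‖bracket (gaussian ε Γ (q, p)) ψ‖ =
      ‖𝓕 (fun x => (envelope ε Γ (x - q) : ℂ) * ψ x) ((2 * Real.pi * ε)⁻¹ • p)‖ := by
  have e : bracket (gaussian ε Γ (q, p)) ψ = Complex.exp (((⟪p, q⟫_ℝ / ε : ℝ) : ℂ) * Complex.I) *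
      𝓕 (fun x => (envelope ε Γ (x - q) : ℂ) * ψ x) ((2 * Real.pi * ε)⁻¹ • p) := by
    rw [Real.fourier_eq', bracket, ← integral_const_mul]
    refine integral_congr_ae (Filter.Eventually.of_forall fun x => ?_)
    simp only [gaussian_eq, map_mul, Complex.conj_ofReal, ← Complex.exp_conj, Complex.conj_I,
      smul_eq_mul, real_inner_smul_right]
    rw [mul_comm (envelope ε Γ (x - q) : ℂ), mul_assoc, ← mul_assoc (Complex.exp _) (Complex.exp _),
      ← Complex.exp_add]
    congr 2
    rw [inner_sub_right, real_inner_comm x p]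
    have hπ := Real.pi_ne_zero
    have hε' := hε.ne'
    have e1 : -2 * Real.pi * ((2 * Real.pi * ε)⁻¹ * ⟪x, p⟫_ℝ) = -(⟪x, p⟫_ℝ / ε) := by
      field_simp
    rw [e1]
    push_cast
    ring
  rw [e, norm_mul, Complex.norm_exp_ofReal_mul_I, one_mul]

theorem lintegral_comp_inv_smul (g : Config D → ℝ≥0∞) {r : ℝ} (hr : 0 < r) :
    ∫⁻ p, g (r⁻¹ • p) = ENNReal.ofReal (r ^ D) * ∫⁻ p, g p := by
  have hr' : r⁻¹ ≠ 0 := inv_ne_zero hr.ne'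
  have hemb : MeasurableEmbedding fun p : Config D => r⁻¹ • p :=
    (Homeomorph.smulOfNeZero r⁻¹ hr').measurableEmbedding
  rw [← hemb.lintegral_map, Measure.map_addHaar_smul _ hr', lintegral_smul_measure]
  simp [abs_of_pos hr]

open scoped FourierTransform in
/-- The phase-space isometry property of the wavepacket transform. -/
theorem exists_moyal (hε : 0 < ε) (hΓ : Γ.PosDef) : ∃ c : ℝ≥0∞, c ≠ 0 ∧ c ≠ ⊤ ∧
    ∀ ψ : Config D → ℂ, MemLp ψ 2 volume →
      ∫⁻ z, ‖bracket (gaussian ε Γ z) ψ‖ₑ ^ 2 = c * ∫⁻ x, ‖ψ x‖ₑ ^ 2 := by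
  have hr : 0 < 2 * Real.pi * ε := by positivity
  obtain ⟨C, hC, hbd⟩ := exists_envelope_le_const (D := D) hε hΓ
  -- Only finiteness and nonvanishing of the constant matter, so the `L²` norm of the window is not
  -- evaluated.
  refine ⟨ENNReal.ofReal ((2 * Real.pi * ε) ^ D) * ∫⁻ u : Config D, ‖envelope ε Γ u‖ₑ ^ 2,
    ?_, ?_, ?_⟩
  · refine mul_ne_zero (ENNReal.ofReal_pos.2 (pow_pos hr D)).ne' fun h => ?_
    rw [lintegral_eq_zero_iff (continuous_envelope.measurable.enorm.pow_const 2)] at h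
    obtain ⟨u, hu⟩ := h.exists
    have : envelope ε Γ u = 0 := by simpa using hu
    exact (envelope_pos hε hΓ u).ne' this
  · exact ENNReal.mul_ne_top ENNReal.ofReal_ne_top
      (memLp_envelope hε hΓ).lintegral_enorm_sq_lt_top.ne
  intro ψ hψ
  have hcont : ∀ q : Config D, Continuous fun x : Config D => (envelope ε Γ (x - q) : ℂ) :=
    fun q => Complex.continuous_ofReal.comp
      (continuous_envelope.comp (continuous_id.sub continuous_const))
  have hL2 : ∀ q : Config D, MemLp (fun x => (envelope ε Γ (x - q) : ℂ) * ψ x) 2 := fun q => by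
    refine hψ.of_le_mul (c := C) ((hcont q).aestronglyMeasurable.mul hψ.1) ?_
    filter_upwards with x
    rw [norm_mul, Complex.norm_real, Real.norm_of_nonneg (envelope_pos hε hΓ _).le]
    exact mul_le_mul_of_nonneg_right (hbd _) (norm_nonneg _)
  have hL1 : ∀ q : Config D, Integrable (fun x => (envelope ε Γ (x - q) : ℂ) * ψ x) := fun q => by
    have h := (memLp_envelope (D := D) hε hΓ).comp_measurePreserving (measurePreserving_sub_right volume q)
    exact MemLp.integrable_mul h.ofReal hψ
  have hmeas : Measurable fun z : Phase D => ‖bracket (gaussian ε Γ z) ψ‖ₑ ^ 2 :=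
    (stronglyMeasurable_bracket hψ.1).measurable.enorm.pow_const 2
  rw [Measure.volume_eq_prod, lintegral_prod _ hmeas.aemeasurable]
  -- Plancherel in `p` at fixed `q`. The remaining integral over `q` only sees the translated window
  -- and, after Tonelli, factors out.
  have h1 : ∀ q : Config D, ∫⁻ p, ‖bracket (gaussian ε Γ (q, p)) ψ‖ₑ ^ 2 =
      ENNReal.ofReal ((2 * Real.pi * ε) ^ D) *
        ∫⁻ x, ‖envelope ε Γ (x - q)‖ₑ ^ 2 * ‖ψ x‖ₑ ^ 2 := fun q => by
    have h2 : ∀ p, ‖bracket (gaussian ε Γ (q, p)) ψ‖ₑ =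
        ‖𝓕 (fun x => (envelope ε Γ (x - q) : ℂ) * ψ x) ((2 * Real.pi * ε)⁻¹ • p)‖ₑ := fun p => by
      rw [← ofReal_norm, ← ofReal_norm, norm_bracket_gaussian_eq_norm_fourier hε]
    simp only [h2]
    rw [lintegral_comp_inv_smul (fun p => ‖𝓕 (fun x => (envelope ε Γ (x - q) : ℂ) * ψ x) p‖ₑ ^ 2) hr,
      lintegral_enorm_sq_fourier (hL1 q) (hL2 q)]
    congr 1
    refine lintegral_congr fun x => ?_
    rw [enorm_mul, mul_pow]
    congr 2
    rw [← ofReal_norm, ← ofReal_norm, Complex.norm_real]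
  simp only [h1]
  have hm2 : AEMeasurable (fun p : Config D × Config D => ‖envelope ε Γ (p.2 - p.1)‖ₑ ^ 2 * ‖ψ p.2‖ₑ ^ 2)
      (volume.prod volume) := by
    refine AEMeasurable.fun_mul ?_ ?_
    · exact ((continuous_envelope.comp (continuous_snd.sub continuous_fst)).measurable.enorm.pow_const 2).aemeasurable
    · exact (hψ.1.comp_snd.enorm.pow_const 2)
  rw [lintegral_const_mul' _ _ ENNReal.ofReal_ne_top, lintegral_lintegral_swap hm2]
  have h3 : ∀ x : Config D, ∫⁻ q, ‖envelope ε Γ (x - q)‖ₑ ^ 2 * ‖ψ x‖ₑ ^ 2 =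
      (∫⁻ u : Config D, ‖envelope ε Γ u‖ₑ ^ 2) * ‖ψ x‖ₑ ^ 2 := fun x => by
    rw [lintegral_mul_const'' _ (by
      exact ((continuous_envelope.comp (continuous_const.sub continuous_id)).measurable.enorm.pow_const 2).aemeasurable),
      lintegral_sub_left_eq_self (fun u => ‖envelope ε Γ u‖ₑ ^ 2)]
  rw [lintegral_congr h3, lintegral_const_mul'' _ (hψ.1.enorm.pow_const 2),
    ← mul_assoc (ENNReal.ofReal _)]

end Gaussian

end HermanKluk

namespace HermanKluk

open Set
open scoped Topology InnerProductSpace Matrix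

variable {D : ℕ} {ε : ℝ} {Γ : Matrix (Fin D) (Fin D) ℝ}

/-! ### The zeros of the wavepacket transform form a null set -/

section ZeroSet

/-- Differentiation under the integral sign. Exponential moments of every order dominate the
derivative locally uniformly in `s`, so the Laplace-type integral is entire. -/
theorem differentiable_integral_cexp_mul {X : Type*} [MeasurableSpace X] {μ : Measure X}
    {h ℓ : X → ℂ} {r : X → ℝ} (hh : AEStronglyMeasurable h μ) (hℓ : AEStronglyMeasurable ℓ μ)
    (hr : ∀ x, ‖ℓ x‖ ≤ r x) (hint : ∀ a : ℝ, Integrable (fun x => Real.exp (a * r x) * ‖h x‖) μ) :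
    Differentiable ℂ fun s : ℂ => ∫ x, Complex.exp (s * ℓ x) * h x ∂μ := by
  intro s₀
  have hm : ∀ s : ℂ, AEStronglyMeasurable (fun x => Complex.exp (s * ℓ x) * h x) μ := fun s =>
    (Complex.continuous_exp.comp_aestronglyMeasurable (hℓ.const_mul s)).mul hh
  have hexp : ∀ s : ℂ, ∀ x, ‖Complex.exp (s * ℓ x)‖ ≤ Real.exp (‖s‖ * r x) := fun s x => by
    rw [Complex.norm_exp]
    refine Real.exp_le_exp.2 ((Complex.re_le_norm _).trans ?_)
    rw [norm_mul]
    exact mul_le_mul_of_nonneg_left (hr x) (norm_nonneg s)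
  refine (hasDerivAt_integral_of_dominated_loc_of_deriv_le (Metric.ball_mem_nhds s₀ one_pos)
    (F' := fun s x => ℓ x * Complex.exp (s * ℓ x) * h x)
    (bound := fun x => Real.exp ((‖s₀‖ + 2) * r x) * ‖h x‖)
    (Filter.Eventually.of_forall hm) ?_ ?_ ?_ (hint _) ?_).2.differentiableAt
  · refine (hint ‖s₀‖).mono' (hm s₀) (Filter.Eventually.of_forall fun x => ?_)
    rw [norm_mul]
    exact mul_le_mul_of_nonneg_right (hexp s₀ x) (norm_nonneg _)
  · exact (hℓ.mul (Complex.continuous_exp.comp_aestronglyMeasurable (hℓ.const_mul s₀))).mul hh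
  · refine Filter.Eventually.of_forall fun x s hs => ?_
    rw [norm_mul, norm_mul]
    refine mul_le_mul_of_nonneg_right ?_ (norm_nonneg _)
    have hr0 : 0 ≤ r x := (norm_nonneg _).trans (hr x)
    have hs' : ‖s‖ ≤ ‖s₀‖ + 1 := by
      have := norm_le_norm_add_norm_sub' s s₀
      rw [Metric.mem_ball, dist_eq_norm] at hs
      linarith
    -- The exponent `‖s₀‖ + 2` of the dominating function consists of `‖s₀‖ + 1`, bounding `‖s‖` on
    -- the unit ball around `s₀`, and 1 more to absorb `ℓ` through `r ≤ exp r`.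
    calc ‖ℓ x‖ * ‖Complex.exp (s * ℓ x)‖ ≤ Real.exp (r x) * Real.exp ((‖s₀‖ + 1) * r x) := by
          refine mul_le_mul ((hr x).trans ?_) ((hexp s x).trans (Real.exp_le_exp.2 ?_))
            (norm_nonneg _) (Real.exp_pos _).le
          · linarith [Real.add_one_le_exp (r x)]
          · exact mul_le_mul_of_nonneg_right hs' hr0
      _ = _ := by rw [← Real.exp_add]; congr 1; ring
  · refine Filter.Eventually.of_forall fun x s _ => ?_
    have := (((hasDerivAt_id s).mul_const (ℓ x)).cexp).mul_const (h x)
    refine this.congr_deriv ?_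
    simp only [id, one_mul]
    ring

/-- By the identity theorem the real zeros are discrete, hence null, unless the function vanishes on
the whole real line. -/
theorem ae_ne_zero_of_differentiable {M : ℂ → ℂ} (hM : Differentiable ℂ M) (h0 : M 0 ≠ 0) :
    ∀ᵐ s : ℝ, M s ≠ 0 := by
  have han : AnalyticOnNhd ℝ (fun s : ℝ => M s) univ := fun s _ =>
    ((hM.analyticAt (s : ℂ)).restrictScalars (𝕜 := ℝ)).fun_comp (Complex.ofRealCLM.analyticAt s)
  have h := han.eqOn_zero_or_eventually_ne_zero_of_preconnected isPreconnected_univ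
  rcases h with h | h
  · exact absurd (by simpa using h (mem_univ 0)) h0
  · have : ∀ᵐ s : ℝ ∂volume.restrict univ, M s ≠ 0 :=
      ae_restrict_le_codiscreteWithin MeasurableSet.univ h
    rwa [Measure.restrict_univ] at this

/-- The symmetric bilinear form `uᵀ Γ a`. -/
noncomputable def bil (Γ : Matrix (Fin D) (Fin D) ℝ) (u a : Config D) : ℝ :=
  u.ofLp ⬝ᵥ Γ.mulVec a.ofLp

theorem quad_sub_smul (hΓ : Γ.PosDef) (u a : Config D) (s : ℝ) :
    quad Γ (u - s • a) = quad Γ u - 2 * s * bil Γ u a + s ^ 2 * quad Γ a := by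
  have hT : Γᵀ = Γ := hΓ.1
  have h : a.ofLp ⬝ᵥ Γ.mulVec u.ofLp = u.ofLp ⬝ᵥ Γ.mulVec a.ofLp := by
    rw [Matrix.dotProduct_mulVec, dotProduct_comm, ← Matrix.mulVec_transpose, hT]
  simp only [quad, bil, WithLp.ofLp_sub, WithLp.ofLp_smul, Matrix.mulVec_sub, Matrix.mulVec_smul,
    sub_dotProduct, dotProduct_sub, smul_dotProduct, dotProduct_smul, smul_eq_mul, h]
  ring

theorem continuous_bil (a : Config D) : Continuous fun u => bil Γ u a := by
  unfold bil
  simp only [dotProduct]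
  fun_prop

theorem abs_bil_le (a : Config D) : ∃ K, 0 ≤ K ∧ ∀ u, |bil Γ u a| ≤ K * ‖u‖ := by
  let w : Config D := WithLp.toLp 2 (Γ.mulVec a.ofLp)
  have e : ∀ u, bil Γ u a = ⟪w, u⟫_ℝ := fun u => by
    simp [bil, w, PiLp.inner_apply, dotProduct]
  exact ⟨‖w‖, norm_nonneg _, fun u => by rw [e]; exact abs_real_inner_le_norm w u⟩

/-- The exponent is quadratic in `s`, but the coefficient of `s²` is free of `x`. The `s²` part thus
leaves the integral as a nonzero factor, and the rest is an integral of `exp (s ℓ(x))`, which is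
entire in `s`. -/
theorem conj_gaussian_line (hε : 0 < ε) (hΓ : Γ.PosDef) (z v : Phase D) (s : ℝ) (x : Config D) :
    (starRingEnd ℂ) (gaussian ε Γ (z + s • v) x) =
      Complex.exp (s * (((⟪z.2, v.1⟫_ℝ / ε : ℝ) : ℂ) * Complex.I)
        + s ^ 2 * ((-(quad Γ v.1 / (2 * ε)) : ℝ) + ((⟪v.2, v.1⟫_ℝ / ε : ℝ) : ℂ) * Complex.I)) *
      (Complex.exp (s * ((bil Γ (x - z.1) v.1 / ε : ℝ)
        - ((⟪v.2, x - z.1⟫_ℝ / ε : ℝ) : ℂ) * Complex.I)) *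
      (starRingEnd ℂ) (gaussian ε Γ z x)) := by
  have e : x - (z + s • v).1 = (x - z.1) - s • v.1 := by
    simp only [Prod.fst_add, Prod.smul_fst]; abel
  set c : ℂ := (((Γ.det / (Real.pi ^ D * ε ^ D)) ^ (1 / 4 : ℝ) : ℝ) : ℂ)
  have hconj : ∀ (y : Phase D), (starRingEnd ℂ) (gaussian ε Γ y x) =
      c * Complex.exp (((-(1 / (2 * ε)) * quad Γ (x - y.1) : ℝ) : ℂ)
        - ((⟪y.2, x - y.1⟫_ℝ / ε : ℝ) : ℂ) * Complex.I) := fun y => by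
    rw [gaussian_eq, envelope, map_mul, Complex.conj_ofReal, ← Complex.exp_conj, map_mul,
      Complex.conj_ofReal, Complex.conj_I, Complex.ofReal_mul, Complex.ofReal_exp, mul_assoc,
      ← Complex.exp_add, mul_neg, ← sub_eq_add_neg]
  rw [hconj, hconj, e, quad_sub_smul hΓ, mul_left_comm _ c, mul_left_comm _ c, ← Complex.exp_add,
    ← Complex.exp_add]
  congr 2
  simp only [Prod.snd_add, Prod.smul_snd, inner_add_left, inner_sub_right, real_inner_smul_left,
    real_inner_smul_right]
  have hε' : (ε : ℂ) ≠ 0 := Complex.ofReal_ne_zero.2 hε.ne'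
  push_cast
  field_simp
  ring

/-- The logarithmic slope of the wavepackets along a line in phase space. -/
noncomputable def lineSlope (ε : ℝ) (Γ : Matrix (Fin D) (Fin D) ℝ) (z v : Phase D) (x : Config D) :
    ℂ :=
  (bil Γ (x - z.1) v.1 / ε : ℝ) - ((⟪v.2, x - z.1⟫_ℝ / ε : ℝ) : ℂ) * Complex.I

theorem continuous_lineSlope (z v : Phase D) : Continuous (lineSlope ε Γ z v) := by
  have h1 : Continuous fun x => bil Γ (x - z.1) v.1 :=
    (continuous_bil v.1).comp (continuous_id.sub continuous_const)
  have h2 : Continuous fun x => ⟪v.2, x - z.1⟫_ℝ :=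
    continuous_const.inner (continuous_id.sub continuous_const)
  exact (Complex.continuous_ofReal.comp (h1.div_const ε)).sub
    ((Complex.continuous_ofReal.comp (h2.div_const ε)).mul continuous_const)

theorem exists_norm_lineSlope_le (hε : 0 < ε) (z v : Phase D) :
    ∃ K, ∀ x, ‖lineSlope ε Γ z v x‖ ≤ K * ‖x - z.1‖ := by
  obtain ⟨K, hK, hbil⟩ := abs_bil_le (Γ := Γ) v.1
  refine ⟨K / ε + ‖v.2‖ / ε, fun x => ?_⟩
  refine (norm_sub_le _ _).trans ?_
  rw [norm_mul, Complex.norm_I, mul_one, Complex.norm_real, Complex.norm_real, Real.norm_eq_abs,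
    Real.norm_eq_abs, abs_div, abs_div, abs_of_pos hε, add_mul]
  refine add_le_add ?_ ?_
  · rw [div_mul_eq_mul_div]
    exact div_le_div_of_nonneg_right (hbil _) hε.le
  · rw [div_mul_eq_mul_div]
    exact div_le_div_of_nonneg_right (abs_real_inner_le_norm _ _) hε.le

theorem exists_bracket_gaussian_line_eq (hε : 0 < ε) (hΓ : Γ.PosDef) (ψ : Config D → ℂ)
    (z v : Phase D) (s : ℝ) : ∃ c : ℂ, c ≠ 0 ∧ bracket (gaussian ε Γ (z + s • v)) ψ =
      c * ∫ x, Complex.exp (s * lineSlope ε Γ z v x)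
        * ((starRingEnd ℂ) (gaussian ε Γ z x) * ψ x) := by
  refine ⟨_, Complex.exp_ne_zero (s * (((⟪z.2, v.1⟫_ℝ / ε : ℝ) : ℂ) * Complex.I)
        + s ^ 2 * ((-(quad Γ v.1 / (2 * ε)) : ℝ) + ((⟪v.2, v.1⟫_ℝ / ε : ℝ) : ℂ) * Complex.I)), ?_⟩
  rw [bracket, ← integral_const_mul]
  refine integral_congr_ae (Filter.Eventually.of_forall fun x => ?_)
  simp only [conj_gaussian_line hε hΓ, lineSlope, mul_assoc]

theorem continuous_gaussian_right (z : Phase D) : Continuous (gaussian ε Γ z) := by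
  have h : Continuous (Function.uncurry (gaussian (D := D) ε Γ)) := continuous_gaussian
  exact h.uncurry_left z

theorem ae_bracket_gaussian_line_ne_zero (hε : 0 < ε) (hΓ : Γ.PosDef) {ψ : Config D → ℂ}
    (hψ : MemLp ψ 2 volume) {z : Phase D} (hz : bracket (gaussian ε Γ z) ψ ≠ 0) (v : Phase D) :
    ∀ᵐ s : ℝ, bracket (gaussian ε Γ (z + s • v)) ψ ≠ 0 := by
  have hh : AEStronglyMeasurable (fun x => (starRingEnd ℂ) (gaussian ε Γ z x) * ψ x) volume :=
    (Complex.continuous_conj.comp (continuous_gaussian_right z)).aestronglyMeasurable.mul hψ.1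
  obtain ⟨K, hK⟩ := exists_norm_lineSlope_le (Γ := Γ) hε z v
  have hint : ∀ a : ℝ, Integrable fun x =>
      Real.exp (a * (K * ‖x - z.1‖)) * ‖(starRingEnd ℂ) (gaussian ε Γ z x) * ψ x‖ := fun a => by
    have h1 := (memLp_exp_mul_norm_mul_envelope (D := D) hε hΓ
      (a * K)).comp_measurePreserving (measurePreserving_sub_right volume z.1)
    refine (MemLp.integrable_mul h1 hψ.norm).congr (Filter.Eventually.of_forall fun x => ?_)
    simp only [Pi.mul_apply, Function.comp_apply, norm_mul, RCLike.norm_conj,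
      norm_gaussian hε hΓ, mul_assoc]
  have hM := differentiable_integral_cexp_mul hh
    (continuous_lineSlope (ε := ε) (Γ := Γ) z v).aestronglyMeasurable hK hint
  have hM0 : (∫ x, Complex.exp (0 * lineSlope ε Γ z v x)
      * ((starRingEnd ℂ) (gaussian ε Γ z x) * ψ x)) ≠ 0 := by
    simpa [bracket] using hz
  filter_upwards [ae_ne_zero_of_differentiable hM hM0] with s hs
  obtain ⟨c, hc, e⟩ := exists_bracket_gaussian_line_eq hε hΓ ψ z v s
  rw [e]
  exact mul_ne_zero hc hs

/-- A measurable set that is null along almost all points of every line through `z₀` is null. -/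
theorem measure_eq_zero_of_lines {E : Type*} [NormedAddCommGroup E] [NormedSpace ℝ E]
    [FiniteDimensional ℝ E] [MeasurableSpace E] [BorelSpace E] {μ : Measure E}
    [μ.IsAddHaarMeasure] {S : Set E} (hS : MeasurableSet S) (z₀ : E)
    (h : ∀ v : E, ∀ᵐ s : ℝ, z₀ + s • v ∉ S) : μ S = 0 := by
  let A : Set (E × ℝ) := (fun p => z₀ + p.2 • p.1) ⁻¹' S
  have hc : Continuous fun p : E × ℝ => z₀ + p.2 • p.1 :=
    continuous_const.add (continuous_snd.smul continuous_fst)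
  have hA : MeasurableSet A := hc.measurable hS
  -- The slices of `A` at fixed `v` are null by hypothesis, so `A` is null. Slicing it at fixed `s`
  -- instead produces some `s ≠ 0` with a null slice, and that slice is a translated and rescaled
  -- copy of `S`.
  have hA0 : ((volume : Measure ℝ).prod μ) (Prod.swap ⁻¹' A) = 0 := by
    rw [Measure.measurePreserving_swap.measure_preimage hA.nullMeasurableSet,
      Measure.measure_prod_null hA]
    refine Filter.Eventually.of_forall fun v => ?_
    have := h v
    rw [ae_iff] at this
    simpa [A, preimage] using this
  have h1 := Measure.measure_ae_null_of_prod_null hA0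
  have h2 : ∀ᵐ s : ℝ, s ≠ 0 := by
    rw [ae_iff]; simp
  obtain ⟨s, hs, hs0⟩ := (h1.and h2).exists
  have h3 : μ ((fun v : E => s • v) ⁻¹' ((fun y => z₀ + y) ⁻¹' S)) = 0 := hs
  rw [Measure.addHaar_preimage_smul _ hs0, measure_preimage_add, mul_eq_zero] at h3
  rcases h3 with h3 | h3
  · exact absurd h3 (by simp [hs0])
  · exact h3

/-- The isometry property excludes an identically vanishing transform; from one point where it is
nonzero, almost every point on every line inherits this. -/
theorem ae_bracket_gaussian_ne_zero (hε : 0 < ε) (hΓ : Γ.PosDef) {ψ : Config D → ℂ}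
    (hψ : MemLp ψ 2 volume) (hne : ∫⁻ x, ‖ψ x‖ₑ ^ 2 ≠ 0) :
    ∀ᵐ z, bracket (gaussian ε Γ z) ψ ≠ 0 := by
  obtain ⟨z₀, hz₀⟩ : ∃ z₀, bracket (gaussian ε Γ z₀) ψ ≠ 0 := by
    by_contra! h
    obtain ⟨c, hc0, -, hc⟩ := exists_moyal (D := D) hε hΓ
    have := hc ψ hψ
    simp only [h, enorm_zero, ne_eq, OfNat.ofNat_ne_zero, not_false_eq_true, zero_pow,
      lintegral_zero] at this
    exact mul_ne_zero hc0 hne this.symm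
  have hS : MeasurableSet {z | bracket (gaussian ε Γ z) ψ = 0} :=
    (stronglyMeasurable_bracket hψ.1).measurable (measurableSet_singleton 0)
  have : (volume : Measure (Phase D)).IsAddHaarMeasure := Measure.prod.instIsAddHaarMeasure _ _
  have := measure_eq_zero_of_lines (μ := volume) hS z₀
    fun v => ae_bracket_gaussian_line_ne_zero hε hΓ hψ hz₀ v
  rw [ae_iff]
  simpa using this

end ZeroSet

end HermanKluk

namespace HermanKluk

open Set
open scoped Topology InnerProductSpace Matrix

variable {D : ℕ} {ε : ℝ} {Γ : Matrix (Fin D) (Fin D) ℝ}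

/-! ### Observables act on wavepackets as multiplication by a symbol -/

section Symbols

open Polynomial

theorem contDiff_gaussian (z : Phase D) : ContDiff ℝ ∞ (gaussian ε Γ z) := by
  have e : gaussian ε Γ z = fun x => (envelope ε Γ (x - z.1) : ℂ)
      * Complex.exp (((⟪z.2, x - z.1⟫_ℝ / ε : ℝ) : ℂ) * Complex.I) := funext (gaussian_eq z)
  rw [e]
  have h1 : ContDiff ℝ ∞ fun x : Config D => (envelope ε Γ (x - z.1) : ℂ) :=
    Complex.ofRealCLM.contDiff.comp (contDiff_envelope.comp (contDiff_id.sub contDiff_const))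
  have h2 : ContDiff ℝ ∞ fun x : Config D => ((⟪z.2, x - z.1⟫_ℝ / ε : ℝ) : ℂ) :=
    Complex.ofRealCLM.contDiff.comp
      ((contDiff_const.inner ℝ (contDiff_id.sub contDiff_const)).div_const ε)
  exact h1.mul (h2.mul contDiff_const).cexp

/-- The local (complex) momentum of a wavepacket in direction `e`. -/
noncomputable def wavenumber (Γ : Matrix (Fin D) (Fin D) ℝ) (e : Config D) (z : Phase D)
    (x : Config D) : ℂ :=
  (⟪z.2, e⟫_ℝ : ℂ) + Complex.I * (bil Γ (x - z.1) e : ℂ)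

theorem bil_add_smul (u a e : Config D) (s : ℝ) :
    bil Γ (u + s • a) e = bil Γ u e + s * bil Γ a e := by
  simp [bil, add_dotProduct, smul_dotProduct]

theorem wavenumber_add_smul (z : Phase D) (x e : Config D) (s : ℝ) :
    wavenumber Γ e z (x + s • e) = wavenumber Γ e z x + s * (Complex.I * (quad Γ e : ℂ)) := by
  have h : x + s • e - z.1 = (x - z.1) + s • e := by abel
  have h' : bil Γ e e = quad Γ e := rfl
  rw [wavenumber, wavenumber, h, bil_add_smul, h']
  push_cast
  ring

/-- Along a line the wavepacket is the exponential of a quadratic in `s`, with linear coefficient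
`i/ε` times the wavenumber. Directional derivatives can be read off at `s = 0`. -/
theorem gaussian_add_smul (hε : 0 < ε) (hΓ : Γ.PosDef) (z : Phase D) (x e : Config D) (s : ℝ) :
    gaussian ε Γ z (x + s • e) = gaussian ε Γ z x *
      Complex.exp (s * (Complex.I / ε * wavenumber Γ e z x) - s ^ 2 * (quad Γ e / (2 * ε))) := by
  have h : x + s • e - z.1 = (x - z.1) - (-s) • e := by
    rw [neg_smul]; abel
  rw [gaussian_eq, gaussian_eq, h, envelope, envelope, quad_sub_smul hΓ, wavenumber,
    inner_sub_right, real_inner_smul_right]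
  push_cast
  simp only [mul_assoc, ← Complex.exp_add]
  congr 2
  have hε' : (ε : ℂ) ≠ 0 := Complex.ofReal_ne_zero.2 hε.ne'
  field_simp
  linear_combination (-2 * s * bil Γ (x - z.1) e : ℂ) * Complex.I_sq

theorem contDiff_wavenumber (e : Config D) (z : Phase D) : ContDiff ℝ ∞ (wavenumber Γ e z) := by
  have h : ContDiff ℝ ∞ fun x => bil Γ (x - z.1) e := by
    unfold bil
    simp only [dotProduct]
    refine ContDiff.sum fun i _ => ContDiff.mul ?_ contDiff_const
    exact (EuclideanSpace.proj (𝕜 := ℝ) i).contDiff.comp (contDiff_id.sub contDiff_const)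
  exact contDiff_const.add (contDiff_const.mul (Complex.ofRealCLM.contDiff.comp h))

theorem contDiff_eval_wavenumber_mul_gaussian (Q : ℂ[X]) (e : Config D) (z : Phase D) :
    ContDiff ℝ ∞ fun x => Q.eval (wavenumber Γ e z x) * gaussian ε Γ z x :=
  ContDiff.mul ((Q.contDiff_aeval ∞).restrict_scalars ℝ |>.comp (contDiff_wavenumber e z))
    (contDiff_gaussian z)

theorem fderiv_eval_wavenumber_mul_gaussian (hε : 0 < ε) (hΓ : Γ.PosDef) (Q : ℂ[X])
    (e : Config D) (z : Phase D) (x : Config D) :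
    fderiv ℝ (fun x => Q.eval (wavenumber Γ e z x) * gaussian ε Γ z x) x e =
      (Complex.I * quad Γ e * (derivative Q).eval (wavenumber Γ e z x) +
        Complex.I / ε * wavenumber Γ e z x * Q.eval (wavenumber Γ e z x)) *
        gaussian ε Γ z x := by
  have hd := ((contDiff_eval_wavenumber_mul_gaussian (ε := ε) (Γ := Γ) Q e z).differentiable
    (by simp) x).hasFDerivAt.hasLineDerivAt e
  refine HasDerivAt.unique hd ?_
  simp only [gaussian_add_smul hε hΓ, wavenumber_add_smul]
  set k := wavenumber Γ e z x
  have h1 : HasDerivAt (fun s : ℝ => k + s * (Complex.I * (quad Γ e : ℂ)))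
      (Complex.I * (quad Γ e : ℂ)) 0 := by
    simpa using (((hasDerivAt_id (0 : ℂ)).comp_ofReal).mul_const
      (Complex.I * (quad Γ e : ℂ))).const_add k
  have h2 : HasDerivAt (fun s : ℝ => Complex.exp (s * (Complex.I / ε * k)
      - s ^ 2 * (quad Γ e / (2 * ε)))) (Complex.I / ε * k) 0 := by
    have a := ((hasDerivAt_id (0 : ℂ)).mul_const (Complex.I / ε * k)).sub
      (((hasDerivAt_id (0 : ℂ)).pow 2).mul_const ((quad Γ e : ℂ) / (2 * ε)))
    simpa using a.cexp.comp_ofReal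
  have h3 := (Q.hasDerivAt (k + ((0 : ℝ) : ℂ) * (Complex.I * (quad Γ e : ℂ)))).comp (0 : ℝ) h1
  refine (h3.fun_mul (h2.const_mul (gaussian ε Γ z x))).congr_deriv ?_
  simp
  ring

/-- The polynomials (of Hermite type) with which iterated momentum operators multiply a
wavepacket. -/
noncomputable def momentumPoly (a : ℂ) : ℕ → ℂ[X]
  | 0 => 1
  | n + 1 => X * momentumPoly a n + C a * derivative (momentumPoly a n)

theorem momentumOp_eval_wavenumber (hε : 0 < ε) (hΓ : Γ.PosDef) (Q : ℂ[X]) (j : Fin D)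
    (z : Phase D) :
    momentumOp ε j
        (fun x => Q.eval (wavenumber Γ (EuclideanSpace.single j 1) z x) * gaussian ε Γ z x) =
      fun x => (X * Q + C ((ε * quad Γ (EuclideanSpace.single j 1) : ℝ) : ℂ) * derivative Q).eval
        (wavenumber Γ (EuclideanSpace.single j 1) z x) * gaussian ε Γ z x := by
  funext x
  rw [momentumOp, fderiv_eval_wavenumber_mul_gaussian hε hΓ]
  have hε' : (ε : ℂ) ≠ 0 := Complex.ofReal_ne_zero.2 hε.ne'
  simp only [eval_add, eval_mul, eval_X, eval_C]
  push_cast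
  field_simp
  linear_combination (-(ε * quad Γ (EuclideanSpace.single j 1) *
    (derivative Q).eval (wavenumber Γ (EuclideanSpace.single j 1) z x)
    + wavenumber Γ (EuclideanSpace.single j 1) z x *
    Q.eval (wavenumber Γ (EuclideanSpace.single j 1) z x)) * gaussian ε Γ z x : ℂ) * Complex.I_sq

theorem iterate_momentumOp_gaussian (hε : 0 < ε) (hΓ : Γ.PosDef) (j : Fin D) (z : Phase D)
    (n : ℕ) :
    (momentumOp ε j)^[n] (gaussian ε Γ z) = fun x =>
      (momentumPoly ((ε * quad Γ (EuclideanSpace.single j 1) : ℝ) : ℂ) n).eval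
        (wavenumber Γ (EuclideanSpace.single j 1) z x) * gaussian ε Γ z x := by
  induction n with
  | zero => simp [momentumPoly]
  | succ n ih =>
    rw [Function.iterate_succ_apply', ih, momentumOp_eval_wavenumber hε hΓ]
    rfl

/-- The derivative term has strictly lower degree and cannot cancel the leading term. Being monic is
what keeps the symbol of a momentum power away from zero at large wavenumber. -/
theorem monic_momentumPoly (a : ℂ) (n : ℕ) :
    (momentumPoly a n).Monic ∧ (momentumPoly a n).natDegree = n := by
  induction n with
  | zero => simp [momentumPoly]
  | succ n ih =>
    obtain ⟨h1, h2⟩ := ih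
    have hX : (X * momentumPoly a n).Monic := monic_X.mul h1
    have hXd : (X * momentumPoly a n).natDegree = n + 1 := by
      rw [natDegree_X_mul h1.ne_zero, h2]
    have hlt : (C a * derivative (momentumPoly a n)).degree < (X * momentumPoly a n).degree := by
      rw [← smul_eq_C_mul, degree_eq_natDegree hX.ne_zero, hXd]
      refine lt_of_le_of_lt ((degree_smul_le a _).trans
        (degree_derivative_le.trans degree_le_natDegree)) ?_
      rw [h2]
      exact_mod_cast n.lt_succ_self
    exact ⟨hX.add_of_left hlt, (natDegree_add_eq_left_of_degree_lt hlt).trans hXd⟩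

theorem kineticOp_eq {f : Config D → ℂ} (hf : ContDiff ℝ ∞ f) (x : Config D) :
    kineticOp ε f x = ∑ j, (momentumOp ε j)^[2] f x / 2 := by
  rw [kineticOp, InnerProductSpace.laplacian_eq_iteratedFDeriv_orthonormalBasis f
    (EuclideanSpace.basisFun (Fin D) ℝ)]
  simp only [EuclideanSpace.basisFun_apply, iteratedFDeriv_two_apply, Matrix.cons_val_zero,
    Matrix.cons_val_one, Finset.mul_sum]
  refine Finset.sum_congr rfl fun j _ => ?_
  have hd : DifferentiableAt ℝ (fderiv ℝ f) x :=
    ((hf.fderiv_right (m := 1) (by exact two_le_infty)).differentiable one_ne_zero) x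
  have e : fderiv ℝ (fun y => fderiv ℝ f y (EuclideanSpace.single j 1)) x
      (EuclideanSpace.single j 1) =
      fderiv ℝ (fderiv ℝ f) x (EuclideanSpace.single j 1) (EuclideanSpace.single j 1) := by
    rw [fderiv_clm_apply hd (differentiableAt_const _)]
    simp
  simp only [Function.iterate_succ, Function.iterate_zero, Function.comp_apply, id]
  unfold momentumOp
  rw [fderiv_const_mul (hd.clm_apply (differentiableAt_const _)), smul_apply, e, smul_eq_mul]
  linear_combination ((ε : ℂ) ^ 2 / 2 * fderiv ℝ (fderiv ℝ f) x (EuclideanSpace.single j 1)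
    (EuclideanSpace.single j 1)) * -Complex.I_sq

/-- The amplitude by which an observable multiplies a wavepacket. -/
noncomputable def Observable.symbol (ε : ℝ) (Γ : Matrix (Fin D) (Fin D) ℝ) (V : Config D → ℝ)
    (A : Observable D) (z : Phase D) (x : Config D) : ℂ :=
  let P (j : Fin D) (n : ℕ) : ℂ :=
    (momentumPoly ((ε * quad Γ (EuclideanSpace.single j 1) : ℝ) : ℂ) n).eval
        (wavenumber Γ (EuclideanSpace.single j 1) z x)
  match A with
  | .identity => 1
  | .position j n => ((x j : ℝ) : ℂ) ^ n
  | .momentum j n => P j n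
  | .kinetic => ∑ j, P j 2 / 2
  | .potential => (V x : ℂ)
  | .hamiltonian => ∑ j, P j 2 / 2 + (V x : ℂ)

/-- The kinetic energy is half the sum of the squared momenta, so differential operators reduce to
the Hermite-type polynomials. From here on upper and lower bounds concern only the symbol. -/
theorem Observable.apply_gaussian (hε : 0 < ε) (hΓ : Γ.PosDef) (V : Config D → ℝ)
    (A : Observable D) (z : Phase D) :
    A.apply ε V (gaussian ε Γ z) = fun x => A.symbol ε Γ V z x * gaussian ε Γ z x := by
  have hkin : ∀ x, kineticOp ε (gaussian ε Γ z) x =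
      (∑ j, (momentumPoly ((ε * quad Γ (EuclideanSpace.single j 1) : ℝ) : ℂ) 2).eval
        (wavenumber Γ (EuclideanSpace.single j 1) z x) / 2) * gaussian ε Γ z x := fun x => by
    rw [kineticOp_eq (contDiff_gaussian z), Finset.sum_mul]
    refine Finset.sum_congr rfl fun j _ => ?_
    rw [iterate_momentumOp_gaussian hε hΓ]
    ring
  cases A with
  | identity => simp [Observable.apply, Observable.symbol]
  | position j n => rfl
  | momentum j n => exact iterate_momentumOp_gaussian hε hΓ j z n
  | kinetic => exact funext hkin
  | potential => rfl
  | hamiltonian =>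
    funext x
    simp only [Observable.apply, Observable.symbol, hkin, add_mul]

theorem continuous_wavenumber (e : Config D) :
    Continuous fun p : Phase D × Config D => wavenumber Γ e p.1 p.2 := by
  have h1 : Continuous fun p : Phase D × Config D => bil Γ (p.2 - p.1.1) e :=
    (continuous_bil e).comp (continuous_snd.sub (continuous_fst.comp continuous_fst))
  have h2 : Continuous fun p : Phase D × Config D => ⟪p.1.2, e⟫_ℝ :=
    (continuous_snd.comp continuous_fst).inner continuous_const
  exact (Complex.continuous_ofReal.comp h2).add
    (continuous_const.mul (Complex.continuous_ofReal.comp h1))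

theorem continuous_eval_wavenumber (Q : ℂ[X]) (e : Config D) :
    Continuous fun p : Phase D × Config D => Q.eval (wavenumber Γ e p.1 p.2) :=
  Q.continuous.comp (continuous_wavenumber e)

theorem Observable.continuous_symbol {V : Config D → ℝ} (hV : IsSubquadratic V)
    (A : Observable D) :
    Continuous fun p : Phase D × Config D => A.symbol ε Γ V p.1 p.2 := by
  have hkin : Continuous fun p : Phase D × Config D =>
      ∑ j, (momentumPoly ((ε * quad Γ (EuclideanSpace.single j 1) : ℝ) : ℂ) 2).eval
        (wavenumber Γ (EuclideanSpace.single j 1) p.1 p.2) / 2 :=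
    continuous_finsetSum _ fun j _ => (continuous_eval_wavenumber _ _).div_const 2
  have hpot : Continuous fun p : Phase D × Config D => (V p.2 : ℂ) :=
    Complex.continuous_ofReal.comp (hV.1.continuous.comp continuous_snd)
  cases A with
  | identity => exact continuous_const
  | position j n =>
    have h : Continuous fun p : Phase D × Config D => (p.2 j : ℝ) :=
      (EuclideanSpace.proj (𝕜 := ℝ) j).continuous.comp continuous_snd
    exact (Complex.continuous_ofReal.comp h).pow n
  | momentum j n => exact continuous_eval_wavenumber _ _
  | kinetic => exact hkin
  | potential => exact hpot
  | hamiltonian => exact hkin.add hpot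

end Symbols

end HermanKluk

namespace HermanKluk

open Set
open scoped Topology InnerProductSpace Matrix

variable {D : ℕ} {ε : ℝ} {Γ : Matrix (Fin D) (Fin D) ℝ} {V : Config D → ℝ}

/-! ### Polynomial growth of the symbols -/

section Growth

open Polynomial

/-- Amplitudes of polynomial growth in the phase-space centre and in the distance to it. -/
def HasPolyGrowth (F : Phase D → Config D → ℂ) : Prop :=
  ∃ (C : ℝ) (m : ℕ), 0 ≤ C ∧ ∀ z x, ‖F z x‖ ≤ C * ((1 + ‖z‖) * (1 + ‖x - z.1‖)) ^ m

theorem one_le_weight (z : Phase D) (x : Config D) : 1 ≤ (1 + ‖z‖) * (1 + ‖x - z.1‖) :=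
  one_le_mul_of_one_le_of_one_le (by linarith [norm_nonneg z]) (by linarith [norm_nonneg (x - z.1)])

theorem norm_le_weight (z : Phase D) (x : Config D) :
    1 + ‖x‖ ≤ (1 + ‖z‖) * (1 + ‖x - z.1‖) := by
  have h1 : ‖z.1‖ ≤ ‖z‖ := norm_fst_le z
  have h2 : ‖x‖ ≤ ‖x - z.1‖ + ‖z.1‖ := by simpa using norm_add_le (x - z.1) z.1
  nlinarith [norm_nonneg z, norm_nonneg (x - z.1), mul_nonneg (norm_nonneg z) (norm_nonneg (x - z.1))]

theorem HasPolyGrowth.const (c : ℂ) : HasPolyGrowth (D := D) fun _ _ => c :=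
  ⟨‖c‖, 0, norm_nonneg c, fun z x => by simp⟩

theorem HasPolyGrowth.mul {F G : Phase D → Config D → ℂ} (hF : HasPolyGrowth F)
    (hG : HasPolyGrowth G) : HasPolyGrowth fun z x => F z x * G z x := by
  obtain ⟨C, m, hC, h⟩ := hF
  obtain ⟨C', m', hC', h'⟩ := hG
  refine ⟨C * C', m + m', by positivity, fun z x => ?_⟩
  rw [norm_mul, pow_add, mul_mul_mul_comm]
  have := one_le_weight z x
  exact mul_le_mul (h z x) (h' z x) (norm_nonneg _) (by positivity)

theorem HasPolyGrowth.add {F G : Phase D → Config D → ℂ} (hF : HasPolyGrowth F)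
    (hG : HasPolyGrowth G) : HasPolyGrowth fun z x => F z x + G z x := by
  obtain ⟨C, m, hC, h⟩ := hF
  obtain ⟨C', m', hC', h'⟩ := hG
  refine ⟨C + C', m + m', by positivity, fun z x => ?_⟩
  have hw := one_le_weight z x
  rw [add_mul]
  refine (norm_add_le _ _).trans (add_le_add ((h z x).trans ?_) ((h' z x).trans ?_))
  · exact mul_le_mul_of_nonneg_left (pow_le_pow_right₀ hw (by omega)) hC
  · exact mul_le_mul_of_nonneg_left (pow_le_pow_right₀ hw (by omega)) hC'

theorem HasPolyGrowth.pow {F : Phase D → Config D → ℂ} (hF : HasPolyGrowth F) (n : ℕ) :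
    HasPolyGrowth fun z x => F z x ^ n := by
  induction n with
  | zero => simpa using HasPolyGrowth.const 1
  | succ n ih => simpa only [pow_succ] using ih.mul hF

theorem HasPolyGrowth.sum {ι : Type*} (s : Finset ι) {F : ι → Phase D → Config D → ℂ}
    (hF : ∀ i, HasPolyGrowth (F i)) : HasPolyGrowth fun z x => ∑ i ∈ s, F i z x := by
  classical
  induction s using Finset.induction_on with
  | empty => simpa using HasPolyGrowth.const 0
  | insert i s hi ih => simpa only [Finset.sum_insert hi] using (hF i).add ih

theorem HasPolyGrowth.eval {F : Phase D → Config D → ℂ} (hF : HasPolyGrowth F) (Q : ℂ[X]) :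
    HasPolyGrowth fun z x => Q.eval (F z x) := by
  simp only [eval_eq_sum_range]
  exact HasPolyGrowth.sum _ fun i => (HasPolyGrowth.const _).mul (hF.pow i)

theorem hasPolyGrowth_of_norm_le {F : Phase D → Config D → ℂ} {C : ℝ} (m : ℕ) (hC : 0 ≤ C)
    (h : ∀ z x, ‖F z x‖ ≤ C * (1 + ‖x‖) ^ m) : HasPolyGrowth F :=
  ⟨C, m, hC, fun z x => (h z x).trans (mul_le_mul_of_nonneg_left
    (pow_le_pow_left₀ (by positivity) (norm_le_weight z x) m) hC)⟩

theorem hasPolyGrowth_wavenumber (e : Config D) : HasPolyGrowth (wavenumber Γ e) := by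
  obtain ⟨K, hK, h⟩ := abs_bil_le (Γ := Γ) e
  refine ⟨‖e‖ + K, 1, by positivity, fun z x => ?_⟩
  have h1 : |⟪z.2, e⟫_ℝ| ≤ ‖z‖ * ‖e‖ :=
    (abs_real_inner_le_norm _ _).trans (mul_le_mul_of_nonneg_right (norm_snd_le z) (norm_nonneg e))
  have h2 := h (x - z.1)
  have h3 : ‖wavenumber Γ e z x‖ ≤ ‖z‖ * ‖e‖ + K * ‖x - z.1‖ := by
    refine (norm_add_le _ _).trans (add_le_add ?_ ?_)
    · rw [Complex.norm_real]; exact h1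
    · rw [norm_mul, Complex.norm_I, one_mul, Complex.norm_real]; exact h2
  refine h3.trans ?_
  rw [pow_one, add_mul, mul_comm ‖z‖]
  have hz := norm_nonneg z
  have hx := norm_nonneg (x - z.1)
  refine add_le_add (mul_le_mul_of_nonneg_left ?_ (norm_nonneg e))
    (mul_le_mul_of_nonneg_left ?_ hK) <;> nlinarith [mul_nonneg hz hx]

/-- A bounded second derivative gives a gradient of linear growth, and the mean value inequality on
the ball of radius `‖x‖` then a potential of quadratic growth. -/
theorem IsSubquadratic.exists_abs_le (hV : IsSubquadratic V) :
    ∃ C, 0 ≤ C ∧ ∀ x, |V x| ≤ C * (1 + ‖x‖) ^ 2 := by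
  obtain ⟨C, hC⟩ := hV.2 2 le_rfl
  have hC0 : 0 ≤ C := (norm_nonneg _).trans (hC 0)
  have hd : Differentiable ℝ V := hV.1.differentiable (by simp)
  have hd2 : Differentiable ℝ (fderiv ℝ V) :=
    (hV.1.fderiv_right (m := 1) (by exact two_le_infty)).differentiable one_ne_zero
  have h1 : ∀ x, ‖fderiv ℝ V x‖ ≤ ‖fderiv ℝ V 0‖ + C * ‖x‖ := fun x => by
    have := convex_univ.norm_image_sub_le_of_norm_fderiv_le (𝕜 := ℝ) (f := fderiv ℝ V) (C := C)
      (fun x _ => hd2 x) (fun x _ => by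
        rw [← norm_iteratedFDeriv_one, norm_iteratedFDeriv_fderiv]
        exact hC x) (mem_univ 0) (mem_univ x)
    rw [sub_zero] at this
    linarith [norm_le_norm_add_norm_sub' (fderiv ℝ V x) (fderiv ℝ V 0)]
  refine ⟨|V 0| + ‖fderiv ℝ V 0‖ + C, by positivity, fun x => ?_⟩
  have h2 := (convex_closedBall (0 : Config D) ‖x‖).norm_image_sub_le_of_norm_fderiv_le (𝕜 := ℝ)
    (f := V) (C := ‖fderiv ℝ V 0‖ + C * ‖x‖) (fun x _ => hd x) (fun y hy => (h1 y).trans (by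
      have : ‖y‖ ≤ ‖x‖ := by simpa using hy
      gcongr)) (Metric.mem_closedBall_self (norm_nonneg x)) (y := x) (by simp)
  rw [sub_zero, Real.norm_eq_abs] at h2
  have h3 : |V x| ≤ |V 0| + |V x - V 0| := by
    have := abs_add_le (V 0) (V x - V 0)
    simpa using this
  have hx := norm_nonneg x
  have h4 := norm_nonneg (fderiv ℝ V 0)
  have h5 := abs_nonneg (V 0)
  calc |V x| ≤ |V 0| + (‖fderiv ℝ V 0‖ + C * ‖x‖) * ‖x‖ := h3.trans (by linarith)
    _ ≤ _ := by nlinarith [mul_nonneg h4 hx, mul_nonneg hC0 hx, mul_nonneg h5 hx,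
        mul_nonneg h4 (mul_nonneg hx hx), mul_nonneg h5 (mul_nonneg hx hx)]

theorem Observable.hasPolyGrowth_symbol (hV : IsSubquadratic V) (A : Observable D) :
    HasPolyGrowth (A.symbol ε Γ V) := by
  have hkin : HasPolyGrowth fun z x =>
      ∑ j, (momentumPoly ((ε * quad Γ (EuclideanSpace.single j 1) : ℝ) : ℂ) 2).eval
        (wavenumber Γ (EuclideanSpace.single j 1) z x) / 2 := by
    simp only [div_eq_mul_inv]
    exact HasPolyGrowth.sum _ fun j =>
      ((hasPolyGrowth_wavenumber _).eval _).mul (HasPolyGrowth.const _)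
  have hpot : HasPolyGrowth fun (_ : Phase D) x => (V x : ℂ) := by
    obtain ⟨C, hC, h⟩ := hV.exists_abs_le
    exact hasPolyGrowth_of_norm_le 2 hC fun z x => by rw [Complex.norm_real]; exact h x
  cases A with
  | identity => exact HasPolyGrowth.const 1
  | position j n =>
    have : HasPolyGrowth fun (_ : Phase D) (x : Config D) => ((x j : ℝ) : ℂ) :=
      hasPolyGrowth_of_norm_le 1 zero_le_one fun z x => by
        rw [Complex.norm_real, one_mul, pow_one]
        linarith [PiLp.norm_apply_le x j]
    exact this.pow n
  | momentum j n => exact (hasPolyGrowth_wavenumber _).eval _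
  | kinetic => exact hkin
  | potential => exact hpot
  | hamiltonian => exact hkin.add hpot

end Growth

/-! ### Observables are local, so vanishing extends from Schwartz to smooth functions -/

section Locality

theorem momentumOp_congr_nhds {f g : Config D → ℂ} {x : Config D} (j : Fin D)
    (h : f =ᶠ[𝓝 x] g) : momentumOp ε j f =ᶠ[𝓝 x] momentumOp ε j g := by
  filter_upwards [h.fderiv (𝕜 := ℝ)] with y hy
  rw [momentumOp, momentumOp, hy]

theorem kineticOp_congr_nhds {f g : Config D → ℂ} {x : Config D}
    (h : f =ᶠ[𝓝 x] g) : kineticOp ε f =ᶠ[𝓝 x] kineticOp ε g := by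
  filter_upwards [InnerProductSpace.laplacian_congr_nhds h] with y hy
  rw [kineticOp, kineticOp, hy]

theorem Observable.apply_congr_nhds (A : Observable D) {f g : Config D → ℂ} {x : Config D}
    (h : f =ᶠ[𝓝 x] g) : A.apply ε V f =ᶠ[𝓝 x] A.apply ε V g := by
  cases A with
  | identity => exact h
  | position j n => exact h.mono fun y hy => by simp only [Observable.apply, hy]
  | momentum j n =>
    simp only [Observable.apply]
    induction n with
    | zero => exact h
    | succ n ih =>
      rw [Function.iterate_succ_apply', Function.iterate_succ_apply']
      exact momentumOp_congr_nhds j ih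
  | kinetic => exact kineticOp_congr_nhds h
  | potential => exact h.mono fun y hy => by simp only [Observable.apply, hy]
  | hamiltonian =>
    filter_upwards [h, kineticOp_congr_nhds (ε := ε) h] with y hy hy'
    simp only [Observable.apply, hy, hy']

/-- A vanishing observable annihilates all smooth functions. -/
theorem Observable.IsZero.apply_eq_zero {A : Observable D} (hA : A.IsZero ε V)
    {f : Config D → ℂ} (hf : ContDiff ℝ ∞ f) : A.apply ε V f = 0 := by
  funext x
  -- Multiplying by a bump equal to 1 near `x` gives a Schwartz function with the same germ as `f`
  -- at `x`.
  let b : ContDiffBump x := ⟨1, 2, one_pos, one_lt_two⟩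
  have hb : ContDiff ℝ ∞ fun y => (b y : ℂ) * f y :=
    (Complex.ofRealCLM.contDiff.comp b.contDiff).mul hf
  have hc : HasCompactSupport fun y => (b y : ℂ) * f y :=
    HasCompactSupport.mul_right (b.hasCompactSupport.comp_left (g := Complex.ofReal) rfl)
  have h0 := congrFun (hA (hc.toSchwartzMap hb)) x
  have he : f =ᶠ[𝓝 x] hc.toSchwartzMap hb := by
    filter_upwards [b.eventuallyEq_one] with y hy
    show f y = (b y : ℂ) * f y
    rw [hy]
    simp
  exact ((A.apply_congr_nhds he).eq_of_nhds).trans h0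

end Locality

/-! ### Divergence of the total energy of the images of wavepackets -/

section LowerBound

open Polynomial

theorem abs_le_norm_wavenumber (e : Config D) (z : Phase D) (x : Config D) :
    ⟪z.2, e⟫_ℝ ≤ ‖wavenumber Γ e z x‖ := by
  refine le_trans (le_of_eq ?_) (Complex.re_le_norm _)
  simp [wavenumber]

theorem re_momentumPoly_two (a : ℝ) (k : ℂ) :
    ((momentumPoly (a : ℂ) 2).eval k).re = k.re ^ 2 - k.im ^ 2 + a := by
  simp [momentumPoly, pow_two]

theorem exists_le_norm_eval {Q : ℂ[X]} (hQ : Q.Monic) : ∃ R : ℝ, ∀ k : ℂ, R ≤ ‖k‖ → 1 ≤ ‖Q.eval k‖ := by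
  rcases eq_or_ne Q.natDegree 0 with h | h
  · replace h := hQ.natDegree_eq_zero.1 h
    exact ⟨0, fun k _ => by simp [h]⟩
  · have ht := Q.tendsto_norm_atTop (natDegree_pos_iff_degree_pos.1 (Nat.pos_of_ne_zero h))
      (l := Filter.comap norm Filter.atTop) (z := fun k : ℂ => k) Filter.tendsto_comap
    obtain ⟨t, ht, hs⟩ := Filter.mem_comap.1 (ht.eventually_ge_atTop 1)
    obtain ⟨R, hR⟩ := Filter.mem_atTop_sets.1 ht
    exact ⟨R, fun k hk => hs (hR _ hk)⟩

/-- The real part of the squared wavenumber is `p_j²` minus a quantity depending only on `x - q`.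
Summed over `j`, a single large momentum component dominates. -/
theorem exists_le_re_kinetic (hε : 0 < ε) (hΓ : Γ.PosDef) (j₀ : Fin D) (q x : Config D) (c : ℝ) :
    ∃ K : ℝ, ∀ p : Config D, K ≤ p j₀ → c ≤
      (∑ j, (momentumPoly ((ε * quad Γ (EuclideanSpace.single j 1) : ℝ) : ℂ) 2).eval
        (wavenumber Γ (EuclideanSpace.single j 1) (q, p) x) / 2).re := by
  set B : ℝ := ∑ j, bil Γ (x - q) (EuclideanSpace.single j 1) ^ 2
  refine ⟨1 + |B + 2 * c|, fun p hp => ?_⟩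
  have hquad : ∀ u, 0 ≤ quad Γ u := fun u => by
    obtain ⟨k, hk, h⟩ := exists_quad_lower_bound hΓ
    exact le_trans (by positivity) (h u)
  have hterm : ∀ j : Fin D, ((momentumPoly ((ε * quad Γ (EuclideanSpace.single j 1) : ℝ) : ℂ) 2).eval
      (wavenumber Γ (EuclideanSpace.single j 1) (q, p) x) / 2).re =
      (p j ^ 2 - bil Γ (x - q) (EuclideanSpace.single j 1) ^ 2
        + ε * quad Γ (EuclideanSpace.single j 1)) / 2 := fun j => by
    rw [show (2 : ℂ) = ((2 : ℝ) : ℂ) by simp, Complex.div_ofReal_re, re_momentumPoly_two]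
    simp [wavenumber, EuclideanSpace.inner_single_right]
  rw [Complex.re_sum]
  simp only [hterm]
  rw [← Finset.sum_div, Finset.sum_add_distrib, Finset.sum_sub_distrib]
  have h1 : p j₀ ^ 2 ≤ ∑ j, p j ^ 2 :=
    Finset.single_le_sum (f := fun j => p j ^ 2) (fun j _ => sq_nonneg _) (Finset.mem_univ j₀)
  have h2 : 0 ≤ ∑ j : Fin D, ε * quad Γ (EuclideanSpace.single j 1) :=
    Finset.sum_nonneg fun j _ => mul_nonneg hε.le (hquad _)
  have h3 := le_abs_self (B + 2 * c)
  have h4 := abs_nonneg (B + 2 * c)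
  have h5 : B + 2 * c ≤ p j₀ ^ 2 := by nlinarith
  rw [le_div_iff₀ two_pos]
  linarith

/-- The symbol of a non-vanishing observable is bounded below on half-spaces of momenta. -/
theorem Observable.exists_le_norm_symbol (hD : 0 < D) (hε : 0 < ε) (hΓ : Γ.PosDef)
    (hV : IsSubquadratic V) {A : Observable D} (hA : ¬ A.IsZero ε V) :
    ∃ (U : Set (Config D)) (j : Fin D), IsOpen U ∧ U.Nonempty ∧ ∀ x ∈ U, ∃ c : ℝ, 0 < c ∧
      ∀ q, ∃ K : ℝ, ∀ p : Config D, K ≤ p j → c ≤ ‖A.symbol ε Γ V (q, p) x‖ := by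
  let j₀ : Fin D := ⟨0, hD⟩
  cases A with
  | identity =>
    exact ⟨univ, j₀, isOpen_univ, univ_nonempty, fun x _ => ⟨1, one_pos, fun q => ⟨0, fun p _ => by
      simp [Observable.symbol]⟩⟩⟩
  | position j n =>
    have hc : Continuous fun x : Config D => x j := (EuclideanSpace.proj (𝕜 := ℝ) j).continuous
    refine ⟨{x | x j ≠ 0}, j, isOpen_ne_fun hc continuous_const,
      ⟨EuclideanSpace.single j 1, by simp⟩, fun x hx => ⟨‖((x j : ℝ) : ℂ) ^ n‖, ?_, fun q =>
      ⟨0, fun p _ => le_rfl⟩⟩⟩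
    have : x j ≠ 0 := hx
    rw [norm_pos_iff]
    exact pow_ne_zero n (Complex.ofReal_ne_zero.2 this)
  | momentum j n =>
    obtain ⟨R, hR⟩ := exists_le_norm_eval
      (monic_momentumPoly ((ε * quad Γ (EuclideanSpace.single j 1) : ℝ) : ℂ) n).1
    refine ⟨univ, j, isOpen_univ, univ_nonempty, fun x _ => ⟨1, one_pos, fun q =>
      ⟨R, fun p hp => hR _ (le_trans ?_ (abs_le_norm_wavenumber _ _ _))⟩⟩⟩
    simpa [EuclideanSpace.inner_single_right] using hp
  | kinetic =>
    refine ⟨univ, j₀, isOpen_univ, univ_nonempty, fun x _ => ⟨1, one_pos, fun q => ?_⟩⟩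
    obtain ⟨K, hK⟩ := exists_le_re_kinetic hε hΓ j₀ q x 1
    exact ⟨K, fun p hp => (hK p hp).trans (Complex.re_le_norm _)⟩
  | potential =>
    obtain ⟨x₀, hx₀⟩ : ∃ x, V x ≠ 0 := by
      by_contra! h
      exact hA fun φ => funext fun x => by simp [Observable.apply, h]
    refine ⟨{x | V x ≠ 0}, j₀, isOpen_ne_fun hV.1.continuous continuous_const, ⟨x₀, hx₀⟩,
      fun x hx => ⟨‖(V x : ℂ)‖, norm_pos_iff.2 (Complex.ofReal_ne_zero.2 hx), fun q =>
      ⟨0, fun p _ => le_rfl⟩⟩⟩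
  | hamiltonian =>
    refine ⟨univ, j₀, isOpen_univ, univ_nonempty, fun x _ => ⟨1, one_pos, fun q => ?_⟩⟩
    -- At fixed `x` the potential is a constant and is absorbed into the threshold, so its sign is
    -- irrelevant.
    obtain ⟨K, hK⟩ := exists_le_re_kinetic hε hΓ j₀ q x (1 - V x)
    refine ⟨K, fun p hp => le_trans ?_ (Complex.re_le_norm _)⟩
    have := hK p hp
    simp only [Observable.symbol, Complex.add_re, Complex.ofReal_re]
    linarith

/-- The reflection `p ↦ 2K e_j - p` preserves volume, and the half-space together with its
reflection covers a space of infinite measure. -/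
theorem volume_halfSpace (j : Fin D) (K : ℝ) : volume {p : Config D | K ≤ p j} = ⊤ := by
  have hc : Continuous fun x : Config D => x j := (EuclideanSpace.proj (𝕜 := ℝ) j).continuous
  have : Nontrivial (Config D) :=
    ⟨⟨0, EuclideanSpace.single j 1, fun h => by simpa using congrArg (fun x : Config D => x j) h⟩⟩
  have h1 : volume ((fun p => EuclideanSpace.single j (2 * K) - p) ⁻¹' {p : Config D | K ≤ p j}) =
      volume {p : Config D | K ≤ p j} :=
    (Measure.measurePreserving_sub_left volume _).measure_preimage
      (isClosed_le continuous_const hc).measurableSet.nullMeasurableSet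
  have h2 : (univ : Set (Config D)) ⊆ {p : Config D | K ≤ p j} ∪
      ((fun p => EuclideanSpace.single j (2 * K) - p) ⁻¹' {p : Config D | K ≤ p j}) := fun p _ => by
    by_cases h : K ≤ p j
    · exact Or.inl h
    · right
      simp only [mem_preimage, mem_ofPred_eq, PiLp.sub_apply, PiLp.single_apply, if_true]
      linarith
  have h3 := (measure_mono h2).trans (measure_union_le (μ := volume) _ _)
  rw [h1, measure_univ_of_isAddLeftInvariant] at h3
  by_contra h
  exact (ENNReal.add_lt_top.2 ⟨lt_top_iff_ne_top.2 h, lt_top_iff_ne_top.2 h⟩).not_ge h3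

/-- Tonelli puts the `p`-integral innermost, where a positive constant is integrated over a
half-space. The constant may therefore depend on `x` and `q`. -/
theorem lintegral_enorm_sq_eq_top {F : Phase D → Config D → ℂ}
    (hF : Continuous fun p : Phase D × Config D => F p.1 p.2) {U : Set (Config D)} (hU : IsOpen U)
    (hne : U.Nonempty) (j : Fin D)
    (h : ∀ x ∈ U, ∀ q, ∃ c K : ℝ, 0 < c ∧ ∀ p : Config D, K ≤ p j → c ≤ ‖F (q, p) x‖) :
    ∫⁻ z, ∫⁻ x, ‖F z x‖ₑ ^ 2 = ⊤ := by
  have hm : Measurable fun p : Phase D × Config D => ‖F p.1 p.2‖ₑ ^ 2 :=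
    hF.measurable.enorm.pow_const 2
  rw [lintegral_lintegral_swap hm.aemeasurable]
  have hx : ∀ x ∈ U, ∫⁻ z, ‖F z x‖ₑ ^ 2 = ⊤ := fun x hx => by
    have hmx : Measurable fun z : Phase D => ‖F z x‖ₑ ^ 2 := hm.comp measurable_prodMk_right
    rw [Measure.volume_eq_prod, lintegral_prod _ hmx.aemeasurable]
    have hin : ∀ q : Config D, ∫⁻ p, ‖F (q, p) x‖ₑ ^ 2 = ⊤ := fun q => by
      obtain ⟨c, K, hc, hK⟩ := h x hx q
      rw [eq_top_iff]
      calc (⊤ : ℝ≥0∞) = ENNReal.ofReal c ^ 2 * volume {p : Config D | K ≤ p j} := by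
            rw [volume_halfSpace, ENNReal.mul_top]
            exact pow_ne_zero 2 (ENNReal.ofReal_pos.2 hc).ne'
        _ = ∫⁻ p in {p : Config D | K ≤ p j}, ENNReal.ofReal c ^ 2 := by
            rw [setLIntegral_const]
        _ ≤ ∫⁻ p in {p : Config D | K ≤ p j}, ‖F (q, p) x‖ₑ ^ 2 := by
            refine setLIntegral_mono (hmx.comp measurable_prodMk_left) fun p hp => ?_
            rw [← ofReal_norm]
            gcongr
            exact hK p hp
        _ ≤ _ := setLIntegral_le_lintegral _ _
    simp only [hin, lintegral_const]
    rw [ENNReal.top_mul]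
    exact isOpen_univ.measure_ne_zero volume univ_nonempty
  rw [eq_top_iff]
  calc (⊤ : ℝ≥0∞) = ∫⁻ x in U, ⊤ := by
        rw [setLIntegral_const, ENNReal.top_mul (hU.measure_ne_zero volume hne)]
    _ = ∫⁻ x in U, ∫⁻ z, ‖F z x‖ₑ ^ 2 :=
        (setLIntegral_congr_fun hU.measurableSet fun x h => hx x h).symm
    _ ≤ _ := setLIntegral_le_lintegral _ _

theorem Observable.continuous_symbol_mul_gaussian (hV : IsSubquadratic V) (A : Observable D) :
    Continuous fun p : Phase D × Config D => A.symbol ε Γ V p.1 p.2 * gaussian ε Γ p.1 p.2 :=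
  (A.continuous_symbol hV).mul continuous_gaussian

/-- The modulus of a wavepacket at `x` depends on `q` but not on `p`, so a lower bound on the symbol
for large momenta gives no decay in `p`. -/
theorem Observable.lintegral_enorm_sq_apply_gaussian (hD : 0 < D) (hε : 0 < ε) (hΓ : Γ.PosDef)
    (hV : IsSubquadratic V) {A : Observable D} (hA : ¬ A.IsZero ε V) :
    ∫⁻ z, ∫⁻ x, ‖A.apply ε V (gaussian ε Γ z) x‖ₑ ^ 2 = ⊤ := by
  obtain ⟨U, j, hU, hne, h⟩ := A.exists_le_norm_symbol hD hε hΓ hV hA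
  simp only [A.apply_gaussian hε hΓ]
  refine lintegral_enorm_sq_eq_top (A.continuous_symbol_mul_gaussian hV) hU hne j
    fun x hx q => ?_
  obtain ⟨c, hc, hq⟩ := h x hx
  obtain ⟨K, hK⟩ := hq q
  have he := envelope_pos hε hΓ (x - q)
  refine ⟨c * envelope ε Γ (x - q), K, mul_pos hc he, fun p hp => ?_⟩
  rw [norm_mul, norm_gaussian hε hΓ]
  exact mul_le_mul_of_nonneg_right (hK p hp) he.le

end LowerBound

end HermanKluk

/-! ### Change of variables along the flow without volume preservation -/

/-- A surjective Lipschitz map does not contract Haar measure to zero. -/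
theorem exists_lintegral_le_mul_lintegral_comp {E : Type*} [NormedAddCommGroup E] [NormedSpace ℝ E]
    [FiniteDimensional ℝ E] [MeasurableSpace E] [BorelSpace E] (μ : Measure E)
    [μ.IsAddHaarMeasure] {f : E → E} {B : NNReal} (hf : LipschitzWith B f)
    (hs : Function.Surjective f) :
    ∃ K : ℝ≥0∞, K ≠ ⊤ ∧ ∀ g : E → ℝ≥0∞, Measurable g → ∫⁻ x, g x ∂μ ≤ K * ∫⁻ x, g (f x) ∂μ := by
  let H : Measure E := Measure.hausdorffMeasure (Module.finrank ℝ E)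
  have hH : H.IsAddHaarMeasure := isAddHaarMeasure_hausdorffMeasure
  have hμ : μ = μ.addHaarScalarFactor H • H := Measure.isAddLeftInvariant_eq_smul μ H
  refine ⟨(B : ℝ≥0∞) ^ (Module.finrank ℝ E : ℝ), by simp, fun g hg => ?_⟩
  -- Haar measure is a multiple of Hausdorff measure, and a Lipschitz map enlarges the latter by at
  -- most `B ^ dim`. Surjectivity writes `s` as the image of its preimage.
  have h1 : μ ≤ ((B : ℝ≥0∞) ^ (Module.finrank ℝ E : ℝ)) • μ.map f := by
    rw [Measure.le_iff]
    intro s hsm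
    rw [Measure.smul_apply, Measure.map_apply hf.continuous.measurable hsm]
    nth_rewrite 1 [← Set.image_preimage_eq s hs]
    rw [hμ, Measure.smul_apply, Measure.smul_apply, smul_comm]
    gcongr
    exact hf.hausdorffMeasure_image_le (Nat.cast_nonneg _) _
  calc ∫⁻ x, g x ∂μ ≤ ∫⁻ x, g x ∂(((B : ℝ≥0∞) ^ (Module.finrank ℝ E : ℝ)) • μ.map f) :=
        lintegral_mono' h1 le_rfl
    _ = _ := by
        rw [lintegral_smul_measure, lintegral_map hg hf.continuous.measurable, smul_eq_mul]

namespace HermanKluk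

open Set
open scoped Topology InnerProductSpace Matrix

variable {D : ℕ} {ε : ℝ} {Γ : Matrix (Fin D) (Fin D) ℝ} {V : Config D → ℝ}

/-! ### The operator factor: polynomial bound and infinite square integral -/

section OperatorFactor

theorem one_add_pow_le_exp {r : ℝ} (hr : 0 ≤ r) (m : ℕ) : (1 + r) ^ m ≤ Real.exp (m * r) := by
  rw [Real.exp_nat_mul]
  exact pow_le_pow_left₀ (by linarith) (by linarith [Real.add_one_le_exp r]) m

theorem Observable.exists_norm_apply_gaussian_le (hε : 0 < ε) (hΓ : Γ.PosDef)
    (hV : IsSubquadratic V) (A : Observable D) :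
    ∃ (C : ℝ) (m : ℕ), 0 ≤ C ∧ ∀ z x, ‖A.apply ε V (gaussian ε Γ z) x‖ ≤
      C * (1 + ‖z‖) ^ m * (Real.exp (m * ‖x - z.1‖) * envelope ε Γ (x - z.1)) := by
  obtain ⟨C, m, hC, h⟩ := A.hasPolyGrowth_symbol (ε := ε) (Γ := Γ) hV
  refine ⟨C, m, hC, fun z x => ?_⟩
  rw [A.apply_gaussian hε hΓ, norm_mul, norm_gaussian hε hΓ, ← mul_assoc]
  refine mul_le_mul_of_nonneg_right ((h z x).trans ?_) (envelope_pos hε hΓ _).le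
  rw [mul_pow, ← mul_assoc]
  exact mul_le_mul_of_nonneg_left (one_add_pow_le_exp (norm_nonneg _) m) (by positivity)

theorem Observable.continuous_apply_gaussian (hε : 0 < ε) (hΓ : Γ.PosDef)
    (hV : IsSubquadratic V) (A : Observable D) :
    Continuous fun p : Phase D × Config D => A.apply ε V (gaussian ε Γ p.1) p.2 := by
  simp only [A.apply_gaussian hε hΓ]
  exact A.continuous_symbol_mul_gaussian hV

theorem continuous_right_of_uncurry {X Y Z : Type*} [TopologicalSpace X] [TopologicalSpace Y]
    [TopologicalSpace Z] {F : X → Y → Z} (hF : Continuous fun p : X × Y => F p.1 p.2) (x : X) :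
    Continuous (F x) :=
  hF.comp (Continuous.prodMk_right x)

theorem Observable.memLp_apply_gaussian (hε : 0 < ε) (hΓ : Γ.PosDef)
    (hV : IsSubquadratic V) (A : Observable D) (z : Phase D) :
    MemLp (A.apply ε V (gaussian ε Γ z)) 2 volume := by
  obtain ⟨C, m, hC, h⟩ := A.exists_norm_apply_gaussian_le hε hΓ hV
  have h1 := (memLp_exp_mul_norm_mul_envelope (D := D) hε hΓ
      m).comp_measurePreserving (measurePreserving_sub_right volume z.1)
  refine h1.of_le_mul (c := C * (1 + ‖z‖) ^ m) (continuous_right_of_uncurry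
    (F := fun z x => A.apply ε V (gaussian ε Γ z) x)
    (A.continuous_apply_gaussian hε hΓ hV) z).aestronglyMeasurable
    (Filter.Eventually.of_forall fun x => ?_)
  refine (h z x).trans (mul_le_mul_of_nonneg_left (le_of_eq ?_) (by positivity))
  exact (Real.norm_of_nonneg (mul_pos (Real.exp_pos _) (envelope_pos hε hΓ _)).le).symm

theorem stronglyMeasurable_bracket_of_continuous {X Y : Type*} [TopologicalSpace X]
    [TopologicalSpace Y] [MeasurableSpace X] [MeasurableSpace Y] [OpensMeasurableSpace X]
    [OpensMeasurableSpace Y] [SecondCountableTopology X] [SecondCountableTopology Y]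
    {F : X → Config D → ℂ} {G : Y → Config D → ℂ}
    (hF : Continuous fun p : X × Config D => F p.1 p.2)
    (hG : Continuous fun p : Y × Config D => G p.1 p.2) :
    StronglyMeasurable fun w : X × Y => bracket (F w.1) (G w.2) := by
  refine StronglyMeasurable.integral_prod_right
    (f := fun (w : X × Y) x => (starRingEnd ℂ) (F w.1 x) * G w.2 x) ?_
  have h1 : Continuous fun p : (X × Y) × Config D => F p.1.1 p.2 :=
    hF.comp ((continuous_fst.comp continuous_fst).prodMk continuous_snd)
  have h2 : Continuous fun p : (X × Y) × Config D => G p.1.2 p.2 :=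
    hG.comp ((continuous_snd.comp continuous_fst).prodMk continuous_snd)
  exact ((Complex.continuous_conj.comp h1).mul h2).stronglyMeasurable

/-- The matrix elements of an observable between wavepackets. -/
noncomputable def matrixElement (ε : ℝ) (Γ : Matrix (Fin D) (Fin D) ℝ) (V : Config D → ℝ)
    (A : Observable D) (w : DoublePhase D) : ℂ :=
  bracket (gaussian ε Γ w.1) (A.apply ε V (gaussian ε Γ w.2))

theorem operatorFactor_eq (A : Observable D) (t : ℝ) (w : DoublePhase D) :
    operatorFactor ε Γ V A t w = matrixElement ε Γ V A (flow V t w.1, flow V t w.2) := rfl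

theorem Observable.stronglyMeasurable_matrixElement (hε : 0 < ε) (hΓ : Γ.PosDef)
    (hV : IsSubquadratic V) (A : Observable D) :
    StronglyMeasurable (matrixElement ε Γ V A) :=
  stronglyMeasurable_bracket_of_continuous (F := fun z => gaussian ε Γ z)
    (G := fun z => A.apply ε V (gaussian ε Γ z)) continuous_gaussian
    (A.continuous_apply_gaussian hε hΓ hV)

/-- The left wavepacket is bounded uniformly in its centre, and the `L¹` norm of the image of the
right one grows polynomially in its own centre. Hence no weight in `w.1` is needed. -/
theorem Observable.exists_norm_matrixElement_le (hε : 0 < ε) (hΓ : Γ.PosDef)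
    (hV : IsSubquadratic V) (A : Observable D) :
    ∃ (C : ℝ) (m : ℕ), 0 ≤ C ∧ ∀ w, ‖matrixElement ε Γ V A w‖ ≤ C * (1 + ‖w.2‖) ^ m := by
  obtain ⟨C, m, hC, h⟩ := A.exists_norm_apply_gaussian_le hε hΓ hV
  obtain ⟨C', hC', h'⟩ := exists_envelope_le_const (D := D) hε hΓ
  have hint := integrable_exp_mul_norm_mul_envelope (D := D) hε hΓ m
  set I := ∫ u : Config D, Real.exp (m * ‖u‖) * envelope ε Γ u
  have hI : 0 ≤ I := integral_nonneg fun u =>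
    mul_nonneg (Real.exp_pos _).le (envelope_pos hε hΓ u).le
  refine ⟨C' * C * I, m, by positivity, fun w => ?_⟩
  have hb : ∀ x, ‖(starRingEnd ℂ) (gaussian ε Γ w.1 x) * A.apply ε V (gaussian ε Γ w.2) x‖ ≤
      C' * (C * (1 + ‖w.2‖) ^ m) *
        (Real.exp (m * ‖x - w.2.1‖) * envelope ε Γ (x - w.2.1)) := fun x => by
    rw [norm_mul, RCLike.norm_conj, norm_gaussian hε hΓ, mul_assoc C']
    exact mul_le_mul (h' _) (h _ _) (norm_nonneg _) hC'.le
  refine (norm_integral_le_of_norm_le ((hint.comp_sub_right w.2.1).const_mul _)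
    (Filter.Eventually.of_forall hb)).trans (le_of_eq ?_)
  rw [integral_const_mul,
    integral_sub_right_eq_self (fun u : Config D => Real.exp (m * ‖u‖) * envelope ε Γ u) w.2.1]
  ring

theorem Observable.exists_norm_operatorFactor_le (hε : 0 < ε) (hΓ : Γ.PosDef)
    (hV : IsSubquadratic V) (A : Observable D) (t : ℝ) :
    ∃ (C : ℝ) (m : ℕ), 0 ≤ C ∧ ∀ w, ‖operatorFactor ε Γ V A t w‖ ≤ C * (1 + ‖w.2‖) ^ m := by
  obtain ⟨C, m, hC, h⟩ := A.exists_norm_matrixElement_le hε hΓ hV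
  obtain ⟨B, hB, hf⟩ := hV.exists_norm_flow_le t
  refine ⟨C * (1 + B) ^ m, m, by positivity, fun w => ?_⟩
  rw [operatorFactor_eq, mul_assoc, ← mul_pow]
  refine (h _).trans (mul_le_mul_of_nonneg_left (pow_le_pow_left₀ (by positivity) ?_ m) hC)
  have := hf w.2
  have h2 := norm_nonneg w.2
  dsimp only
  linarith

theorem IsSubquadratic.measurable_flow (hV : IsSubquadratic V) (t : ℝ) : Measurable (flow V t) := by
  obtain ⟨B, hB⟩ := hV.lipschitzWith_flow t
  exact hB.continuous.measurable

theorem stronglyMeasurable_prodMap_comp {X : Type*} [MeasurableSpace X] {Y : Type*} [TopologicalSpace Y]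
    {M : X × X → Y} (hM : StronglyMeasurable M) {f : X → X} (hf : Measurable f) :
    StronglyMeasurable fun w : X × X => M (f w.1, f w.2) :=
  hM.comp_measurable ((hf.comp measurable_fst).prodMk (hf.comp measurable_snd))

theorem Observable.stronglyMeasurable_operatorFactor (hε : 0 < ε) (hΓ : Γ.PosDef)
    (hV : IsSubquadratic V) (A : Observable D) (t : ℝ) :
    StronglyMeasurable (operatorFactor ε Γ V A t) :=
  stronglyMeasurable_prodMap_comp (M := matrixElement ε Γ V A)
    (A.stronglyMeasurable_matrixElement hε hΓ hV) (hV.measurable_flow t)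

/-- For fixed `z` the isometry property turns the integral over `y` into a nonzero multiple of the
squared `L²` norm of `F z`. -/
theorem lintegral_enorm_sq_bracket_eq_top (hε : 0 < ε) (hΓ : Γ.PosDef)
    {F : Phase D → Config D → ℂ} (hF : Continuous fun p : Phase D × Config D => F p.1 p.2)
    (hF2 : ∀ z, MemLp (F z) 2 volume) (htop : ∫⁻ z, ∫⁻ x, ‖F z x‖ₑ ^ 2 = ⊤) :
    ∫⁻ z, ∫⁻ y, ‖bracket (gaussian ε Γ y) (F z)‖ₑ ^ 2 = ⊤ := by
  obtain ⟨c, hc0, -, hc⟩ := exists_moyal (D := D) hε hΓ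
  have hm : Measurable fun z : Phase D => ∫⁻ x, ‖F z x‖ₑ ^ 2 :=
    Measurable.lintegral_prod_right' (f := fun p : Phase D × Config D => ‖F p.1 p.2‖ₑ ^ 2)
      (hF.measurable.enorm.pow_const 2)
  rw [lintegral_congr fun z => hc _ (hF2 z), lintegral_const_mul _ hm, htop, ENNReal.mul_top hc0]

theorem Observable.lintegral_enorm_sq_matrixElement (hD : 0 < D) (hε : 0 < ε) (hΓ : Γ.PosDef)
    (hV : IsSubquadratic V) {A : Observable D} (hA : ¬ A.IsZero ε V) :
    ∫⁻ z, ∫⁻ y, ‖matrixElement ε Γ V A (y, z)‖ₑ ^ 2 = ⊤ :=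
  lintegral_enorm_sq_bracket_eq_top hε hΓ (F := fun z => A.apply ε V (gaussian ε Γ z))
    (A.continuous_apply_gaussian hε hΓ hV) (A.memLp_apply_gaussian hε hΓ hV)
    (A.lintegral_enorm_sq_apply_gaussian hD hε hΓ hV hA)

/-- The change-of-variables inequality is applied once in each factor, so the divergent integral is
at most `K²` times the transported one. -/
theorem lintegral_prodMap_eq_top {X : Type*} [MeasurableSpace X] {μ : Measure X} [SFinite μ]
    {G : X × X → ℝ≥0∞} (hG : Measurable G) {f : X → X} (hf : Measurable f) {K : ℝ≥0∞}
    (hK : K ≠ ⊤) (h : ∀ g : X → ℝ≥0∞, Measurable g → ∫⁻ x, g x ∂μ ≤ K * ∫⁻ x, g (f x) ∂μ)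
    (htop : ∫⁻ z, ∫⁻ y, G (y, z) ∂μ ∂μ = ⊤) : ∫⁻ w, G (f w.1, f w.2) ∂(μ.prod μ) = ⊤ := by
  have hGf : Measurable fun p : X × X => G (f p.2, p.1) :=
    hG.comp ((hf.comp measurable_snd).prodMk measurable_fst)
  have h1 : ∫⁻ z, ∫⁻ y, G (y, z) ∂μ ∂μ ≤ K * (K * ∫⁻ z, ∫⁻ y, G (f y, f z) ∂μ ∂μ) := by
    calc ∫⁻ z, ∫⁻ y, G (y, z) ∂μ ∂μ ≤ ∫⁻ z, K * ∫⁻ y, G (f y, z) ∂μ ∂μ :=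
          lintegral_mono fun z => h _ (hG.comp measurable_prodMk_right)
      _ = K * ∫⁻ z, ∫⁻ y, G (f y, z) ∂μ ∂μ := lintegral_const_mul _ hGf.lintegral_prod_right'
      _ ≤ _ := by
          gcongr
          exact h _ hGf.lintegral_prod_right'
  have hGff : Measurable fun w : X × X => G (f w.1, f w.2) :=
    hG.comp ((hf.comp measurable_fst).prodMk (hf.comp measurable_snd))
  rw [lintegral_prod_symm' _ hGff]
  by_contra h4
  rw [htop, top_le_iff] at h1
  exact ENNReal.mul_ne_top hK (ENNReal.mul_ne_top hK h4) h1

theorem Observable.lintegral_enorm_sq_operatorFactor (hD : 0 < D) (hε : 0 < ε) (hΓ : Γ.PosDef)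
    (hV : IsSubquadratic V) {A : Observable D} (hA : ¬ A.IsZero ε V) (t : ℝ) :
    ∫⁻ w, ‖operatorFactor ε Γ V A t w‖ₑ ^ 2 = ⊤ := by
  have : (volume : Measure (Phase D)).IsAddHaarMeasure := Measure.prod.instIsAddHaarMeasure _ _
  obtain ⟨B, hB⟩ := hV.lipschitzWith_flow t
  obtain ⟨K, hK, h⟩ := exists_lintegral_le_mul_lintegral_comp volume hB (hV.flow_surjective t)
  have hm : Measurable fun w => ‖matrixElement ε Γ V A w‖ₑ ^ 2 :=
    (A.stronglyMeasurable_matrixElement hε hΓ hV).measurable.enorm.pow_const 2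
  exact lintegral_prodMap_eq_top (G := fun w => ‖matrixElement ε Γ V A w‖ₑ ^ 2) hm
    (hV.measurable_flow t) hK h (A.lintegral_enorm_sq_matrixElement hD hε hΓ hV hA)

theorem Observable.IsZero.operatorFactor_eq_zero {A : Observable D} (hA : A.IsZero ε V) (t : ℝ)
    (w : DoublePhase D) : operatorFactor ε Γ V A t w = 0 := by
  simp [operatorFactor, hA.apply_eq_zero (contDiff_gaussian _), bracket]

end OperatorFactor

end HermanKluk

namespace HermanKluk

open Set
open scoped Topology InnerProductSpace Matrix

variable {D : ℕ} {ε : ℝ} {Γ : Matrix (Fin D) (Fin D) ℝ} {V : Config D → ℝ}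

/-! ### Rapid decay of the wavepacket transform of Schwartz functions -/

section SchwartzDecay

/-- Allows the derivative formula for wavepackets to be used for the conjugated wavepacket in the
bracket. -/
theorem conj_gaussian (z : Phase D) (x : Config D) :
    (starRingEnd ℂ) (gaussian ε Γ z x) = gaussian ε Γ (z.1, -z.2) x := by
  rw [gaussian_eq, gaussian_eq, map_mul, Complex.conj_ofReal, ← Complex.exp_conj, map_mul,
    Complex.conj_ofReal, Complex.conj_I, inner_neg_left, neg_div]
  push_cast
  rw [neg_mul, mul_neg]

theorem fderiv_gaussian (hε : 0 < ε) (hΓ : Γ.PosDef) (z : Phase D) (x e : Config D) :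
    fderiv ℝ (gaussian ε Γ z) x e =
      Complex.I / ε * wavenumber Γ e z x * gaussian ε Γ z x := by
  simpa using fderiv_eval_wavenumber_mul_gaussian hε hΓ 1 e z x

theorem exists_schwartz_bil_mul (Γ : Matrix (Fin D) (Fin D) ℝ) (e : Config D)
    (φ : 𝓢(Config D, ℂ)) : ∃ χ : 𝓢(Config D, ℂ), ∀ x, χ x = (bil Γ x e : ℂ) * φ x := by
  let w : Config D := WithLp.toLp 2 (Γ.mulVec e.ofLp)
  have h : ∀ u, bil Γ u e = innerSL ℝ w u := fun u => by
    simp [bil, w, PiLp.inner_apply, dotProduct]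
  refine ⟨SchwartzMap.smulLeftCLM ℂ (fun x => innerSL ℝ w x) φ, fun x => ?_⟩
  rw [SchwartzMap.smulLeftCLM_apply_apply (innerSL ℝ w).hasTemperateGrowth, h,
    Complex.real_smul]

theorem integrable_gaussian_mul_schwartz (hε : 0 < ε) (hΓ : Γ.PosDef) (z : Phase D)
    (φ : 𝓢(Config D, ℂ)) : Integrable fun x => gaussian ε Γ z x * φ x := by
  obtain ⟨C, hC, h⟩ := exists_envelope_le_const (D := D) hε hΓ
  refine φ.integrable.bdd_mul (c := C) (continuous_gaussian_right z).aestronglyMeasurable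
    (Filter.Eventually.of_forall fun x => ?_)
  rw [norm_gaussian hε hΓ]
  exact h _

/-- Multiplication by a momentum, transferred to the wave function. -/
theorem inner_mul_bracket_gaussian (hε : 0 < ε) (hΓ : Γ.PosDef) (e : Config D)
    {φ φ' χ : 𝓢(Config D, ℂ)} (hφ' : ∀ x, φ' x = fderiv ℝ φ x e)
    (hχ : ∀ x, χ x = (bil Γ x e : ℂ) * φ x) (z : Phase D) :
    (⟪z.2, e⟫_ℝ : ℂ) * bracket (gaussian ε Γ z) φ =
      -Complex.I * ε * bracket (gaussian ε Γ z) φ' + Complex.I * bracket (gaussian ε Γ z) χ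
        - Complex.I * (bil Γ z.1 e : ℂ) * bracket (gaussian ε Γ z) φ := by
  have hb : ∀ f : 𝓢(Config D, ℂ), bracket (gaussian ε Γ z) f =
      ∫ x, gaussian ε Γ (z.1, -z.2) x * f x := fun f => by
    simp only [bracket, conj_gaussian]
  set z' : Phase D := (z.1, -z.2)
  have hi : ∀ f : 𝓢(Config D, ℂ), Integrable fun x => gaussian ε Γ z' x * f x :=
    integrable_gaussian_mul_schwartz hε hΓ z'
  have hbil : ∀ x, bil Γ (x - z.1) e = bil Γ x e - bil Γ z.1 e := fun x => by
    simp [bil, sub_dotProduct]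
  have hε' : (ε : ℂ) ≠ 0 := Complex.ofReal_ne_zero.2 hε.ne'
  have hder : ∀ x, fderiv ℝ (gaussian ε Γ z') x e * φ x =
      -(Complex.I / ε) * (⟪z.2, e⟫_ℝ : ℂ) * (gaussian ε Γ z' x * φ x)
        + (1 / ε * (bil Γ z.1 e : ℂ) * (gaussian ε Γ z' x * φ x)
          + -(1 / ε) * (gaussian ε Γ z' x * χ x)) := fun x => by
    rw [fderiv_gaussian hε hΓ, hχ, wavenumber, hbil, inner_neg_left]
    push_cast
    field_simp
    linear_combination (((bil Γ x e : ℂ) - bil Γ z.1 e) * (gaussian ε Γ z' x * φ x)) *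
      Complex.I_sq
  have i1 := (hi φ).const_mul (-(Complex.I / ε) * (⟪z.2, e⟫_ℝ : ℂ))
  have i2 := (hi φ).const_mul (1 / ε * (bil Γ z.1 e : ℂ))
  have i3 := (hi χ).const_mul (-(1 / ε) : ℂ)
  have i23 : Integrable fun x => 1 / ε * (bil Γ z.1 e : ℂ) * (gaussian ε Γ z' x * φ x)
      + -(1 / ε) * (gaussian ε Γ z' x * χ x) := i2.add i3
  -- Integration by parts: differentiating the conjugated wavepacket produces the momentum, plus a
  -- term linear in `x - q` that `χ` and `bil Γ z.1 e` account for.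
  have hparts : ∫ x, gaussian ε Γ z' x * fderiv ℝ φ x e =
      -∫ x, fderiv ℝ (gaussian ε Γ z') x e * φ x := by
    refine integral_mul_fderiv_eq_neg_fderiv_mul_of_integrable ?_ ?_ (hi φ)
      (fun x _ => (contDiff_gaussian z').differentiable (by simp) x)
      (fun x _ => φ.differentiable x)
    · simp only [hder]
      exact i1.add i23
    · simpa only [hφ'] using hi φ'
  simp only [hder] at hparts
  rw [integral_add i1 i23, integral_add i2 i3, integral_const_mul, integral_const_mul,
    integral_const_mul] at hparts
  rw [hb, hb, hb]
  simp only [hφ']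
  rw [hparts]
  field_simp
  linear_combination ((⟪z.2, e⟫_ℝ : ℂ) * ∫ x, gaussian ε Γ z' x * φ x) * Complex.I_sq

/-- Decay in position: by `1 + |q| ≤ (1 + |x - q|)(1 + |x|)` the weight is shared between the
Gaussian, which has exponential moments, and `φ`. -/
theorem exists_pow_mul_norm_bracket_le (hε : 0 < ε) (hΓ : Γ.PosDef) (φ : 𝓢(Config D, ℂ)) (N : ℕ) :
    ∃ C : ℝ, ∀ z, (1 + ‖z.1‖) ^ N * ‖bracket (gaussian ε Γ z) φ‖ ≤ C := by
  set B : ℝ := 2 ^ N * (Finset.Iic (N, 0)).sup (fun m => SchwartzMap.seminorm ℝ m.1 m.2) φ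
  have hB : ∀ x, (1 + ‖x‖) ^ N * ‖φ x‖ ≤ B := fun x => by
    simpa using SchwartzMap.one_add_le_sup_seminorm_apply (𝕜 := ℝ) (m := (N, 0)) (k := N) (n := 0)
      le_rfl le_rfl φ x
  have hint := integrable_exp_mul_norm_mul_envelope (D := D) hε hΓ N
  refine ⟨B * ∫ u : Config D, Real.exp (N * ‖u‖) * envelope ε Γ u, fun z => ?_⟩
  have hpt : ∀ x, ‖((1 + ‖z.1‖) ^ N : ℂ) * ((starRingEnd ℂ) (gaussian ε Γ z x) * φ x)‖ ≤
      B * (Real.exp (N * ‖x - z.1‖) * envelope ε Γ (x - z.1)) := fun x => by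
    have he := envelope_pos hε hΓ (x - z.1)
    have h1 : ‖((1 + ‖z.1‖) ^ N : ℂ)‖ = (1 + ‖z.1‖) ^ N := by
      rw [← Complex.ofReal_one, ← Complex.ofReal_add, ← Complex.ofReal_pow, Complex.norm_real,
        Real.norm_of_nonneg (by positivity)]
    have h2 : 1 + ‖z.1‖ ≤ (1 + ‖x - z.1‖) * (1 + ‖x‖) := by
      have : ‖z.1‖ ≤ ‖x‖ + ‖x - z.1‖ := norm_le_norm_add_norm_sub x z.1
      nlinarith [norm_nonneg x, norm_nonneg (x - z.1),
        mul_nonneg (norm_nonneg x) (norm_nonneg (x - z.1))]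
    rw [norm_mul, norm_mul, RCLike.norm_conj, norm_gaussian hε hΓ, h1]
    calc (1 + ‖z.1‖) ^ N * (envelope ε Γ (x - z.1) * ‖φ x‖)
        ≤ ((1 + ‖x - z.1‖) * (1 + ‖x‖)) ^ N * (envelope ε Γ (x - z.1) * ‖φ x‖) := by gcongr
      _ = ((1 + ‖x‖) ^ N * ‖φ x‖) * ((1 + ‖x - z.1‖) ^ N * envelope ε Γ (x - z.1)) := by
          rw [mul_pow]; ring
      _ ≤ _ := mul_le_mul (hB x) (mul_le_mul_of_nonneg_right
          (one_add_pow_le_exp (norm_nonneg _) N) he.le) (by positivity)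
          ((by positivity : (0 : ℝ) ≤ _).trans (hB x))
  have h3 := norm_integral_le_of_norm_le ((hint.comp_sub_right z.1).const_mul B)
    (Filter.Eventually.of_forall hpt)
  rw [integral_const_mul, integral_const_mul, integral_sub_right_eq_self
    (fun u : Config D => Real.exp (N * ‖u‖) * envelope ε Γ u) z.1, norm_mul,
    ← Complex.ofReal_one, ← Complex.ofReal_add, ← Complex.ofReal_pow, Complex.norm_real,
    Real.norm_of_nonneg (by positivity)] at h3
  exact h3

/-- Each power of momentum is traded, via `inner_mul_bracket_gaussian`, for brackets with other
Schwartz functions and one more power of `1 + ‖z.1‖`. The induction on `k` must therefore quantify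
over all `φ` and `N`. -/
theorem exists_pow_mul_pow_mul_norm_bracket_le (hε : 0 < ε) (hΓ : Γ.PosDef) (k : ℕ) :
    ∀ (φ : 𝓢(Config D, ℂ)) (N : ℕ), ∃ C : ℝ, ∀ z,
      (1 + ‖z.1‖) ^ N * (1 + ‖z.2‖) ^ k * ‖bracket (gaussian ε Γ z) φ‖ ≤ C := by
  induction k with
  | zero => simpa using exists_pow_mul_norm_bracket_le hε hΓ
  | succ k ih =>
    intro φ N
    have hj : ∀ j : Fin D, ∃ C : ℝ, ∀ z : Phase D,
        (1 + ‖z.1‖) ^ N * (1 + ‖z.2‖) ^ k * (|z.2 j| * ‖bracket (gaussian ε Γ z) φ‖) ≤ C := by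
      intro j
      obtain ⟨χ, hχ⟩ := exists_schwartz_bil_mul Γ (EuclideanSpace.single j 1) φ
      let φ' : 𝓢(Config D, ℂ) := LineDeriv.lineDerivOp (EuclideanSpace.single j (1 : ℝ)) φ
      have hφ' : ∀ x, φ' x = fderiv ℝ φ x (EuclideanSpace.single j 1) :=
        SchwartzMap.lineDerivOp_apply_eq_fderiv _ _
      obtain ⟨K, hK, hbil⟩ := abs_bil_le (Γ := Γ) (EuclideanSpace.single j 1)
      obtain ⟨C₁, h₁⟩ := ih φ' N
      obtain ⟨C₂, h₂⟩ := ih χ N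
      obtain ⟨C₃, h₃⟩ := ih φ (N + 1)
      refine ⟨ε * C₁ + C₂ + K * C₃, fun z => ?_⟩
      have e := inner_mul_bracket_gaussian hε hΓ (EuclideanSpace.single j 1) hφ' hχ z
      have hn : |z.2 j| * ‖bracket (gaussian ε Γ z) φ‖ ≤
          ε * ‖bracket (gaussian ε Γ z) φ'‖ + ‖bracket (gaussian ε Γ z) χ‖ +
            K * ((1 + ‖z.1‖) * ‖bracket (gaussian ε Γ z) φ‖) := by
        have e1 := congrArg norm e
        rw [norm_mul, Complex.norm_real, Real.norm_eq_abs, EuclideanSpace.inner_single_right] at e1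
        simp only [one_mul, conj_trivial] at e1
        rw [e1]
        refine (norm_sub_le _ _).trans (add_le_add ((norm_add_le _ _).trans
          (add_le_add (le_of_eq ?_) (le_of_eq ?_))) ?_)
        · simp [abs_of_pos hε]
        · simp
        · rw [norm_mul, norm_mul, Complex.norm_I, one_mul, Complex.norm_real, ← mul_assoc]
          refine mul_le_mul_of_nonneg_right ((hbil _).trans ?_) (norm_nonneg _)
          exact mul_le_mul_of_nonneg_left (by linarith) hK
      have h1 := mul_le_mul_of_nonneg_left (h₁ z) hε.le
      have h2 := h₂ z
      have h3 := mul_le_mul_of_nonneg_left (h₃ z) hK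
      set P := (1 + ‖z.1‖) ^ N * (1 + ‖z.2‖) ^ k
      have hP : 0 ≤ P := by positivity
      have h4 := mul_le_mul_of_nonneg_left hn hP
      have h5 : (1 + ‖z.1‖) ^ (N + 1) * (1 + ‖z.2‖) ^ k = P * (1 + ‖z.1‖) := by
        rw [pow_succ]; ring
      rw [h5] at h3
      linarith
    choose C hC using hj
    obtain ⟨C₀, h₀⟩ := ih φ N
    refine ⟨C₀ + ∑ j, C j, fun z => ?_⟩
    have hsum : ‖z.2‖ ≤ ∑ j, |z.2 j| := by
      have h := norm_sum_le Finset.univ fun j => z.2 j • EuclideanSpace.single j (1 : ℝ)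
      have e : ∑ j, z.2 j • EuclideanSpace.single j (1 : ℝ) = z.2 := by
        simpa using (EuclideanSpace.basisFun (Fin D) ℝ).sum_repr z.2
      rw [e] at h
      refine h.trans (le_of_eq (Finset.sum_congr rfl fun j _ => ?_))
      simp [norm_smul]
    have h1 := h₀ z
    have h2 : ∑ j, (1 + ‖z.1‖) ^ N * (1 + ‖z.2‖) ^ k *
        (|z.2 j| * ‖bracket (gaussian ε Γ z) φ‖) ≤ ∑ j, C j :=
      Finset.sum_le_sum fun j _ => hC j z
    rw [← Finset.mul_sum, ← Finset.sum_mul] at h2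
    set P := (1 + ‖z.1‖) ^ N * (1 + ‖z.2‖) ^ k
    have hP : 0 ≤ P := by positivity
    have h3 : (1 + ‖z.1‖) ^ N * (1 + ‖z.2‖) ^ (k + 1) = P * (1 + ‖z.2‖) := by
      rw [pow_succ]; ring
    rw [h3]
    have h4 := mul_le_mul_of_nonneg_left (mul_le_mul_of_nonneg_right hsum
      (norm_nonneg (bracket (gaussian ε Γ z) φ))) hP
    linarith

/-- The wavepacket transform of a Schwartz function decays rapidly. -/
theorem exists_norm_bracket_le (hε : 0 < ε) (hΓ : Γ.PosDef) (φ : 𝓢(Config D, ℂ)) (N : ℕ) :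
    ∃ C : ℝ, ∀ z, (1 + ‖z‖) ^ N * ‖bracket (gaussian ε Γ z) φ‖ ≤ C := by
  obtain ⟨C, h⟩ := exists_pow_mul_pow_mul_norm_bracket_le hε hΓ N φ N
  refine ⟨C, fun z => le_trans (mul_le_mul_of_nonneg_right ?_ (norm_nonneg _)) (h z)⟩
  rw [← mul_pow]
  refine pow_le_pow_left₀ (by positivity) ?_ N
  have h1 := norm_nonneg z.1
  have h2 := norm_nonneg z.2
  have h3 : ‖z‖ ≤ ‖z.1‖ + ‖z.2‖ := by
    rw [Prod.norm_def]
    exact max_le (by linarith) (by linarith)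
  nlinarith [mul_nonneg h1 h2]

theorem integrable_pow_mul_norm_bracket (hε : 0 < ε) (hΓ : Γ.PosDef) (φ : 𝓢(Config D, ℂ)) (N : ℕ) :
    Integrable fun z => (1 + ‖z‖) ^ N * ‖bracket (gaussian ε Γ z) φ‖ := by
  have : (volume : Measure (Phase D)).IsAddHaarMeasure := Measure.prod.instIsAddHaarMeasure _ _
  -- The exponent must exceed the dimension of phase space for `(1 + ‖z‖) ^ (-d)` to be integrable.
  set d := Module.finrank ℝ (Phase D) + 1
  obtain ⟨C, h⟩ := exists_norm_bracket_le hε hΓ φ (N + d)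
  have hint : Integrable fun z : Phase D => (1 + ‖z‖) ^ (-(d : ℝ)) :=
    integrable_one_add_norm (by simp [d])
  have hm : StronglyMeasurable fun z => bracket (gaussian ε Γ z) φ :=
    stronglyMeasurable_bracket φ.continuous.aestronglyMeasurable
  have hc : Continuous fun z : Phase D => (1 + ‖z‖) ^ N :=
    (continuous_const.add continuous_norm).pow N
  refine (hint.const_mul C).mono' (hc.aestronglyMeasurable.mul hm.norm.aestronglyMeasurable)
    (Filter.Eventually.of_forall fun z => ?_)
  have hz : 0 < 1 + ‖z‖ := by positivity
  rw [Real.norm_of_nonneg (by positivity), Real.rpow_neg hz.le, Real.rpow_natCast,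
    ← div_eq_mul_inv, le_div_iff₀ (by positivity)]
  have := h z
  rw [pow_add] at this
  linarith

end SchwartzDecay

end HermanKluk

/-! ### Variance versus second moment for general densities -/

section ImportanceSampling

variable {X : Type*} [MeasurableSpace X] {μ : Measure X}

/-- Compares the variance integrand with the second moment in both directions, through `b = E` and,
after shifting, `b = -E`. -/
theorem norm_sq_mul_le (a b : ℂ) {r : ℝ} (hr : 0 ≤ r) :
    ‖a‖ ^ 2 * r ≤ 2 * (‖a - b‖ ^ 2 * r) + 2 * ‖b‖ ^ 2 * r := by
  have h : ‖a‖ ≤ ‖a - b‖ + ‖b‖ := by simpa using norm_add_le (a - b) b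
  have h1 : ‖a‖ ^ 2 ≤ 2 * ‖a - b‖ ^ 2 + 2 * ‖b‖ ^ 2 := by
    nlinarith [norm_nonneg a, norm_nonneg b, norm_nonneg (a - b), sq_nonneg (‖a - b‖ - ‖b‖)]
  nlinarith [mul_le_mul_of_nonneg_right h1 hr]

/-- A second moment with respect to a finite density is infinite if it dominates a divergent
integral. -/
theorem lintegral_norm_div_sub_sq_eq_top {ρ : X → ℝ} (hρm : Measurable ρ)
    (hρ : ∫⁻ w, ENNReal.ofReal (ρ w) ∂μ ≠ ⊤) {F G : X → ℂ} (E : ℂ) {c : ℝ} (hc : 0 < c)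
    (h : ∀ᵐ w ∂μ, 0 ≤ ρ w ∧ c * ‖G w‖ ^ 2 ≤ ‖F w / (ρ w : ℂ)‖ ^ 2 * ρ w)
    (hG : ∫⁻ w, ‖G w‖ₑ ^ 2 ∂μ = ⊤) :
    ∫⁻ w, ENNReal.ofReal (‖F w / (ρ w : ℂ) - E‖ ^ 2 * ρ w) ∂μ = ⊤ := by
  by_contra hfin
  have h1 : ∫⁻ w, ENNReal.ofReal c * ‖G w‖ₑ ^ 2 ∂μ ≤
      ∫⁻ w, ENNReal.ofReal 2 * ENNReal.ofReal (‖F w / (ρ w : ℂ) - E‖ ^ 2 * ρ w) +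
        ENNReal.ofReal (2 * ‖E‖ ^ 2) * ENNReal.ofReal (ρ w) ∂μ := by
    refine lintegral_mono_ae ?_
    filter_upwards [h] with w hw
    obtain ⟨h0, hw⟩ := hw
    rw [← ofReal_norm, ← ENNReal.ofReal_pow (norm_nonneg _), ← ENNReal.ofReal_mul hc.le,
      ← ENNReal.ofReal_mul two_pos.le, ← ENNReal.ofReal_mul (by positivity),
      ← ENNReal.ofReal_add (by positivity) (by positivity)]
    exact ENNReal.ofReal_le_ofReal (hw.trans (norm_sq_mul_le _ E h0))
  rw [lintegral_const_mul' _ _ ENNReal.ofReal_ne_top, hG,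
    ENNReal.mul_top (ENNReal.ofReal_pos.2 hc).ne',
    lintegral_add_right _ (hρm.ennreal_ofReal.const_mul _),
    lintegral_const_mul' _ _ ENNReal.ofReal_ne_top, lintegral_const_mul' _ _ ENNReal.ofReal_ne_top,
    top_le_iff] at h1
  exact ENNReal.add_ne_top.2 ⟨ENNReal.mul_ne_top ENNReal.ofReal_ne_top hfin,
    ENNReal.mul_ne_top ENNReal.ofReal_ne_top hρ⟩ h1

/-- Second moments with respect to a product density proportional to `u ⊗ u` are finite for
integrands bounded by `u ⊗ (W u)`. -/
theorem lintegral_norm_div_sub_sq_lt_top [SFinite μ] {u W : X → ℝ} (hu0 : ∀ x, 0 ≤ u x)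
    (hu : Integrable u μ) (hW : Integrable (fun x => W x ^ 2 * u x) μ) {F : X × X → ℂ} {K : ℝ}
    (hF : ∀ w, ‖F w‖ ≤ K * (u w.1 * (W w.2 * u w.2))) {a : ℝ} (ha : 0 < a) (E : ℂ) :
    ∫⁻ w, ENNReal.ofReal (‖F w / ((a * u w.1 * (a * u w.2) : ℝ) : ℂ) - E‖ ^ 2
      * (a * u w.1 * (a * u w.2))) ∂(μ.prod μ) < ⊤ := by
  have hint : Integrable (fun w : X × X => 2 * (K ^ 2 / a ^ 2) * (u w.1 * (W w.2 ^ 2 * u w.2))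
      + 2 * ‖E‖ ^ 2 * a ^ 2 * (u w.1 * u w.2)) (μ.prod μ) :=
    ((hu.mul_prod hW).const_mul _).add ((hu.mul_prod hu).const_mul _)
  refine lt_of_le_of_lt (lintegral_mono fun w => ENNReal.ofReal_le_ofReal ?_)
    hint.lintegral_lt_top
  have h1 := hu0 w.1
  have h2 := hu0 w.2
  set r : ℝ := a * u w.1 * (a * u w.2) with hr
  have hr0 : 0 ≤ r := by positivity
  have h3 := norm_sq_mul_le (F w / (r : ℂ) - E) (-E) hr0
  rw [sub_neg_eq_add, sub_add_cancel, norm_neg] at h3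
  -- Where a factor `u` vanishes, so does `r`, and both sides are zero. Elsewhere the square of the
  -- bound on `F` divided by `r` leaves one power of each `u`.
  have h4 : ‖F w / (r : ℂ)‖ ^ 2 * r ≤ K ^ 2 / a ^ 2 * (u w.1 * (W w.2 ^ 2 * u w.2)) := by
    rw [norm_div, Complex.norm_real, Real.norm_of_nonneg hr0]
    rcases h1.eq_or_lt with h1 | h1
    · simp [hr, ← h1]
    rcases h2.eq_or_lt with h2 | h2
    · simp [hr, ← h2]
    have h5 := pow_le_pow_left₀ (norm_nonneg _) (hF w) 2
    have e : (‖F w‖ / r) ^ 2 * r = ‖F w‖ ^ 2 / r := by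
      field_simp
    rw [e, div_le_iff₀ (by positivity)]
    refine h5.trans (le_of_eq ?_)
    rw [hr]
    field_simp
  have e : 2 * ‖E‖ ^ 2 * r = 2 * ‖E‖ ^ 2 * a ^ 2 * (u w.1 * u w.2) := by rw [hr]; ring
  linarith

end ImportanceSampling

namespace HermanKluk

open Set
open scoped Topology InnerProductSpace Matrix

variable {D : ℕ} {ε : ℝ} {Γ : Matrix (Fin D) (Fin D) ℝ} {V : Config D → ℝ} {ψ₀ : Config D → ℂ}

/-! ### The two sampling densities -/

section Variance

theorem norm_initialFactor (hε : 0 < ε) (w : DoublePhase D) :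
    ‖initialFactor ε Γ ψ₀ w‖ = ((2 * Real.pi * ε) ^ (2 * D))⁻¹ *
      (‖bracket (gaussian ε Γ w.1) ψ₀‖ * ‖bracket (gaussian ε Γ w.2) ψ₀‖) := by
  have hπ := Real.pi_pos
  rw [initialFactor, norm_mul, norm_mul, norm_bracket_comm ψ₀, Complex.norm_real,
    Real.norm_of_nonneg (by positivity)]

theorem norm_phaseFactor (t : ℝ) (w : DoublePhase D) :
    ‖phaseFactor ε Γ V t w‖ = ‖prefactor Γ V t w.1‖ * ‖prefactor Γ V t w.2‖ := by
  have h : Complex.I * ((action V t w.2 - action V t w.1 : ℝ) : ℂ) / (ε : ℂ) =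
      (((action V t w.2 - action V t w.1) / ε : ℝ) : ℂ) * Complex.I := by
    push_cast
    ring
  rw [phaseFactor, h, norm_mul, Complex.norm_exp_ofReal_mul_I, mul_one, norm_mul, RCLike.norm_conj]

theorem norm_integrand (A : Observable D) (t : ℝ) (w : DoublePhase D) :
    ‖integrand ε Γ V ψ₀ A t w‖ = ‖initialFactor ε Γ ψ₀ w‖ * ‖phaseFactor ε Γ V t w‖
      * ‖operatorFactor ε Γ V A t w‖ := by
  rw [integrand, norm_mul, norm_mul]

theorem measurable_husimi (hψ₀ : AEStronglyMeasurable ψ₀ volume) :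
    Measurable (husimi ε Γ ψ₀) :=
  ((stronglyMeasurable_bracket hψ₀).norm.measurable.pow_const 2).const_mul _

theorem measurable_double {ρ : Phase D → ℝ} (hρ : Measurable ρ) : Measurable (double ρ) :=
  (hρ.comp measurable_fst).mul (hρ.comp measurable_snd)

theorem lintegral_husimi_ne_top (hε : 0 < ε) (hΓ : Γ.PosDef) (hψ₀ : MemLp ψ₀ 2 volume) :
    ∫⁻ z, ENNReal.ofReal (husimi ε Γ ψ₀ z) ≠ ⊤ := by
  obtain ⟨c, -, hc, h⟩ := exists_moyal (D := D) hε hΓ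
  have hπ := Real.pi_pos
  have e : ∀ z, ENNReal.ofReal (husimi ε Γ ψ₀ z) =
      ENNReal.ofReal ((2 * Real.pi * ε) ^ D)⁻¹ * ‖bracket (gaussian ε Γ z) ψ₀‖ₑ ^ 2 := fun z => by
    rw [husimi, ENNReal.ofReal_mul (by positivity), ENNReal.ofReal_pow (norm_nonneg _), ofReal_norm]
  rw [lintegral_congr e, lintegral_const_mul' _ _ ENNReal.ofReal_ne_top, h ψ₀ hψ₀]
  exact ENNReal.mul_ne_top ENNReal.ofReal_ne_top
    (ENNReal.mul_ne_top hc hψ₀.lintegral_enorm_sq_lt_top.ne)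

theorem lintegral_double_ne_top {ρ : Phase D → ℝ} (hρ0 : ∀ z, 0 ≤ ρ z) (hρm : Measurable ρ)
    (h : ∫⁻ z, ENNReal.ofReal (ρ z) ≠ ⊤) : ∫⁻ w, ENNReal.ofReal (double ρ w) ≠ ⊤ := by
  have e : ∀ w, ENNReal.ofReal (double ρ w) =
      ENNReal.ofReal (ρ w.1) * ENNReal.ofReal (ρ w.2) := fun w => ENNReal.ofReal_mul (hρ0 _)
  rw [lintegral_congr e, Measure.volume_eq_prod (Phase D) (Phase D),
    lintegral_prod_mul hρm.ennreal_ofReal.aemeasurable hρm.ennreal_ofReal.aemeasurable]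
  exact ENNReal.mul_ne_top h h

theorem husimi_nonneg (hε : 0 < ε) (z : Phase D) : 0 ≤ husimi ε Γ ψ₀ z := by
  have hπ := Real.pi_pos
  unfold husimi
  positivity

/-- Off the zeros of the transform the Husimi weights cancel the initial factor exactly, so nothing
depending on `ψ₀` is left; the prefactors have modulus at least 1 and may be dropped. -/
theorem le_norm_integrand_div_husimi (hε : 0 < ε) (hΓ : Γ.PosDef) (hV : IsSubquadratic V)
    (A : Observable D) (t : ℝ) {w : DoublePhase D} (h1 : bracket (gaussian ε Γ w.1) ψ₀ ≠ 0)
    (h2 : bracket (gaussian ε Γ w.2) ψ₀ ≠ 0) :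
    ((2 * Real.pi * ε) ^ (2 * D))⁻¹ * ‖operatorFactor ε Γ V A t w‖ ^ 2 ≤
      ‖integrand ε Γ V ψ₀ A t w / (double (husimi ε Γ ψ₀) w : ℂ)‖ ^ 2
        * double (husimi ε Γ ψ₀) w := by
  have hπ := Real.pi_pos
  have r1 := hV.one_le_norm_prefactor hΓ t w.1
  have r2 := hV.one_le_norm_prefactor hΓ t w.2
  have hρ : 0 ≤ double (husimi ε Γ ψ₀) w :=
    mul_nonneg (husimi_nonneg hε _) (husimi_nonneg hε _)
  rw [norm_div, Complex.norm_real, Real.norm_of_nonneg hρ, norm_integrand, norm_initialFactor hε,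
    norm_phaseFactor, double, husimi, husimi]
  replace h1 := norm_pos_iff.2 h1
  replace h2 := norm_pos_iff.2 h2
  set b₁ := ‖bracket (gaussian ε Γ w.1) ψ₀‖
  set b₂ := ‖bracket (gaussian ε Γ w.2) ψ₀‖
  set R₁ := ‖prefactor Γ V t w.1‖
  set R₂ := ‖prefactor Γ V t w.2‖
  set o := ‖operatorFactor ε Γ V A t w‖
  have hs : 0 < (2 * Real.pi * ε) ^ D := by positivity
  rw [mul_comm 2 D, pow_mul]
  set s := (2 * Real.pi * ε) ^ D
  have e : ((s ^ 2)⁻¹ * (b₁ * b₂) * (R₁ * R₂) * o / (s⁻¹ * b₁ ^ 2 * (s⁻¹ * b₂ ^ 2))) ^ 2 *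
      (s⁻¹ * b₁ ^ 2 * (s⁻¹ * b₂ ^ 2)) = (s ^ 2)⁻¹ * ((R₁ * R₂) ^ 2 * o ^ 2) := by
    field_simp
  rw [e]
  refine mul_le_mul_of_nonneg_left ?_ (by positivity)
  exact le_mul_of_one_le_left (sq_nonneg o) (one_le_pow₀ (one_le_mul_of_one_le_of_one_le r1 r2))

theorem variance_husimi_eq_top (hD : 0 < D) (hε : 0 < ε) (hΓ : Γ.PosDef) (hV : IsSubquadratic V)
    (hψ₀ : MemLp ψ₀ 2 volume) (hne : ∫⁻ x, ‖ψ₀ x‖ₑ ^ 2 ≠ 0) {A : Observable D}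
    (hA : ¬ A.IsZero ε V) (t : ℝ) :
    HermanKluk.variance ε Γ V ψ₀ A t (double (husimi ε Γ ψ₀)) = ⊤ := by
  have hπ := Real.pi_pos
  have hae := ae_bracket_gaussian_ne_zero hε hΓ hψ₀ hne
  have hae2 : ∀ᵐ w : DoublePhase D, bracket (gaussian ε Γ w.1) ψ₀ ≠ 0 ∧
      bracket (gaussian ε Γ w.2) ψ₀ ≠ 0 :=
    (Measure.quasiMeasurePreserving_fst.ae hae).and (Measure.quasiMeasurePreserving_snd.ae hae)
  refine lintegral_norm_div_sub_sq_eq_top (measurable_double (measurable_husimi hψ₀.1))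
    (lintegral_double_ne_top (husimi_nonneg hε) (measurable_husimi hψ₀.1)
      (lintegral_husimi_ne_top hε hΓ hψ₀)) (expectation ε Γ V ψ₀ A t)
    (c := ((2 * Real.pi * ε) ^ (2 * D))⁻¹) (by positivity) ?_
    (A.lintegral_enorm_sq_operatorFactor hD hε hΓ hV hA t)
  filter_upwards [hae2] with w hw
  exact ⟨mul_nonneg (husimi_nonneg hε _) (husimi_nonneg hε _),
    le_norm_integrand_div_husimi hε hΓ hV A t hw.1 hw.2⟩

theorem Observable.IsZero.variance_eq_zero {A : Observable D} (hA : A.IsZero ε V) (t : ℝ)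
    (ρ : DoublePhase D → ℝ) : HermanKluk.variance ε Γ V ψ₀ A t ρ = 0 := by
  have h : ∀ w, integrand ε Γ V ψ₀ A t w = 0 := fun w => by
    rw [integrand, hA.operatorFactor_eq_zero, mul_zero]
  have hE : expectation ε Γ V ψ₀ A t = 0 := by simp [expectation, h]
  simp [HermanKluk.variance, h, hE]

theorem exists_norm_integrand_le (hε : 0 < ε) (hΓ : Γ.PosDef) (hV : IsSubquadratic V)
    (A : Observable D) (t : ℝ) : ∃ (K : ℝ) (m : ℕ), ∀ w, ‖integrand ε Γ V ψ₀ A t w‖ ≤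
      K * (‖bracket (gaussian ε Γ w.1) ψ₀‖ *
        ((1 + ‖w.2‖) ^ m * ‖bracket (gaussian ε Γ w.2) ψ₀‖)) := by
  have hπ := Real.pi_pos
  obtain ⟨B, hB, hR⟩ := hV.exists_norm_prefactor_le hΓ t
  obtain ⟨C, m, hC, hO⟩ := A.exists_norm_operatorFactor_le hε hΓ hV t
  refine ⟨((2 * Real.pi * ε) ^ (2 * D))⁻¹ * (B * B) * C, m, fun w => ?_⟩
  rw [norm_integrand, norm_initialFactor hε, norm_phaseFactor]
  have h1 := hO w
  have h2 := mul_le_mul (hR w.1) (hR w.2) (norm_nonneg _) hB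
  set b₁ := ‖bracket (gaussian ε Γ w.1) ψ₀‖
  set b₂ := ‖bracket (gaussian ε Γ w.2) ψ₀‖
  have hb₁ : 0 ≤ b₁ := norm_nonneg _
  have hb₂ : 0 ≤ b₂ := norm_nonneg _
  calc _ ≤ ((2 * Real.pi * ε) ^ (2 * D))⁻¹ * (b₁ * b₂) * (B * B) * (C * (1 + ‖w.2‖) ^ m) := by
        gcongr
    _ = _ := by ring

/-- Relies on continuity in `z` of the prefactor and the action and on measurability of the flow;
none of these is evident from definitions by choice. -/
theorem aestronglyMeasurable_integrand (hε : 0 < ε) (hΓ : Γ.PosDef) (hV : IsSubquadratic V)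
    (hψ₀ : AEStronglyMeasurable ψ₀ volume) (A : Observable D) (t : ℝ) :
    AEStronglyMeasurable (integrand ε Γ V ψ₀ A t) volume := by
  have hb : StronglyMeasurable fun z => bracket (gaussian ε Γ z) ψ₀ :=
    stronglyMeasurable_bracket hψ₀
  have hb' : StronglyMeasurable fun z => bracket ψ₀ (gaussian ε Γ z) := by
    simp only [bracket_conj ψ₀]
    exact Complex.continuous_conj.comp_stronglyMeasurable hb
  have h1 : StronglyMeasurable (initialFactor ε Γ ψ₀) :=
    ((hb'.comp_measurable measurable_fst).mul (hb.comp_measurable measurable_snd)).const_mul _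
  have hR := hV.continuous_prefactor hΓ t
  have hS := hV.continuous_action t
  have hS2 : Continuous fun w : DoublePhase D => action V t w.2 - action V t w.1 :=
    (hS.comp continuous_snd).sub (hS.comp continuous_fst)
  have h2 : Continuous (phaseFactor ε Γ V t) :=
    ((Complex.continuous_conj.comp (hR.comp continuous_fst)).mul (hR.comp continuous_snd)).mul
      (Complex.continuous_exp.comp
        ((continuous_const.mul (Complex.continuous_ofReal.comp hS2)).div_const _))
  exact ((h1.mul h2.stronglyMeasurable).mul
    (A.stronglyMeasurable_operatorFactor hε hΓ hV t)).aestronglyMeasurable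

theorem integrable_integrand (hε : 0 < ε) (hΓ : Γ.PosDef) (hV : IsSubquadratic V)
    (hψ₀ : AEStronglyMeasurable ψ₀ volume)
    (hdec : ∀ N : ℕ, Integrable fun z => (1 + ‖z‖) ^ N * ‖bracket (gaussian ε Γ z) ψ₀‖)
    (A : Observable D) (t : ℝ) : Integrable (integrand ε Γ V ψ₀ A t) volume := by
  obtain ⟨K, m, h⟩ := exists_norm_integrand_le (ψ₀ := ψ₀) hε hΓ hV A t
  have h0 : Integrable fun z => ‖bracket (gaussian ε Γ z) ψ₀‖ := by simpa using hdec 0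
  exact ((h0.mul_prod (hdec m)).const_mul K).mono'
    (aestronglyMeasurable_integrand hε hΓ hV hψ₀ A t) (Filter.Eventually.of_forall h)

theorem sqrtHusimi_eq (z : Phase D) : sqrtHusimi ε Γ ψ₀ z =
    ((2 * Real.pi * ε) ^ D)⁻¹ / sqrtHusimiConst ε Γ ψ₀ * ‖bracket (gaussian ε Γ z) ψ₀‖ := by
  rw [sqrtHusimi, norm_bracket_comm]

theorem sqrtHusimiConst_eq : sqrtHusimiConst ε Γ ψ₀ =
    ((2 * Real.pi * ε) ^ D)⁻¹ * ∫ z, ‖bracket (gaussian ε Γ z) ψ₀‖ := by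
  simp only [sqrtHusimiConst, norm_bracket_comm ψ₀]

/-- A vanishing integral would make the transform zero almost everywhere, whereas it is nonzero
almost everywhere. -/
theorem sqrtHusimiConst_pos (hε : 0 < ε) (hΓ : Γ.PosDef) (hψ₀ : MemLp ψ₀ 2 volume)
    (hne : ∫⁻ x, ‖ψ₀ x‖ₑ ^ 2 ≠ 0)
    (hint : Integrable fun z => ‖bracket (gaussian ε Γ z) ψ₀‖) :
    0 < sqrtHusimiConst ε Γ ψ₀ := by
  have hπ := Real.pi_pos
  rw [sqrtHusimiConst_eq]
  refine mul_pos (by positivity) ?_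
  refine lt_of_le_of_ne (integral_nonneg fun z => norm_nonneg _) fun h => ?_
  have h0 := (integral_eq_zero_iff_of_nonneg (fun z => norm_nonneg _) hint).1 h.symm
  have : (volume : Measure (Phase D)).IsAddHaarMeasure := Measure.prod.instIsAddHaarMeasure _ _
  obtain ⟨z, hz, hz'⟩ := (h0.and (ae_bracket_gaussian_ne_zero hε hΓ hψ₀ hne)).exists
  exact hz' (norm_eq_zero.1 hz)

theorem integral_sqrtHusimi (hκ : 0 < sqrtHusimiConst ε Γ ψ₀) :
    ∫ z, sqrtHusimi ε Γ ψ₀ z = 1 := by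
  simp only [sqrtHusimi_eq]
  rw [integral_const_mul, div_mul_eq_mul_div, ← sqrtHusimiConst_eq, div_self hκ.ne']

theorem variance_sqrtHusimi_lt_top (hε : 0 < ε) (hΓ : Γ.PosDef) (hV : IsSubquadratic V)
    (hκ : 0 < sqrtHusimiConst ε Γ ψ₀)
    (hdec : ∀ N : ℕ, Integrable fun z => (1 + ‖z‖) ^ N * ‖bracket (gaussian ε Γ z) ψ₀‖)
    (A : Observable D) (t : ℝ) :
    HermanKluk.variance ε Γ V ψ₀ A t (double (sqrtHusimi ε Γ ψ₀)) < ⊤ := by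
  have hπ := Real.pi_pos
  obtain ⟨K, m, h⟩ := exists_norm_integrand_le (ψ₀ := ψ₀) hε hΓ hV A t
  have h0 : Integrable fun z => ‖bracket (gaussian ε Γ z) ψ₀‖ := by simpa using hdec 0
  have h2 : Integrable fun z => ((1 + ‖z‖) ^ m) ^ 2 * ‖bracket (gaussian ε Γ z) ψ₀‖ := by
    simpa only [← pow_mul] using hdec (m * 2)
  have := lintegral_norm_div_sub_sq_lt_top (fun z => norm_nonneg _) h0 h2 h
    (a := ((2 * Real.pi * ε) ^ D)⁻¹ / sqrtHusimiConst ε Γ ψ₀) (by positivity)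
    (expectation ε Γ V ψ₀ A t)
  simp only [HermanKluk.variance, double, sqrtHusimi_eq]
  exact this

end Variance

end HermanKluk

/-! ### Proof of the proposition -/

open HermanKluk
theorem proposition3p3 {D : ℕ} (hD : 0 < D) (ε : ℝ) (hε : 0 < ε)
    (Γ : Matrix (Fin D) (Fin D) ℝ) (hΓ : Γ.PosDef)
    (V : Config D → ℝ) (hV : IsSubquadratic V)
    (ψ₀ : Config D → ℂ) (hψ₀ : MemLp ψ₀ 2 volume) (hnorm : ∫ x, ‖ψ₀ x‖ ^ 2 = 1)
    (A : Observable D) (τ : ℝ) (hτ : 0 < τ) (t : ℝ) (ht : t ∈ Set.Icc 0 τ) :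
    (HermanKluk.variance ε Γ V ψ₀ A t (double (husimi ε Γ ψ₀)) < ⊤ ↔ A.IsZero ε V) ∧
    ((∃ φ : 𝓢(Config D, ℂ), ψ₀ =ᵐ[volume] φ) →
      -- the sqrt-Husimi density and the expectation value are well-defined
      (Integrable (sqrtHusimi ε Γ ψ₀) volume ∧ ∫ z, sqrtHusimi ε Γ ψ₀ z = 1) ∧
      Integrable (integrand ε Γ V ψ₀ A t) volume ∧
      HermanKluk.variance ε Γ V ψ₀ A t (double (sqrtHusimi ε Γ ψ₀)) < ⊤) := by
  have hne : ∫⁻ x, ‖ψ₀ x‖ₑ ^ 2 ≠ 0 := fun h => by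
    rw [lintegral_eq_zero_iff' (hψ₀.1.enorm.pow_const 2)] at h
    have h0 : ∫ x, ‖ψ₀ x‖ ^ 2 = 0 := integral_eq_zero_of_ae (by
      filter_upwards [h] with x hx
      simpa using hx)
    rw [h0] at hnorm
    exact zero_ne_one hnorm
  refine ⟨⟨fun hfin => ?_, fun hA => ?_⟩, ?_⟩
  · by_contra hA
    exact hfin.ne (variance_husimi_eq_top hD hε hΓ hV hψ₀ hne hA t)
  · rw [hA.variance_eq_zero]
    exact ENNReal.zero_lt_top
  · rintro ⟨φ, hφ⟩
    -- The brackets depend only on the almost-everywhere class of `ψ₀`, so the rapid decay for `φ`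
    -- holds for `ψ₀` as well.
    have hdec : ∀ N : ℕ,
        Integrable fun z => (1 + ‖z‖) ^ N * ‖bracket (gaussian ε Γ z) ψ₀‖ := fun N => by
      simpa only [bracket_congr_right hφ] using integrable_pow_mul_norm_bracket hε hΓ φ N
    have h0 : Integrable fun z => ‖bracket (gaussian ε Γ z) ψ₀‖ := by simpa using hdec 0
    have hκ := sqrtHusimiConst_pos hε hΓ hψ₀ hne h0
    refine ⟨⟨?_, integral_sqrtHusimi hκ⟩, integrable_integrand hε hΓ hV hψ₀.1 hdec A t,
      variance_sqrtHusimi_lt_top hε hΓ hV hκ hdec A t⟩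
    exact (h0.const_mul _).congr (Filter.Eventually.of_forall fun z => (sqrtHusimi_eq z).symm)
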